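/- A betweenness structure is a pair $\mathcal{B}=(X,\beta)$ of a nonempty finite set $X$ and a relation $\beta\subseteq X^3$; write $(x\,y\,z)$ for $(x,y,z)\in\beta$. It is almost-metrizable if for all $x,y,z,w\in X$: (P1) $(x\,x\,z)$; (P2) $(x\,y\,z)\Rightarrow(z\,y\,x)$; (P3) $(x\,y\,z)\wedge(y\,x\,z)\Rightarrow x=y$; (P4) $(x\,y\,z)\wedge(x\,w\,y)\Rightarrow(x\,w\,z)\wedge(w\,y\,z)$. The order of $\mathcal{B}$ is $|X|$. A three-element subset of $X$ is collinear if its elements can be labelled $x,y,z$ with $(x\,y\,z)$, and is a triangle otherwise; the co-size of $\mathcal{B}$ is its number of triangles. Two betweenness structures are isomorphic ($\simeq$) if there is a bijection between their ground sets that preserves betweenness in both directions. For an integer $n\ge 0$ and an integer $m$, let $B(n,m)$ be the class of almost-metrizable betweenness structures of order $n$ and co-size $m$. For $n\ge 6$ and $1\le i\le\lceil\frac{n-5}{2}\rceil$ let $T_{n,i}$ be the simple graph with vertices $x_1,\dots,x_{n-4},y,z,u,v$ and edges $\{x_j,x_{j+1}\}$ ($1\le j\le n-5$, $j\ne i$),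 $\{x_i,y\}$, $\{x_i,z\}$, $\{y,u\}$, $\{y,v\}$, $\{z,u\}$, $\{z,v\}$, $\{u,x_{i+1}\}$, $\{v,x_{i+1}\}$. Let $\mathcal{T}_{n,i}$ be the betweenness structure on its vertex set in which $(a\,b\,c)$ holds if and only if $d(a,c)=d(a,b)+d(b,c)$, where $d$ is the graph distance of $T_{n,i}$. Theorem. 1. Let $c\ge 11$ be an integer. Then, for every integer $n\ge 0$, $B(n,2n-c)\ne\emptyset$ if and only if $n=c/2$ or $c-4\le n\le c-2$. 2. For every integer $n\ge 0$, $B(n,2n-10)\ne\emptyset$ if and only if $n\ge 5$. Further, if $n\ge 9$ and $\mathcal{B}\in B(n,2n-10)$, then $\mathcal{B}\simeq\mathcal{T}_{n,i}$ for some $1\le i\le\lceil\frac{n-5}{2}\rceil$. 3. For all $6\le n<9$ there exists $\mathcal{B}\in B(n,2n-10)$ such that $\mathcal{B}\not\simeq\mathcal{T}_{n,i}$ for every $1\le i\le\lceil\frac{n-5}{2}\rceil$. -/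

import Mathlib

universe u v

/-- A betweenness structure `(X, β)`: a nonempty finite ground set `X` together with an arbitrary
ternary relation `β` on `X`; `btw x y z` is read "`y` is between `x` and `z`". -/
structure BetweennessStructure : Type (u + 1) where
  /-- the ground set `X` -/
  carrier : Type u
  [nonempty : Nonempty carrier]
  [finite : Finite carrier]
  /-- the betweenness relation `β` -/
  btw : carrier → carrier → carrier → Prop

namespace BetweennessStructure

/-- The four elementary properties of metric betweenness. -/
structure IsAlmostMetrizable (𝓑 : BetweennessStructure.{u}) : Prop where
  btw_left : ∀ x z : 𝓑.carrier, 𝓑.btw x x z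
  symm : ∀ x y z : 𝓑.carrier, 𝓑.btw x y z → 𝓑.btw z y x
  antisymm : ∀ x y z : 𝓑.carrier, 𝓑.btw x y z → 𝓑.btw y x z → x = y
  four_relations : ∀ x y z w : 𝓑.carrier,
    𝓑.btw x y z → 𝓑.btw x w y → 𝓑.btw x w z ∧ 𝓑.btw w y z

/-- The order: the number of points. -/
noncomputable def order (𝓑 : BetweennessStructure.{u}) : ℕ := Nat.card 𝓑.carrier

/-- A triple (an unordered set of three points) is collinear if one of its points
is between the two others. -/
def Collinear (𝓑 : BetweennessStructure.{u}) (T : Finset 𝓑.carrier) : Prop :=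
  ∃ x ∈ T, ∃ y ∈ T, ∃ z ∈ T, x ≠ y ∧ y ≠ z ∧ x ≠ z ∧ 𝓑.btw x y z

/-- The triangles: the triples that are not collinear. -/
def triangles (𝓑 : BetweennessStructure.{u}) : Set (Finset 𝓑.carrier) :=
  {T | T.card = 3 ∧ ¬ 𝓑.Collinear T}

/-- The co-size: the number of triangles. -/
noncomputable def coSize (𝓑 : BetweennessStructure.{u}) : ℕ := 𝓑.triangles.ncard

/-- Isomorphism: a bijection of the ground sets that preserves the betweenness relation in both
directions. -/
def Isomorphic (𝓐 : BetweennessStructure.{u}) (𝓑 : BetweennessStructure.{v}) : Prop :=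
  ∃ e : 𝓐.carrier ≃ 𝓑.carrier,
    ∀ x y z : 𝓐.carrier, 𝓐.btw x y z ↔ 𝓑.btw (e x) (e y) (e z)

/-- `B n m`: the almost-metrizable betweenness structures of order `n` and co-size `m`. The co-size
parameter is an integer, so `B n m` is empty for negative `m`. -/
def B (n : ℕ) (m : ℤ) : Set BetweennessStructure.{u} :=
  {𝓑 | 𝓑.IsAlmostMetrizable ∧ 𝓑.order = n ∧ (𝓑.coSize : ℤ) = m}

/-- The betweenness structure induced by a (connected) simple graph on a nonempty finite vertex
set: `y` is between `x` and `z` iff `d(x, z) = d(x, y) + d(y, z)` for the graph metric `d`. -/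
def ofGraph {V : Type u} [Nonempty V] [Finite V] (G : SimpleGraph V) :
    BetweennessStructure.{u} where
  carrier := V
  btw x y z := G.dist x z = G.dist x y + G.dist y z

/-- The vertices `x_1, …, x_{n-4}, y, z, u, v` of the graph `T_{n,i}`. -/
inductive TVertex (n : ℕ) : Type
  | x (j : Finset.Icc 1 (n - 4)) : TVertex n
  | y : TVertex n
  | z : TVertex n
  | u : TVertex n
  | v : TVertex n

instance (n : ℕ) : Nonempty (TVertex n) := ⟨TVertex.y⟩

instance (n : ℕ) : Finite (TVertex n) :=
  Finite.of_surjective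
    (fun s : Finset.Icc 1 (n - 4) ⊕ Fin 4 =>
      Sum.elim (fun j => TVertex.x j) ![TVertex.y, TVertex.z, TVertex.u, TVertex.v] s)
    (by
      intro w
      cases w with
      | x j => exact ⟨Sum.inl j, rfl⟩
      | y => exact ⟨Sum.inr 0, rfl⟩
      | z => exact ⟨Sum.inr 1, rfl⟩
      | u => exact ⟨Sum.inr 2, rfl⟩
      | v => exact ⟨Sum.inr 3, rfl⟩)

/-- The edges of `T_{n,i}`, each listed in one orientation. -/
inductive TEdge (n i : ℕ) : TVertex n → TVertex n → Prop
  | path (j k : Finset.Icc 1 (n - 4)) (hjk : k.val = j.val + 1) (hj : j.val ≠ i) :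
      TEdge n i (.x j) (.x k)
  | xy (j : Finset.Icc 1 (n - 4)) (hj : j.val = i) : TEdge n i (.x j) .y
  | xz (j : Finset.Icc 1 (n - 4)) (hj : j.val = i) : TEdge n i (.x j) .z
  | yu : TEdge n i .y .u
  | yv : TEdge n i .y .v
  | zu : TEdge n i .z .u
  | zv : TEdge n i .z .v
  | ux (k : Finset.Icc 1 (n - 4)) (hk : k.val = i + 1) : TEdge n i .u (.x k)
  | vx (k : Finset.Icc 1 (n - 4)) (hk : k.val = i + 1) : TEdge n i .v (.x k)

/-- The simple graph `T_{n,i}` (used for `n ≥ 6` and `1 ≤ i ≤ ⌈(n - 5) / 2⌉`, where it is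
connected): the path `x_1 … x_{n-4}` with the edge `x_i x_{i+1}` replaced by the edges
`x_i y`, `x_i z`, `y u`, `y v`, `z u`, `z v`, `u x_{i+1}`, `v x_{i+1}`. -/
def graphT (n i : ℕ) : SimpleGraph (TVertex n) := SimpleGraph.fromRel (TEdge n i)

/-- The betweenness structure induced by the graph `T_{n,i}`. -/
def structT (n i : ℕ) : BetweennessStructure.{0} := ofGraph (graphT n i)

end BetweennessStructure

/-! Write `m` for the number of triangles of a set of `n` points. The theorem rests on a gap
phenomenon: below `2n - 10` only the values `0`, `n - 4`, `n - 3`, `n - 2` of `m` occur, and for `n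
≥ 9` the value `2n - 10` comes from one family only.

Triangle-free sets with at least five points are linearly ordered (`exists_isPath`); the 4-cycle is
the obstruction on four points. If all triangles pass through one point `p`, the other points
therefore form a path once there are at least five of them, and the structure is recorded by the
position of `p` relative to each pair of path points. (P4) gives a finite table of admissible
triples of positions, and two exhaustive searches settle the small cases: with five path points
there is never exactly one triangle, and with six the triangles share a second point or number at
least five.

Deleting points propagates these facts. A set with a triangle has `m ≥ n - 4`
(`card_le_card_tri_add_four`, `n ≥ 5`). Triangles with a common point but no common pair number at
least `2n - 9` (`two_mul_card_le_of_common_point`, `n ≥ 7`). If `m ≤ 2n - 11` and `n ≥ 6`, all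
triangles share a pair (`sharedPair_of_card_tri_le`), whence `m ≤ n - 2`. The recurring device is
that a point `y` common to all triangles avoiding `p` has large degree, while deleting `y` still
leaves many triangles.

For `m = 2n - 10` and `n ≥ 9` all these estimates are equalities. This yields two disjoint pairs `y,
z` and `u, v` such that each triangle consists of one pair and a point outside both, each pair being
collinear with exactly one outside point (`exists_twoTwins`). A pair that extends a common path
either occupies one gap or sits at opposite ends; the second case is impossible here
(`TwoTwins.not_opposite`), and in the first case the points are arranged in levels exactly as in
`T_{n,i}` (`IsSpine.isomorphic`).

Existence comes from paths with one or two doubled points, metrized by levels. For `6 ≤ n ≤ 8` the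
number `2n - 10` lies between `n - 4` and `n - 2`, so a path with a single doubled point also
attains it; its triangles share a pair, whereas those of `T_{n,i}` do not even share a point. -/

namespace BetweennessStructure

/-! ### Betweenness calculus and the triangles of a finite subset. -/

section Basics

variable {𝓑 : BetweennessStructure.{u}}

namespace IsAlmostMetrizable

variable (h : 𝓑.IsAlmostMetrizable)
include h

theorem btw_right (x z : 𝓑.carrier) : 𝓑.btw x z z := h.symm _ _ _ (h.btw_left z x)

theorem comm {x y z : 𝓑.carrier} : 𝓑.btw x y z ↔ 𝓑.btw z y x := ⟨h.symm _ _ _, h.symm _ _ _⟩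

theorem not_btw_left {x y z : 𝓑.carrier} (hxy : x ≠ y) (H : 𝓑.btw x y z) : ¬ 𝓑.btw y x z :=
  fun H' => hxy (h.antisymm _ _ _ H H')

theorem not_btw_right {x y z : 𝓑.carrier} (hyz : y ≠ z) (H : 𝓑.btw x y z) : ¬ 𝓑.btw x z y :=
  fun H' => hyz (h.antisymm _ _ _ (h.symm _ _ _ H') (h.symm _ _ _ H))

theorem eq_of_btw_self {x y : 𝓑.carrier} (H : 𝓑.btw x y x) : x = y :=
  h.antisymm _ _ _ H (h.btw_right y x)

/-- From `x w y z` read off `(x w z)`. -/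
theorem trans_outer {x w y z : 𝓑.carrier} (H : 𝓑.btw x y z) (H' : 𝓑.btw x w y) : 𝓑.btw x w z :=
  (h.four_relations _ _ _ _ H H').1

theorem trans_inner {x w y z : 𝓑.carrier} (H : 𝓑.btw x y z) (H' : 𝓑.btw x w y) : 𝓑.btw w y z :=
  (h.four_relations _ _ _ _ H H').2

theorem trans_outer' {x y w z : 𝓑.carrier} (H : 𝓑.btw x y z) (H' : 𝓑.btw y w z) : 𝓑.btw x w z :=
  h.symm _ _ _ (h.trans_outer (h.symm _ _ _ H) (h.symm _ _ _ H'))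

theorem trans_inner' {x y w z : 𝓑.carrier} (H : 𝓑.btw x y z) (H' : 𝓑.btw y w z) : 𝓑.btw x y w :=
  h.symm _ _ _ (h.trans_inner (h.symm _ _ _ H) (h.symm _ _ _ H'))

end IsAlmostMetrizable

open Classical

theorem collinear_triple (h : 𝓑.IsAlmostMetrizable) {x y z : 𝓑.carrier} (hxy : x ≠ y)
    (hyz : y ≠ z) (hxz : x ≠ z) :
    𝓑.Collinear {x, y, z} ↔ 𝓑.btw x y z ∨ 𝓑.btw y x z ∨ 𝓑.btw x z y := by
  constructor
  · rintro ⟨a, ha, b, hb, c, hc, hab, hbc, hac, H⟩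
    have H' := h.symm _ _ _ H
    simp only [Finset.mem_insert, Finset.mem_singleton] at ha hb hc
    rcases ha with rfl | rfl | rfl <;> rcases hb with rfl | rfl | rfl <;>
      rcases hc with rfl | rfl | rfl <;> simp_all
  · rintro (H | H | H)
    · exact ⟨x, by simp, y, by simp, z, by simp, hxy, hyz, hxz, H⟩
    · exact ⟨y, by simp, x, by simp, z, by simp, hxy.symm, hxz, hyz, H⟩
    · exact ⟨x, by simp, z, by simp, y, by simp, hxz, hyz.symm, hxy, H⟩

/-- The triangles inside a set of points. -/
noncomputable def tri (𝓑 : BetweennessStructure.{u}) (S : Finset 𝓑.carrier) :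
    Finset (Finset 𝓑.carrier) :=
  (S.powersetCard 3).filter fun T => ¬ 𝓑.Collinear T

/-- The number of triangles inside `S` through the point `p`. -/
noncomputable def triDegree (𝓑 : BetweennessStructure.{u}) (S : Finset 𝓑.carrier)
    (p : 𝓑.carrier) : ℕ :=
  ((𝓑.tri S).filter fun T => p ∈ T).card

variable {S : Finset 𝓑.carrier}

theorem mem_tri {T : Finset 𝓑.carrier} :
    T ∈ 𝓑.tri S ↔ T ⊆ S ∧ T.card = 3 ∧ ¬ 𝓑.Collinear T := by
  simp [tri, Finset.mem_powersetCard, and_assoc]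

theorem triple_mem_tri {x y z : 𝓑.carrier} (hx : x ∈ S) (hy : y ∈ S) (hz : z ∈ S) (hxy : x ≠ y)
    (hyz : y ≠ z) (hxz : x ≠ z) (H : ¬ 𝓑.Collinear {x, y, z}) : {x, y, z} ∈ 𝓑.tri S := by
  rw [mem_tri]
  refine ⟨?_, Finset.card_eq_three.2 ⟨x, y, z, hxy, hxz, hyz, rfl⟩, H⟩
  intro a ha
  simp only [Finset.mem_insert, Finset.mem_singleton] at ha
  rcases ha with rfl | rfl | rfl <;> assumption

theorem collinear_of_tri_eq_empty (hS : 𝓑.tri S = ∅) {x y z : 𝓑.carrier} (hx : x ∈ S) (hy : y ∈ S)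
    (hz : z ∈ S) (hxy : x ≠ y) (hyz : y ≠ z) (hxz : x ≠ z) : 𝓑.Collinear {x, y, z} := by
  by_contra H
  have := triple_mem_tri hx hy hz hxy hyz hxz H
  simp [hS] at this

theorem tri_mono {S' : Finset 𝓑.carrier} (hS : S ⊆ S') : 𝓑.tri S ⊆ 𝓑.tri S' := by
  intro T hT
  rw [mem_tri] at hT ⊢
  exact ⟨hT.1.trans hS, hT.2⟩

theorem mem_tri_erase {p : 𝓑.carrier} {T : Finset 𝓑.carrier} :
    T ∈ 𝓑.tri (S.erase p) ↔ T ∈ 𝓑.tri S ∧ p ∉ T := by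
  simp only [mem_tri, Finset.subset_erase]
  tauto

theorem card_tri_eq (S : Finset 𝓑.carrier) (p : 𝓑.carrier) :
    (𝓑.tri S).card = 𝓑.triDegree S p + (𝓑.tri (S.erase p)).card := by
  have : 𝓑.tri (S.erase p) = (𝓑.tri S).filter fun T => p ∉ T := by
    ext T; simp [mem_tri_erase]
  rw [this, triDegree, Finset.card_filter_add_card_filter_not]

theorem sum_triDegree (S : Finset 𝓑.carrier) :
    ∑ p ∈ S, 𝓑.triDegree S p = 3 * (𝓑.tri S).card := by
  have := Finset.sum_card_bipartiteAbove_eq_sum_card_bipartiteBelow (s := S) (t := 𝓑.tri S)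
    (fun p T => p ∈ T)
  simp only [Finset.bipartiteAbove, Finset.bipartiteBelow] at this
  unfold triDegree
  rw [this, mul_comm, ← smul_eq_mul, ← Finset.sum_const]
  refine Finset.sum_congr rfl fun T hT => ?_
  rw [mem_tri] at hT
  rw [← hT.2.1]
  congr 1
  ext a
  simp only [Finset.mem_filter]
  exact ⟨fun H => H.2, fun H => ⟨hT.1 H, H⟩⟩

/-- All triangles in `S` have two points in common. -/
def SharedPair (𝓑 : BetweennessStructure.{u}) (S : Finset 𝓑.carrier) : Prop :=
  ∃ y z : 𝓑.carrier, y ≠ z ∧ ∀ T ∈ 𝓑.tri S, y ∈ T ∧ z ∈ T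

theorem exists_third {T : Finset 𝓑.carrier} (hT : T.card = 3) {y z : 𝓑.carrier} (hyz : y ≠ z)
    (hy : y ∈ T) (hz : z ∈ T) : ∃ w, w ≠ y ∧ w ≠ z ∧ T = {y, z, w} := by
  have h1 : ((T.erase y).erase z).card = 1 := by
    rw [Finset.card_erase_of_mem (by simp [hz, hyz.symm]), Finset.card_erase_of_mem hy, hT]
  obtain ⟨w, hw⟩ := Finset.card_eq_one.1 h1
  have hw' : w ∈ (T.erase y).erase z := by simp [hw]
  simp only [Finset.mem_erase] at hw'
  refine ⟨w, hw'.2.1, hw'.1, ?_⟩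
  rw [← Finset.insert_erase hy, ← Finset.insert_erase (a := z) (s := T.erase y) (by simp [hz, hyz.symm]), hw]

theorem exists_other_two {T : Finset 𝓑.carrier} (hT : T.card = 3) {p : 𝓑.carrier} (hp : p ∈ T) :
    ∃ x y, x ≠ p ∧ y ≠ p ∧ x ≠ y ∧ T = {p, x, y} := by
  have h1 : (T.erase p).card = 2 := by rw [Finset.card_erase_of_mem hp, hT]
  obtain ⟨x, y, hxy, hE⟩ := Finset.card_eq_two.1 h1
  have hx : x ∈ T.erase p := by simp [hE]
  have hy : y ∈ T.erase p := by simp [hE]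
  exact ⟨x, y, (Finset.mem_erase.1 hx).1, (Finset.mem_erase.1 hy).1, hxy, by
    rw [← Finset.insert_erase hp, hE]⟩

/-- The triangles of `S` through `y` and `z` correspond to their third points. -/
theorem card_filter_pair {y z : 𝓑.carrier} (hyz : y ≠ z) (hy : y ∈ S) (hz : z ∈ S) :
    ((𝓑.tri S).filter fun T => y ∈ T ∧ z ∈ T).card =
      (((S.erase y).erase z).filter fun w => ¬ 𝓑.Collinear {y, z, w}).card := by
  symm
  refine Finset.card_bij (fun w _ => {y, z, w}) ?_ ?_ ?_
  · intro w hw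
    simp only [Finset.mem_filter, Finset.mem_erase] at hw ⊢
    exact ⟨triple_mem_tri hy hz hw.1.2.2 hyz hw.1.1.symm hw.1.2.1.symm hw.2, by simp⟩
  · intro w hw w' hw' H
    simp only [Finset.mem_filter, Finset.mem_erase] at hw hw'
    have : w ∈ ({y, z, w'} : Finset 𝓑.carrier) := by rw [← H]; simp
    simp only [Finset.mem_insert, Finset.mem_singleton] at this
    tauto
  · intro T hT
    simp only [Finset.mem_filter] at hT
    have hT' := mem_tri.1 hT.1
    obtain ⟨w, hwy, hwz, rfl⟩ := exists_third hT'.2.1 hyz hT.2.1 hT.2.2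
    exact ⟨w, by simpa [hwy, hwz, hT'.2.2] using hT'.1 (by simp), rfl⟩

theorem mem_of_mem_tri {T : Finset 𝓑.carrier} (hT : T ∈ 𝓑.tri S) {x : 𝓑.carrier} (hx : x ∈ T) :
    x ∈ S := (mem_tri.1 hT).1 hx

theorem SharedPair.card_tri_le (hS : 𝓑.SharedPair S) : (𝓑.tri S).card ≤ S.card - 2 := by
  obtain ⟨y, z, hyz, H⟩ := hS
  rcases (𝓑.tri S).eq_empty_or_nonempty with h0 | ⟨T, hT⟩
  · simp [h0]
  · have hy := mem_of_mem_tri hT (H T hT).1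
    have hz := mem_of_mem_tri hT (H T hT).2
    have e : (𝓑.tri S) = (𝓑.tri S).filter fun T => y ∈ T ∧ z ∈ T := by
      rw [Finset.filter_true_of_mem H]
    rw [e, card_filter_pair hyz hy hz]
    refine (Finset.card_filter_le _ _).trans ?_
    rw [Finset.card_erase_of_mem (by simp [hz, hyz.symm]), Finset.card_erase_of_mem hy]
    omega

theorem triDegree_pos_iff {p : 𝓑.carrier} : 0 < 𝓑.triDegree S p ↔ ∃ T ∈ 𝓑.tri S, p ∈ T := by
  simp [triDegree, Finset.card_pos, Finset.Nonempty]

theorem tri_erase_eq_empty_iff {p : 𝓑.carrier} :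
    𝓑.tri (S.erase p) = ∅ ↔ ∀ T ∈ 𝓑.tri S, p ∈ T := by
  rw [Finset.eq_empty_iff_forall_notMem]
  simp only [mem_tri_erase]
  constructor
  · intro H T hT
    by_contra hp
    exact H T ⟨hT, hp⟩
  · rintro H T ⟨hT, hp⟩
    exact hp (H T hT)

theorem coSize_eq [Fintype 𝓑.carrier] : 𝓑.coSize = (𝓑.tri Finset.univ).card := by
  rw [coSize, ← Set.ncard_coe_finset]
  congr 1
  ext T
  simp [triangles, mem_tri]

end Basics

end BetweennessStructure

/-! ### Positions of a point relative to a path, and two exhaustive searches. -/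

namespace BetweennessStructure

/-- The position of an extra point relative to two points of a path: to the left of both, between
them, to the right of both, or forming a triangle with them. -/
inductive Rel
  | L | M | R | D
  deriving DecidableEq

namespace Rel

instance : Fintype Rel := ⟨{L, M, R, D}, fun a => by cases a <;> decide⟩

/-- Whether the relation is a triangle. -/
def isD : Rel → Bool
  | D => true
  | _ => false

/-- The possible relations of an extra point to the pairs `xy`, `yz`, `xz` where `y` is between
`x` and `z`. -/
def ok : Rel → Rel → Rel → Bool
  | L, L, c => match c with | L => true | _ => false
  | L, M, _ => false
  | L, _, c => match c with | M | D => true | _ => false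
  | M, L, c => match c with | M => true | _ => false
  | M, _, _ => false
  | R, L, c => match c with | D => true | _ => false
  | R, M, c => match c with | M => true | _ => false
  | R, R, c => match c with | R => true | _ => false
  | R, D, c => match c with | D => true | _ => false
  | D, L, c => match c with | D => true | _ => false
  | D, M, _ => false
  | D, _, c => match c with | M | D => true | _ => false

/-- Depth-first search through the assignments (latest value first) in which every new value `v`
satisfies `ok a b v` for all prescribed positions of `a` and `b`. -/
def search (fin : List Rel → Bool) : List (List (ℕ × ℕ)) → List Rel → Bool
  | [], acc => fin acc
  | c :: cs, acc =>
    let step := fun v : Rel =>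
      -- A value that violates a constraint is pruned by counting its branch as successful. The
      -- default `D` is never read for `constraints`, whose indices stay within the values already
      -- assigned.
      bif c.all fun ab => ok (acc.getD ab.1 D) (acc.getD ab.2 D) v then search fin cs (v :: acc)
      else true
    step L && step M && step R && step D

/-- The values `vs`, added one by one to `acc`, satisfy the constraints. -/
def Sat : List (List (ℕ × ℕ)) → List Rel → List Rel → Prop
  | c :: cs, acc, v :: vs =>
    (∀ ab ∈ c, ok (acc.getD ab.1 D) (acc.getD ab.2 D) v = true) ∧ Sat cs (v :: acc) vs
  | [], _, [] => True
  | _, _, _ => False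

theorem search_sound (fin : List Rel → Bool) :
    ∀ (cs : List (List (ℕ × ℕ))) (acc vs : List Rel), search fin cs acc = true → Sat cs acc vs →
      fin (vs.reverse ++ acc) = true
  | [], acc, [], h, _ => by simpa [search] using h
  | [], acc, _ :: _, _, hs => by simp [Sat] at hs
  | _ :: _, acc, [], _, hs => by simp [Sat] at hs
  | c :: cs, acc, v :: vs, h, hs => by
    obtain ⟨h1, h2⟩ := hs
    have hc : (c.all fun ab => ok (acc.getD ab.1 D) (acc.getD ab.2 D) v) = true := by
      rw [List.all_eq_true]; exact h1
    have h3 : search fin cs (v :: acc) = true := by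
      simp only [search, Bool.and_eq_true] at h
      obtain ⟨⟨⟨hL, hM⟩, hR⟩, hD⟩ := h
      cases v
      · rwa [hc] at hL
      · rwa [hc] at hM
      · rwa [hc] at hR
      · rwa [hc] at hD
    have := search_sound fin cs (v :: acc) vs h3 h2
    simpa using this

/-- Pairs of indices below `6`, by decreasing position in the assignment. -/
def pairs : List (ℕ × ℕ) :=
  [(0, 5), (1, 5), (2, 5), (3, 5), (4, 5), (0, 4), (1, 4), (2, 4), (3, 4), (0, 3), (1, 3), (2, 3),
    (0, 2), (1, 2), (0, 1)]

/-- Positions of the constraints: column by column, each column from the bottom up. -/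
def constraints : List (List (ℕ × ℕ)) :=
  [[], [], [(1, 0)], [], [(2, 0)], [(4, 0), (2, 1)], [], [(3, 0)], [(6, 0), (3, 1)], [(8, 0),
    (6, 1), (3, 2)], [], [(4, 0)], [(8, 0), (4, 1)], [(11, 0), (8, 1), (4, 2)], [(13, 0), (11,
    1), (8, 2), (4, 3)]]

/-- All triangle pairs contain a common index, or there are at least `b` of them. -/
def starOrMany (ps : List (ℕ × ℕ)) (b : ℕ) (acc : List Rel) : Bool :=
  ([0, 1, 2, 3, 4, 5].any fun v =>
    (ps.zip acc).all fun e => !e.2.isD || Nat.beq e.1.1 v || Nat.beq e.1.2 v) ||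
  Nat.ble b (acc.countP isD)

/-- Six path points and one extra point. This is the base case, on seven points, of the bound `2n -
9`. -/
theorem search_six : search (starOrMany pairs 5) constraints [] = true := by
  decide +kernel

/-- The first ten constraints are those among five path points. This excludes a single triangle on
six points, which starts the bound `n - 4`. -/
theorem search_five :
    search (fun acc => !Nat.beq 1 (acc.countP isD))
      (constraints.take 10) [] = true := by
  decide +kernel

end Rel
end BetweennessStructure

/-! ### Triangle-free sets are paths. -/

namespace BetweennessStructure

namespace Rel

/-- The triples of relations that occur when an extra point is inserted into a path. -/
def Good (a b c : Rel) : Prop :=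
  (b = L ∧ (a = L ∧ c = L ∨ a = M ∧ c = M)) ∨ (a = R ∧ (b = R ∧ c = R ∨ b = M ∧ c = M))

instance (a b c : Rel) : Decidable (Good a b c) := by unfold Good; infer_instance

set_option synthInstance.maxSize 1000 in
set_option synthInstance.maxHeartbeats 400000 in
-- The only triangle-free pattern that is not an insertion into the path is `L`, `R`, `M`, a
-- 4-cycle. It does not survive a fourth path point.
theorem good_of_ok (a b c d e f : Rel) : a ≠ D → b ≠ D → c ≠ D → d ≠ D → e ≠ D → f ≠ D →
    ok a b c = true → ok a e f = true → ok c d f = true → ok b d e = true →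
    Good a b c ∧ Good a e f ∧ Good c d f ∧ Good b d e := by
  revert a b c d e f
  decide +kernel

theorem ok_of_ne_D (a b c : Rel) : a ≠ D → b ≠ D → c ≠ D → ok a b c = true →
    Good a b c ∨ (a = L ∧ b = R ∧ c = M) := by
  revert a b c
  decide +kernel

set_option synthInstance.maxSize 1000 in
set_option synthInstance.maxHeartbeats 400000 in
-- The table `ok` rejects only triples that break one of these eight rules, and in `rel_ok` each
-- rule is an application of (P4), up to reversal. The searches thus range over a superset of the
-- actual configurations.
theorem ok_of_rules (a b c : Rel) : (a = M → c = M ∧ b = L) → (b = M → c = M ∧ a = R) →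
    (c = L → a = L ∧ b = L) → (c = R → a = R ∧ b = R) → (a = L → b = L → c = L) →
    (a = R → b = R → c = R) → (a = R → c = M → b = M) → (b = L → c = M → a = M) →
    ok a b c = true := by
  revert a b c
  decide +kernel

theorem exists_gap_of_good (s : ℕ → ℕ → Rel) (N : ℕ) (hN : 2 ≤ N)
    (hD : ∀ i j, i < j → j < N → s i j ≠ D)
    (hs : ∀ i j k, i < j → j < k → k < N → Good (s i j) (s j k) (s i k)) :
    ∃ a ≤ N, ∀ i j, i < j → j < N → s i j = if j < a then R else if i < a then M else L := by
  induction N, hN using Nat.le_induction with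
  | base =>
    have h01 := hD 0 1 (by omega) (by omega)
    rcases h : s 0 1 with _ | _ | _ | _
    · refine ⟨0, by omega, fun i j hij hj => ?_⟩
      obtain ⟨rfl, rfl⟩ : i = 0 ∧ j = 1 := by omega
      simp [h]
    · refine ⟨1, by omega, fun i j hij hj => ?_⟩
      obtain ⟨rfl, rfl⟩ : i = 0 ∧ j = 1 := by omega
      simp [h]
    · refine ⟨2, by omega, fun i j hij hj => ?_⟩
      obtain ⟨rfl, rfl⟩ : i = 0 ∧ j = 1 := by omega
      simp [h]
    · exact absurd h h01
  | succ N hN ih =>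
    obtain ⟨a, ha, H⟩ := ih (fun i j hij hj => hD i j hij (by omega))
      (fun i j k hij hjk hk => hs i j k hij hjk (by omega))
    rcases ha.lt_or_eq with ha | rfl
    · have hlast : ∀ i, i < N - 1 → s (N - 1) N = L ∧ s i N = if i < a then M else L := by
        intro i hi
        have h1 := hs i (N - 1) N hi (by omega) (by omega)
        rw [H i (N - 1) hi (by omega), if_neg (by omega)] at h1
        by_cases hia : i < a
        · simp [Good, hia] at h1 ⊢; exact h1
        · simp [Good, hia] at h1 ⊢; exact h1
      refine ⟨a, by omega, fun i j hij hj => ?_⟩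
      rcases Nat.lt_succ_iff_lt_or_eq.1 hj with hj | rfl
      · exact H i j hij hj
      · rw [if_neg (by omega)]
        rcases Nat.lt_or_ge i (j - 1) with hi | hi
        · exact (hlast i hi).2
        · obtain rfl : i = j - 1 := by omega
          rw [if_neg (by omega)]
          exact (hlast 0 (by omega)).1
    -- The extra point was past the end of the old path, so the new last entry may fall on either
    -- side of it: the gap moves to `a + 1` if all new values are `R`, and stays at `a` if they are
    -- all `M`.
    · have hlast : ∀ i, i < a - 1 →
          (s i a = R ∧ s (a - 1) a = R) ∨ (s i a = M ∧ s (a - 1) a = M) := by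
        intro i hi
        have h1 := hs i (a - 1) a hi (by omega) (by omega)
        rw [H i (a - 1) hi (by omega), if_pos (by omega)] at h1
        simp [Good] at h1
        tauto
      have hall : ∀ i, i < a → s i a = s (a - 1) a := by
        intro i hi
        rcases Nat.lt_or_ge i (a - 1) with hi' | hi'
        · rcases hlast i hi' with h | h <;> rw [h.1, h.2]
        · rw [show i = a - 1 by omega]
      rcases hlast 0 (by omega) with h | h
      · refine ⟨a + 1, le_rfl, fun i j hij hj => ?_⟩
        rw [if_pos (by omega)]
        rcases Nat.lt_succ_iff_lt_or_eq.1 hj with hj | rfl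
        · rw [H i j hij hj, if_pos hj]
        · rw [hall i hij, h.2]
      · refine ⟨a, by omega, fun i j hij hj => ?_⟩
        rcases Nat.lt_succ_iff_lt_or_eq.1 hj with hj | rfl
        · rw [H i j hij hj]
        · rw [hall i hij, h.2, if_neg (by omega), if_pos hij]

/-- With at least four indices every triple lies in a quadruple, so `good_of_ok` rules out the
4-cycle pattern everywhere. -/
theorem exists_gap (s : ℕ → ℕ → Rel) (N : ℕ) (hN : 4 ≤ N)
    (hD : ∀ i j, i < j → j < N → s i j ≠ D)
    (hs : ∀ i j k, i < j → j < k → k < N → ok (s i j) (s j k) (s i k) = true) :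
    ∃ a ≤ N, ∀ i j, i < j → j < N → s i j = if j < a then R else if i < a then M else L := by
  refine exists_gap_of_good s N (by omega) hD fun i j k hij hjk hk => ?_
  have key : ∀ i j k l, i < j → j < k → k < l → l < N →
      Good (s i j) (s j k) (s i k) ∧ Good (s i j) (s j l) (s i l) ∧
        Good (s i k) (s k l) (s i l) ∧ Good (s j k) (s k l) (s j l) := by
    intro i j k l hij hjk hkl hl
    exact good_of_ok _ _ _ _ _ _ (hD _ _ hij (by omega)) (hD _ _ hjk (by omega))
      (hD _ _ (hij.trans hjk) (by omega)) (hD _ _ hkl (by omega)) (hD _ _ (hjk.trans hkl) (by omega))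
      (hD _ _ (hij.trans (hjk.trans hkl)) (by omega)) (hs _ _ _ hij hjk (by omega))
      (hs _ _ _ hij (hjk.trans hkl) hl) (hs _ _ _ (hij.trans hjk) hkl hl) (hs _ _ _ hjk hkl hl)
  by_cases h1 : k + 1 < N
  · exact (key i j k (k + 1) hij hjk (by omega) h1).1
  · by_cases h2 : j + 1 < k
    · exact (key i j (j + 1) k hij (by omega) h2 hk).2.1
    · by_cases h3 : i + 1 < j
      · exact (key i (i + 1) j k (by omega) h3 hjk hk).2.2.1
      · exact (key 0 i j k (by omega) hij hjk hk).2.2.2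

end Rel

open Classical

/-! ### Inserting points into paths of a betweenness structure. -/

section Path

variable {𝓑 : BetweennessStructure.{u}}

/-- The position of `p` relative to `x` and `y`. -/
noncomputable def rel (𝓑 : BetweennessStructure.{u}) (p x y : 𝓑.carrier) : Rel :=
  if 𝓑.btw p x y then .L else if 𝓑.btw x p y then .M else if 𝓑.btw x y p then .R else .D

theorem rel_eq_L {p x y : 𝓑.carrier} : 𝓑.rel p x y = .L ↔ 𝓑.btw p x y := by
  unfold rel; split_ifs <;> simp_all

theorem rel_eq_M (h : 𝓑.IsAlmostMetrizable) {p x y : 𝓑.carrier} (hpx : p ≠ x) :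
    𝓑.rel p x y = .M ↔ 𝓑.btw x p y := by
  have := h.not_btw_left (x := p) (y := x) (z := y) hpx
  unfold rel; split_ifs <;> simp_all

theorem rel_eq_R (h : 𝓑.IsAlmostMetrizable) {p x y : 𝓑.carrier} (hpy : p ≠ y)
    (hxy : x ≠ y) : 𝓑.rel p x y = .R ↔ 𝓑.btw x y p := by
  have h1 : 𝓑.btw p x y → ¬ 𝓑.btw x y p := fun H H' =>
    h.not_btw_right hxy H (h.symm _ _ _ H')
  have h2 : 𝓑.btw x p y → ¬ 𝓑.btw x y p := fun H H' => h.not_btw_right hpy H H'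
  unfold rel; split_ifs <;> simp_all

theorem rel_eq_D (h : 𝓑.IsAlmostMetrizable) {p x y : 𝓑.carrier} (hpx : p ≠ x) (hpy : p ≠ y)
    (hxy : x ≠ y) : 𝓑.rel p x y = .D ↔ ¬ 𝓑.Collinear {p, x, y} := by
  rw [collinear_triple h hpx hxy hpy]
  have := h.comm (x := x) (y := y) (z := p)
  unfold rel; split_ifs <;> simp_all

theorem rel_ok (h : 𝓑.IsAlmostMetrizable) {p x y z : 𝓑.carrier} (hpx : p ≠ x) (hpy : p ≠ y)
    (hpz : p ≠ z) (hxy : x ≠ y) (hyz : y ≠ z) (hxz : x ≠ z) (H : 𝓑.btw x y z) :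
    Rel.ok (𝓑.rel p x y) (𝓑.rel p y z) (𝓑.rel p x z) = true := by
  have H' := h.symm _ _ _ H
  have m1 : 𝓑.rel p x y = .M → 𝓑.rel p x z = .M ∧ 𝓑.rel p y z = .L := by
    rw [rel_eq_M h hpx, rel_eq_M h hpx, rel_eq_L]
    exact fun H1 => ⟨h.trans_outer H H1, h.trans_inner H H1⟩
  have m2 : 𝓑.rel p y z = .M → 𝓑.rel p x z = .M ∧ 𝓑.rel p x y = .R := by
    rw [rel_eq_M h hpx, rel_eq_M h hpy, rel_eq_R h hpy hxy]
    exact fun H1 => ⟨h.trans_outer' H H1, h.trans_inner' H H1⟩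
  have m3 : 𝓑.rel p x z = .L → 𝓑.rel p x y = .L ∧ 𝓑.rel p y z = .L := by
    rw [rel_eq_L, rel_eq_L, rel_eq_L]
    exact fun H1 => ⟨h.trans_inner' H1 H, h.trans_outer' H1 H⟩
  have m4 : 𝓑.rel p x z = .R → 𝓑.rel p x y = .R ∧ 𝓑.rel p y z = .R := by
    rw [rel_eq_R h hpy hxy, rel_eq_R h hpz hxz, rel_eq_R h hpz hyz]
    exact fun H1 => ⟨h.trans_outer H1 H, h.trans_inner H1 H⟩
  have m5 : 𝓑.rel p x y = .L → 𝓑.rel p y z = .L → 𝓑.rel p x z = .L := by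
    rw [rel_eq_L, rel_eq_L, rel_eq_L]
    exact fun H1 H2 => h.trans_outer H2 H1
  have m6 : 𝓑.rel p x y = .R → 𝓑.rel p y z = .R → 𝓑.rel p x z = .R := by
    rw [rel_eq_R h hpy hxy, rel_eq_R h hpz hxz, rel_eq_R h hpz hyz]
    exact fun H1 H2 => h.trans_outer' H1 H2
  have m7 : 𝓑.rel p x y = .R → 𝓑.rel p x z = .M → 𝓑.rel p y z = .M := by
    rw [rel_eq_R h hpy hxy, rel_eq_M h hpx, rel_eq_M h hpy]
    exact fun H1 H2 => h.trans_inner H2 H1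
  have m8 : 𝓑.rel p y z = .L → 𝓑.rel p x z = .M → 𝓑.rel p x y = .M := by
    rw [rel_eq_L, rel_eq_M h hpx, rel_eq_M h hpx]
    exact fun H1 H2 => h.trans_inner' H2 H1
  exact Rel.ok_of_rules _ _ _ m1 m2 m3 m4 m5 m6 m7 m8

/-- `g 0, …, g (N - 1)` enumerates `S` along a path. -/
structure IsPath (𝓑 : BetweennessStructure.{u}) (g : ℕ → 𝓑.carrier) (N : ℕ)
    (S : Finset 𝓑.carrier) : Prop where
  inj : ∀ i j, i < N → j < N → g i = g j → i = j
  mem_iff : ∀ x, x ∈ S ↔ ∃ i, i < N ∧ g i = x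
  btw : ∀ i j k, i < j → j < k → k < N → 𝓑.btw (g i) (g j) (g k)

/-- The point `p` lies in front of the entry with index `a` of a path. -/
structure IsGap (𝓑 : BetweennessStructure.{u}) (g : ℕ → 𝓑.carrier) (N : ℕ) (p : 𝓑.carrier)
    (a : ℕ) : Prop where
  le : a ≤ N
  right : ∀ i j, i < j → j < a → 𝓑.btw (g i) (g j) p
  mid : ∀ i j, i < a → a ≤ j → j < N → 𝓑.btw (g i) p (g j)
  left : ∀ i j, a ≤ i → i < j → j < N → 𝓑.btw p (g i) (g j)

/-- The sequence `g` with `p` inserted at index `a`. -/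
def ins (g : ℕ → 𝓑.carrier) (a : ℕ) (p : 𝓑.carrier) (k : ℕ) : 𝓑.carrier :=
  if k < a then g k else if k = a then p else g (k - 1)

variable {g : ℕ → 𝓑.carrier} {N : ℕ} {S : Finset 𝓑.carrier}

namespace IsPath

theorem mem (hg : 𝓑.IsPath g N S) {i : ℕ} (hi : i < N) : g i ∈ S := (hg.mem_iff _).2 ⟨i, hi, rfl⟩

theorem ne (hg : 𝓑.IsPath g N S) {i j : ℕ} (hi : i < N) (hj : j < N) (hij : i ≠ j) : g i ≠ g j :=
  fun H => hij (hg.inj i j hi hj H)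

theorem reverse (h : 𝓑.IsAlmostMetrizable) (hg : 𝓑.IsPath g N S) :
    𝓑.IsPath (fun i => g (N - 1 - i)) N S where
  inj i j hi hj H := by
    have := hg.inj _ _ (by omega) (by omega) H
    omega
  mem_iff x := by
    rw [hg.mem_iff]
    constructor
    · rintro ⟨i, hi, rfl⟩
      exact ⟨N - 1 - i, by omega, by
        show g (N - 1 - (N - 1 - i)) = g i
        congr 1; omega⟩
    · rintro ⟨i, hi, rfl⟩
      exact ⟨N - 1 - i, by omega, rfl⟩
  btw i j k hij hjk hk := h.symm _ _ _ (hg.btw _ _ _ (by omega) (by omega) (by omega))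

theorem insert (hg : 𝓑.IsPath g N S) {p : 𝓑.carrier} (hp : p ∉ S)
    {a : ℕ} (ha : 𝓑.IsGap g N p a) : 𝓑.IsPath (ins g a p) (N + 1) (insert p S) where
  inj i j hi hj H := by
    have hle := ha.le
    have hpg : ∀ k, k < N → g k ≠ p := fun k hk e => hp (e ▸ hg.mem hk)
    unfold ins at H
    split_ifs at H with h1 h2 h3 h4 h5 h6
    · exact hg.inj i j (by omega) (by omega) H
    · exact absurd H (hpg _ (by omega))
    · have := hg.inj _ _ (by omega) (by omega) H
      omega
    · exact absurd H.symm (hpg _ (by omega))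
    · omega
    · exact absurd H.symm (hpg _ (by omega))
    · have := hg.inj _ _ (by omega) (by omega) H
      omega
    · exact absurd H (hpg _ (by omega))
    · have := hg.inj _ _ (by omega) (by omega) H
      omega
  mem_iff x := by
    have hle := ha.le
    rw [Finset.mem_insert, hg.mem_iff]
    constructor
    · rintro (rfl | ⟨i, hi, rfl⟩)
      · exact ⟨a, by omega, by simp [ins]⟩
      · by_cases hia : i < a
        · exact ⟨i, by omega, by simp [ins, hia]⟩
        · exact ⟨i + 1, by omega, by
            simp only [ins]; rw [if_neg (by omega), if_neg (by omega)]; rfl⟩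
    · rintro ⟨i, hi, rfl⟩
      unfold ins
      split_ifs with h1 h2
      · exact Or.inr ⟨i, by omega, rfl⟩
      · exact Or.inl rfl
      · exact Or.inr ⟨i - 1, by omega, rfl⟩
  btw i j k hij hjk hk := by
    have hle := ha.le
    unfold ins
    split_ifs with h1 h2 h3 h4 h5 h6 <;> first
      | omega
      | exact hg.btw _ _ _ (by omega) (by omega) (by omega)
      | exact ha.right _ _ (by omega) (by omega)
      | exact ha.mid _ _ (by omega) (by omega) (by omega)
      | exact ha.left _ _ (by omega) (by omega) (by omega)

theorem rel_ok (h : 𝓑.IsAlmostMetrizable) (hg : 𝓑.IsPath g N S) {p : 𝓑.carrier} (hp : p ∉ S)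
    {i j k : ℕ} (hij : i < j) (hjk : j < k) (hk : k < N) :
    Rel.ok (𝓑.rel p (g i) (g j)) (𝓑.rel p (g j) (g k)) (𝓑.rel p (g i) (g k)) = true := by
  have hpg : ∀ k, k < N → p ≠ g k := fun k hk e => hp (e ▸ hg.mem hk)
  exact BetweennessStructure.rel_ok h (hpg _ (by omega)) (hpg _ (by omega)) (hpg _ (by omega))
    (hg.ne (by omega) (by omega) (by omega)) (hg.ne (by omega) (by omega) (by omega))
    (hg.ne (by omega) (by omega) (by omega)) (hg.btw _ _ _ hij hjk hk)

theorem isGap_of_rel (h : 𝓑.IsAlmostMetrizable) (hg : 𝓑.IsPath g N S) {p : 𝓑.carrier}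
    (hp : p ∉ S) {a : ℕ} (haN : a ≤ N)
    (ha : ∀ i j, i < j → j < N →
      𝓑.rel p (g i) (g j) = if j < a then .R else if i < a then .M else .L) : 𝓑.IsGap g N p a := by
  have hpg : ∀ k, k < N → p ≠ g k := fun k hk e => hp (e ▸ hg.mem hk)
  refine ⟨haN, fun i j hij hj => ?_, fun i j hi hj hjN => ?_, fun i j hi hij hj => ?_⟩
  · rw [← rel_eq_R h (hpg j (by omega)) (hg.ne (by omega) (by omega) (by omega)),
      ha i j hij (by omega), if_pos hj]
  · rw [← rel_eq_M h (hpg i (by omega)), ha i j (by omega) hjN, if_neg (by omega), if_pos hi]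
  · rw [← rel_eq_L, ha i j hij hj, if_neg (by omega), if_neg (by omega)]

theorem rel_ne_D (h : 𝓑.IsAlmostMetrizable) (hg : 𝓑.IsPath g N S) {p : 𝓑.carrier}
    (hp : p ∉ S) (hS : 𝓑.tri (Insert.insert p S) = ∅) {i j : ℕ} (hij : i < j) (hj : j < N) :
    𝓑.rel p (g i) (g j) ≠ .D := by
  have hpg : ∀ k, k < N → p ≠ g k := fun k hk e => hp (e ▸ hg.mem hk)
  have hne := hg.ne (i := i) (j := j) (by omega) hj (by omega)
  rw [Ne, rel_eq_D h (hpg i (by omega)) (hpg j hj) hne, not_not]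
  exact collinear_of_tri_eq_empty hS (by simp) (by simp [hg.mem (show i < N by omega)])
    (by simp [hg.mem hj]) (hpg i (by omega)) hne (hpg j hj)

theorem exists_gap (h : 𝓑.IsAlmostMetrizable) (hg : 𝓑.IsPath g N S) (hN : 4 ≤ N) {p : 𝓑.carrier}
    (hp : p ∉ S) (hS : 𝓑.tri (Insert.insert p S) = ∅) : ∃ a, 𝓑.IsGap g N p a := by
  obtain ⟨a, haN, ha⟩ := Rel.exists_gap (fun i j => 𝓑.rel p (g i) (g j)) N hN
    (fun i j hij hj => hg.rel_ne_D h hp hS hij hj)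
    (fun i j k hij hjk hk => hg.rel_ok h hp hij hjk hk)
  exact ⟨a, hg.isGap_of_rel h hp haN ha⟩

/-- A point added to a path of three points extends it or completes a 4-cycle. -/
theorem exists_gap_or_cycle (h : 𝓑.IsAlmostMetrizable) (hg : 𝓑.IsPath g 3 S) {p : 𝓑.carrier}
    (hp : p ∉ S) (hS : 𝓑.tri (Insert.insert p S) = ∅) :
    (∃ a, 𝓑.IsGap g 3 p a) ∨ (𝓑.btw p (g 0) (g 1) ∧ 𝓑.btw (g 1) (g 2) p ∧ 𝓑.btw (g 0) p (g 2)) := by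
  have hpg : ∀ k, k < 3 → p ≠ g k := fun k hk e => hp (e ▸ hg.mem hk)
  have hne := hg.ne (i := 1) (j := 2) (by omega) (by omega) (by omega)
  rcases Rel.ok_of_ne_D _ _ _ (hg.rel_ne_D h hp hS (i := 0) (j := 1) (by omega) (by omega))
    (hg.rel_ne_D h hp hS (i := 1) (j := 2) (by omega) (by omega))
    (hg.rel_ne_D h hp hS (i := 0) (j := 2) (by omega) (by omega))
    (hg.rel_ok h hp (i := 0) (j := 1) (k := 2) (by omega) (by omega) (by omega)) with H | ⟨h1, h2, h3⟩
  · left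
    obtain ⟨a, haN, ha⟩ := Rel.exists_gap_of_good (fun i j => 𝓑.rel p (g i) (g j)) 3 (by omega)
      (fun i j hij hj => hg.rel_ne_D h hp hS hij hj)
      (fun i j k hij hjk hk => by
        obtain ⟨rfl, rfl, rfl⟩ : i = 0 ∧ j = 1 ∧ k = 2 := by omega
        exact H)
    exact ⟨a, hg.isGap_of_rel h hp haN ha⟩
  · right
    rw [rel_eq_L] at h1
    rw [rel_eq_R h (hpg 2 (by omega)) hne] at h2
    rw [rel_eq_M h (hpg 0 (by omega))] at h3
    exact ⟨h1, h2, h3⟩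

end IsPath

theorem isPath_three {x y z : 𝓑.carrier} (hxy : x ≠ y) (hyz : y ≠ z) (hxz : x ≠ z)
    (H : 𝓑.btw x y z) :
    𝓑.IsPath (fun n => if n = 0 then x else if n = 1 then y else z) 3 {x, y, z} where
  inj i j hi hj H := by
    interval_cases i <;> interval_cases j <;> simp_all
  mem_iff w := by
    simp only [Finset.mem_insert, Finset.mem_singleton]
    constructor
    · rintro (rfl | rfl | rfl)
      · exact ⟨0, by simp⟩
      · exact ⟨1, by simp⟩
      · exact ⟨2, by simp⟩
    · rintro ⟨i, hi, rfl⟩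
      interval_cases i <;> simp
  btw i j k hij hjk hk := by
    obtain ⟨rfl, rfl, rfl⟩ : i = 0 ∧ j = 1 ∧ k = 2 := by omega
    simpa using H

/-- A fourth point added to a collinear triple `x y z` either extends it, and then the fifth can be
inserted, or closes a 4-cycle. If the triple `x y z` closes up with both `d` and `e`, and `x d z`
with `e`, then `x` lies between any two of `y`, `d`, `e`, which prevents these three from being
collinear. -/
theorem exists_isPath_of_card_five (h : 𝓑.IsAlmostMetrizable) (hS : 𝓑.tri S = ∅)
    (h5 : S.card = 5) : ∃ g, 𝓑.IsPath g 5 S := by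
  suffices ∃ p ∈ S, ∃ g, 𝓑.IsPath g 4 (S.erase p) by
    obtain ⟨p, hp, g, hg⟩ := this
    obtain ⟨a, ha⟩ := hg.exists_gap h le_rfl (Finset.notMem_erase p S)
      (by rwa [Finset.insert_erase hp])
    have := hg.insert (Finset.notMem_erase p S) ha
    rw [Finset.insert_erase hp] at this
    exact ⟨_, this⟩
  obtain ⟨T, hTS, hT⟩ := Finset.exists_subset_card_eq (s := S) (n := 3) (by omega)
  have hc : 𝓑.Collinear T := by
    by_contra H
    have : T ∈ 𝓑.tri S := mem_tri.2 ⟨hTS, hT, H⟩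
    simp [hS] at this
  obtain ⟨x, hx, y, hy, z, hz, hxy, hyz, hxz, H⟩ := hc
  have hTe : {x, y, z} = T := by
    apply Finset.eq_of_subset_of_card_le
    · intro w; simp only [Finset.mem_insert, Finset.mem_singleton]
      rintro (rfl | rfl | rfl) <;> assumption
    · rw [hT, Finset.card_eq_three.2 ⟨x, y, z, hxy, hxz, hyz, rfl⟩]
  subst hTe
  have h2 : (S \ {x, y, z}).card = 2 := by
    rw [Finset.card_sdiff_of_subset hTS]; omega
  obtain ⟨d, e, hde, hD⟩ := Finset.card_eq_two.1 h2
  have hd : d ∈ S \ {x, y, z} := by simp [hD]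
  have he : e ∈ S \ {x, y, z} := by simp [hD]
  have hSe : ∀ w, w ∈ S ↔ w = x ∨ w = y ∨ w = z ∨ w = d ∨ w = e := by
    intro w
    have : w ∈ S \ {x, y, z} ↔ w = d ∨ w = e := by simp [hD]
    have hw : w = x ∨ w = y ∨ w = z → w ∈ S := fun hw => hTS (by simpa using hw)
    simp only [Finset.mem_sdiff, Finset.mem_insert, Finset.mem_singleton] at this
    tauto
  simp only [Finset.mem_sdiff, Finset.mem_insert, Finset.mem_singleton, not_or] at hd he
  have sub : ∀ {A : Finset 𝓑.carrier}, A ⊆ S → 𝓑.tri A = ∅ := fun hA =>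
    Finset.subset_empty.1 (hS ▸ tri_mono hA)
  have hP := isPath_three hxy hyz hxz H
  have step : ∀ {a b c d' e' : 𝓑.carrier} {g : ℕ → 𝓑.carrier}, 𝓑.IsPath g 3 {a, b, c} →
      d' ∉ ({a, b, c} : Finset 𝓑.carrier) → e' ∈ S → (insert d' {a, b, c} : Finset 𝓑.carrier) = S.erase e' →
      (∃ p ∈ S, ∃ g, 𝓑.IsPath g 4 (S.erase p)) ∨
        (𝓑.btw d' (g 0) (g 1) ∧ 𝓑.btw (g 1) (g 2) d' ∧ 𝓑.btw (g 0) d' (g 2)) := by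
    intro a b c d' e' g hg hd' he' heq
    rcases hg.exists_gap_or_cycle h hd' (sub (heq ▸ Finset.erase_subset _ _)) with ⟨i, hi⟩ | hc
    · left
      have := hg.insert hd' hi
      rw [heq] at this
      exact ⟨e', he', _, this⟩
    · exact Or.inr hc
  rcases step hP (d' := d) (e' := e) (by simp; tauto) he.1
    (by ext w; simp only [Finset.mem_insert, Finset.mem_singleton, Finset.mem_erase, hSe]; grind)
    with hE | ⟨c1, c2, c3⟩
  · exact hE
  rcases step hP (d' := e) (e' := d) (by simp; tauto) hd.1
    (by ext w; simp only [Finset.mem_insert, Finset.mem_singleton, Finset.mem_erase, hSe]; grind)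
    with hE | ⟨c4, c5, c6⟩
  · exact hE
  simp only [↓reduceIte, one_ne_zero, OfNat.ofNat_ne_zero, OfNat.ofNat_ne_one] at c1 c2 c3 c4 c5 c6
  rcases step (isPath_three (Ne.symm hd.2.1) hd.2.2.2 hxz c3) (d' := e) (e' := y) (by simp; tauto) ((hSe _).2 (by simp))
    (by ext w; simp only [Finset.mem_insert, Finset.mem_singleton, Finset.mem_erase, hSe]; grind)
    with hE | ⟨c7, c8, c9⟩
  · exact hE
  simp only [↓reduceIte, one_ne_zero, OfNat.ofNat_ne_zero, OfNat.ofNat_ne_one] at c7 c8 c9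
  exfalso
  have hcol := collinear_of_tri_eq_empty hS (x := y) (y := d) (z := e) ((hSe _).2 (by simp)) hd.1 he.1
    (Ne.symm hd.2.2.1) hde (Ne.symm he.2.2.1)
  -- From `a b c` and `a x b`, (P4) gives `x b c`, which is incompatible with `b x c`.
  have star : ∀ {a b c : 𝓑.carrier}, a ≠ x → b ≠ x → c ≠ x → 𝓑.btw a x b → 𝓑.btw b x c → ¬ 𝓑.btw a b c := by
    intro a b c ha hb hc h1 h2 h3
    have := h.trans_inner h3 h1
    exact h.not_btw_left hb.symm this h2
  rw [collinear_triple h (Ne.symm hd.2.2.1) hde (Ne.symm he.2.2.1)] at hcol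
  rcases hcol with H1 | H1 | H1
  · exact star hxy.symm hd.2.1 he.2.1 (h.symm _ _ _ c1) (h.symm _ _ _ c7) H1
  · exact star hd.2.1 hxy.symm he.2.1 c1 (h.symm _ _ _ c4) H1
  · exact star hxy.symm he.2.1 hd.2.1 (h.symm _ _ _ c4) c7 H1

/-- A set of at least five points without triangles is a path. -/
theorem exists_isPath (h : 𝓑.IsAlmostMetrizable) (n : ℕ) (hn : 5 ≤ n) :
    ∀ S : Finset 𝓑.carrier, 𝓑.tri S = ∅ → S.card = n → ∃ g, 𝓑.IsPath g n S := by
  induction n, hn using Nat.le_induction with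
  | base => exact fun S hS h5 => exists_isPath_of_card_five h hS h5
  | succ n hn ih =>
    intro S hS hc
    obtain ⟨p, hp⟩ := Finset.card_pos.1 (show 0 < S.card by omega)
    obtain ⟨g, hg⟩ := ih (S.erase p)
      (Finset.subset_empty.1 (hS ▸ tri_mono (Finset.erase_subset _ _)))
      (by rw [Finset.card_erase_of_mem hp]; omega)
    obtain ⟨a, ha⟩ := hg.exists_gap h (by omega) (Finset.notMem_erase p S)
      (by rwa [Finset.insert_erase hp])
    have := hg.insert (Finset.notMem_erase p S) ha
    rw [Finset.insert_erase hp] at this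
    exact ⟨_, this⟩

end Path
end BetweennessStructure

/-! ### From the searches to sets of six and seven points. -/

namespace BetweennessStructure

namespace Rel

/-- The pairs of indices `i < j < N`. -/
def indexPairs (N : ℕ) : Finset (ℕ × ℕ) :=
  (Finset.range N ×ˢ Finset.range N).filter fun e => e.1 < e.2

theorem mem_indexPairs {N : ℕ} {e : ℕ × ℕ} : e ∈ indexPairs N ↔ e.1 < e.2 ∧ e.2 < N := by
  simp only [indexPairs, Finset.mem_filter, Finset.mem_product, Finset.mem_range]
  omega

theorem isD_iff {a : Rel} : a.isD = true ↔ a = D := by cases a <;> simp [isD]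

theorem countP_map_isD (ps : List (ℕ × ℕ)) (hps : ps.Nodup) (s : ℕ → ℕ → Rel) :
    (ps.map fun e => s e.1 e.2).countP isD =
      (ps.toFinset.filter fun e => s e.1 e.2 = D).card := by
  rw [List.countP_map, List.countP_eq_length_filter,
    ← List.toFinset_card_of_nodup (hps.filter _), List.toFinset_filter]
  congr 1
  ext e
  simp [isD_iff]

theorem starOrMany_map {N b : ℕ} {ps : List (ℕ × ℕ)} (hps : ps.Nodup)
    (hN : ps.toFinset = indexPairs N) {s : ℕ → ℕ → Rel}
    (h : starOrMany ps b (ps.map fun e => s e.1 e.2) = true) :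
    (∃ v, ∀ i j, i < j → j < N → s i j = D → i = v ∨ j = v) ∨
      b ≤ ((indexPairs N).filter fun e => s e.1 e.2 = D).card := by
  rw [starOrMany, Bool.or_eq_true] at h
  rcases h with h | h
  · left
    rw [List.any_eq_true] at h
    obtain ⟨v, -, hv⟩ := h
    rw [List.all_eq_true] at hv
    refine ⟨v, fun i j hij hj hD => ?_⟩
    have hmem : (i, j) ∈ ps := by
      rw [← List.mem_toFinset, hN, mem_indexPairs]; exact ⟨hij, hj⟩
    have hz : ((i, j), s i j) ∈ ps.zip (ps.map fun e => s e.1 e.2) := by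
      rw [← List.map_prod_left_eq_zip, List.mem_map]
      exact ⟨(i, j), hmem, rfl⟩
    have := hv _ hz
    simpa [hD, isD, Nat.beq_eq] using this
  · right
    have := Nat.le_of_ble_eq_true h
    rwa [countP_map_isD ps hps, hN] at this

theorem six_star_or_many (s : ℕ → ℕ → Rel)
    (hs : ∀ i j k, i < j → j < k → k < 6 → ok (s i j) (s j k) (s i k) = true) :
    (∃ v, ∀ i j, i < j → j < 6 → s i j = D → i = v ∨ j = v) ∨
      5 ≤ ((indexPairs 6).filter fun e => s e.1 e.2 = D).card := by
  refine starOrMany_map (ps := pairs) (by decide) (by decide) ?_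
  have := search_sound _ constraints [] (pairs.map fun e => s e.1 e.2).reverse search_six ?_
  · simpa using this
  · simp only [pairs, constraints, List.map, List.reverse, List.reverseAux, Sat]
    simp
    simp (discharger := omega) only [hs, and_self]

theorem card_ne_one_of_five (s : ℕ → ℕ → Rel)
    (hs : ∀ i j k, i < j → j < k → k < 5 → ok (s i j) (s j k) (s i k) = true) :
    ((indexPairs 5).filter fun e => s e.1 e.2 = D).card ≠ 1 := by
  have := search_sound _ (constraints.take 10) []
    ((pairs.drop 5).map fun e => s e.1 e.2).reverse search_five ?_
  · simp only [List.reverse_reverse, List.append_nil] at this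
    intro h1
    rw [countP_map_isD _ (by decide), show (pairs.drop 5).toFinset = indexPairs 5 by decide,
      h1] at this
    simp at this
  · simp only [pairs, constraints, List.map, List.reverse, List.reverseAux, Sat, List.take,
      List.drop]
    simp
    simp (discharger := omega) only [hs, and_self]

end Rel

open Classical

section

variable {𝓑 : BetweennessStructure.{u}} {g : ℕ → 𝓑.carrier} {N : ℕ} {S : Finset 𝓑.carrier}
  {p : 𝓑.carrier}

/-- If all triangles of `S` contain `p`, they correspond to pairs of indices on the path. -/
theorem IsPath.exists_of_mem_tri (h : 𝓑.IsAlmostMetrizable) (hg : 𝓑.IsPath g N (S.erase p))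
    (hall : ∀ T ∈ 𝓑.tri S, p ∈ T) {T : Finset 𝓑.carrier} (hT : T ∈ 𝓑.tri S) :
    ∃ i j, i < j ∧ j < N ∧ T = {p, g i, g j} ∧ 𝓑.rel p (g i) (g j) = .D := by
  have hT' := mem_tri.1 hT
  obtain ⟨x, y, hx, hy, hxy, rfl⟩ := exists_other_two hT'.2.1 (hall T hT)
  obtain ⟨i, hi, rfl⟩ := (hg.mem_iff x).1 (Finset.mem_erase.2 ⟨hx, hT'.1 (by simp)⟩)
  obtain ⟨j, hj, rfl⟩ := (hg.mem_iff y).1 (Finset.mem_erase.2 ⟨hy, hT'.1 (by simp)⟩)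
  rcases Nat.lt_trichotomy i j with hij | rfl | hij
  · exact ⟨i, j, hij, hj, rfl, (rel_eq_D h hx.symm hy.symm hxy).2 hT'.2.2⟩
  · exact absurd rfl hxy
  · have e : ({p, g i, g j} : Finset 𝓑.carrier) = {p, g j, g i} := by
      rw [Finset.pair_comm]
    exact ⟨j, i, hij, hi, e, (rel_eq_D h hy.symm hx.symm hxy.symm).2 (e ▸ hT'.2.2)⟩

theorem IsPath.card_tri (h : 𝓑.IsAlmostMetrizable) (hg : 𝓑.IsPath g N (S.erase p)) (hp : p ∈ S)
    (hall : ∀ T ∈ 𝓑.tri S, p ∈ T) :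
    ((Rel.indexPairs N).filter fun e => 𝓑.rel p (g e.1) (g e.2) = .D).card = (𝓑.tri S).card := by
  have hpg : ∀ k, k < N → p ≠ g k := fun k hk e => Finset.notMem_erase p S (e ▸ hg.mem hk)
  refine Finset.card_bij (fun e _ => {p, g e.1, g e.2}) ?_ ?_ ?_
  · rintro ⟨i, j⟩ he
    rw [Finset.mem_filter, Rel.mem_indexPairs] at he
    obtain ⟨⟨hij, hj⟩, hD⟩ := he
    have hne := hg.ne (i := i) (j := j) (by simp at hij hj; omega) hj (by simp at hij hj; omega)
    exact triple_mem_tri hp (Finset.mem_of_mem_erase (hg.mem (by simp at hij hj; omega)))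
      (Finset.mem_of_mem_erase (hg.mem hj))
      (hpg i (by simp at hij hj; omega)) hne (hpg j hj)
      ((rel_eq_D h (hpg i (by simp at hij hj; omega)) (hpg j hj) hne).1 hD)
  · rintro ⟨i, j⟩ he ⟨i', j'⟩ he' H
    rw [Finset.mem_filter, Rel.mem_indexPairs] at he he'
    obtain ⟨⟨hij, hj⟩, -⟩ := he
    obtain ⟨⟨hij', hj'⟩, -⟩ := he'
    dsimp only at *
    have key : ∀ k, k < N → (g k ∈ ({p, g i, g j} : Finset 𝓑.carrier) ↔ k = i ∨ k = j) := by
      intro k hk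
      have hk1 : g k = p ↔ False := by simp [(hpg k hk).symm]
      have hk2 : g k = g i ↔ k = i := ⟨hg.inj _ _ hk (by omega), fun e => e ▸ rfl⟩
      have hk3 : g k = g j ↔ k = j := ⟨hg.inj _ _ hk (by omega), fun e => e ▸ rfl⟩
      simp [hk1, hk2, hk3]
    have h1 := (key i' (by omega)).1 (by rw [H]; simp)
    have h2 := (key j' (by omega)).1 (by rw [H]; simp)
    rw [Prod.mk.injEq]
    omega
  · intro T hT
    obtain ⟨i, j, hij, hj, rfl, hD⟩ := hg.exists_of_mem_tri h hall hT
    exact ⟨(i, j), Finset.mem_filter.2 ⟨Rel.mem_indexPairs.2 ⟨hij, hj⟩, hD⟩, rfl⟩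

theorem IsPath.sharedPair_of_star (h : 𝓑.IsAlmostMetrizable) (hg : 𝓑.IsPath g N (S.erase p))
    (hN : 0 < N) (hall : ∀ T ∈ 𝓑.tri S, p ∈ T)
    (hv : ∃ v, ∀ i j, i < j → j < N → 𝓑.rel p (g i) (g j) = .D → i = v ∨ j = v) :
    𝓑.SharedPair S := by
  obtain ⟨v, hv⟩ := hv
  have hpg : ∀ k, k < N → p ≠ g k := fun k hk e => Finset.notMem_erase p S (e ▸ hg.mem hk)
  -- If `v` is not an index of the path there are no triangles, and any path point can serve as the
  -- partner of `p`.
  refine ⟨p, g (if v < N then v else 0), hpg _ (by split_ifs <;> omega), fun T hT => ?_⟩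
  obtain ⟨i, j, hij, hj, rfl, hD⟩ := hg.exists_of_mem_tri h hall hT
  refine ⟨by simp, ?_⟩
  rcases hv i j hij hj hD with rfl | rfl
  · rw [if_pos (by omega)]; simp
  · rw [if_pos hj]; simp

/-- Without `p` the set is triangle-free, hence a path of five points, and the triangles are the
entries `D` of the searched pattern. -/
theorem card_tri_ne_one_of_six_points (h : 𝓑.IsAlmostMetrizable) (hS : S.card = 6) (hp : p ∈ S)
    (hall : ∀ T ∈ 𝓑.tri S, p ∈ T) :
    (𝓑.tri S).card ≠ 1 := by
  obtain ⟨g, hg⟩ := exists_isPath h 5 le_rfl (S.erase p) (tri_erase_eq_empty_iff.2 hall)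
    (by rw [Finset.card_erase_of_mem hp]; omega)
  have := Rel.card_ne_one_of_five (fun i j => 𝓑.rel p (g i) (g j))
    fun i j k hij hjk hk => hg.rel_ok h (Finset.notMem_erase p S) hij hjk hk
  rwa [hg.card_tri h hp hall] at this

theorem seven_points (h : 𝓑.IsAlmostMetrizable) (hS : S.card = 7) (hp : p ∈ S)
    (hall : ∀ T ∈ 𝓑.tri S, p ∈ T) : 𝓑.SharedPair S ∨ 5 ≤ (𝓑.tri S).card := by
  obtain ⟨g, hg⟩ := exists_isPath h 6 (by omega) (S.erase p) (tri_erase_eq_empty_iff.2 hall)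
    (by rw [Finset.card_erase_of_mem hp]; omega)
  have := Rel.six_star_or_many (fun i j => 𝓑.rel p (g i) (g j))
    fun i j k hij hjk hk => hg.rel_ok h (Finset.notMem_erase p S) hij hjk hk
  rw [hg.card_tri h hp hall] at this
  exact this.imp_left (hg.sharedPair_of_star h (by omega) hall)

end
end BetweennessStructure

/-! ### Lower bounds for the number of triangles. -/

namespace BetweennessStructure

open Classical

section Counting

variable {𝓑 : BetweennessStructure.{u}} {S : Finset 𝓑.carrier}

theorem eq_of_subset_tri {T T' : Finset 𝓑.carrier} (hT : T ∈ 𝓑.tri S) (hT' : T' ∈ 𝓑.tri S)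
    (hsub : T ⊆ T') : T = T' :=
  Finset.eq_of_subset_of_card_le hsub (by rw [(mem_tri.1 hT).2.1, (mem_tri.1 hT').2.1])

/-- A set of `n ≥ 5` points with a triangle has at least `n - 4` triangles. -/
theorem card_le_card_tri_add_four (h : 𝓑.IsAlmostMetrizable) (n : ℕ) (hn : 5 ≤ n) :
    ∀ S : Finset 𝓑.carrier, S.card = n → 𝓑.tri S ≠ ∅ → n ≤ (𝓑.tri S).card + 4 := by
  induction n, hn using Nat.le_induction with
  | base =>
    intro S _ hne
    have := Finset.card_pos.2 (Finset.nonempty_iff_ne_empty.2 hne)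
    omega
  | succ n hn ih =>
    intro S hS hne
    by_cases hp : ∃ p ∈ S, 0 < 𝓑.triDegree S p ∧ 𝓑.tri (S.erase p) ≠ ∅
    · obtain ⟨p, hpS, hp, hne'⟩ := hp
      have := ih (S.erase p) (by rw [Finset.card_erase_of_mem hpS]; omega) hne'
      have := card_tri_eq S p
      omega
    · exfalso
      push Not at hp
      -- Every point on a triangle now lies on all triangles, so there is only one triangle. Six
      -- points are excluded by the search; with more points, deleting a point off the triangle
      -- leaves at least two triangles by induction.
      obtain ⟨T, hT⟩ := Finset.nonempty_iff_ne_empty.2 hne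
      have hT' := mem_tri.1 hT
      have hall : ∀ p ∈ T, ∀ T' ∈ 𝓑.tri S, p ∈ T' := fun p hp' =>
        tri_erase_eq_empty_iff.1 (hp p (hT'.1 hp') (triDegree_pos_iff.2 ⟨T, hT, hp'⟩))
      have hone : 𝓑.tri S = {T} := by
        ext T'
        rw [Finset.mem_singleton]
        exact ⟨fun H => (eq_of_subset_tri hT H fun p hp => hall p hp T' H).symm, fun H => H ▸ hT⟩
      have hcard : (𝓑.tri S).card = 1 := by rw [hone, Finset.card_singleton]
      rcases hn.eq_or_lt with rfl | hn
      · obtain ⟨p, hp'⟩ := Finset.card_pos.1 (show 0 < T.card by omega)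
        exact card_tri_ne_one_of_six_points h hS (hT'.1 hp') (hall p hp') hcard
      · obtain ⟨q, hqS, hqT⟩ := Finset.exists_mem_notMem_of_card_lt_card (s := T) (t := S) (by omega)
        have hTq : T ∈ 𝓑.tri (S.erase q) := mem_tri_erase.2 ⟨hT, hqT⟩
        have h1 := ih (S.erase q) (by rw [Finset.card_erase_of_mem hqS]; omega)
          (Finset.ne_empty_of_mem hTq)
        have := Finset.card_le_card (tri_mono (𝓑 := 𝓑) (Finset.erase_subset q S))
        omega

theorem card_tri_erase_ge (h : 𝓑.IsAlmostMetrizable) {n : ℕ} (hn : 5 ≤ n) (hS : S.card = n + 1)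
    {p : 𝓑.carrier} (hp : p ∈ S) (hne : 𝓑.tri (S.erase p) ≠ ∅) :
    n ≤ (𝓑.tri (S.erase p)).card + 4 :=
  card_le_card_tri_add_four h n hn _ (by rw [Finset.card_erase_of_mem hp]; omega) hne

theorem sharedPair_of_eq_empty (hS : 2 ≤ S.card) (h0 : 𝓑.tri S = ∅) : 𝓑.SharedPair S := by
  obtain ⟨x, _, y, _, hxy⟩ := Finset.one_lt_card.1 (show 1 < S.card by omega)
  exact ⟨x, y, hxy, by simp [h0]⟩

/-- Combined with `card_tri_eq` at `y`, this doubles the bound: the triangles through `y` and those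
avoiding `y` are both numerous. -/
theorem card_tri_erase_le_triDegree {p y : 𝓑.carrier} (hy : ∀ T ∈ 𝓑.tri (S.erase p), y ∈ T) :
    (𝓑.tri (S.erase p)).card ≤ 𝓑.triDegree S y :=
  Finset.card_le_card fun T hT =>
    Finset.mem_filter.2 ⟨(mem_tri_erase.1 hT).1, hy T hT⟩

/-- The equality case of the preceding estimate: no triangle through `y` contains `p`. -/
theorem mem_tri_erase_of_triDegree_le {p y : 𝓑.carrier} (hy : ∀ T ∈ 𝓑.tri (S.erase p), y ∈ T)
    (hle : 𝓑.triDegree S y ≤ (𝓑.tri (S.erase p)).card) {T : Finset 𝓑.carrier} (hT : T ∈ 𝓑.tri S)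
    (hyT : y ∈ T) : T ∈ 𝓑.tri (S.erase p) := by
  have : 𝓑.tri (S.erase p) = (𝓑.tri S).filter fun T => y ∈ T :=
    Finset.eq_of_subset_of_card_le
      (fun T hT => Finset.mem_filter.2 ⟨(mem_tri_erase.1 hT).1, hy T hT⟩) hle
  rw [this]
  exact Finset.mem_filter.2 ⟨hT, hyT⟩

theorem exists_triDegree_gt {k : ℕ} (hk : k * S.card < 3 * (𝓑.tri S).card) :
    ∃ p ∈ S, k < 𝓑.triDegree S p := by
  by_contra H
  push Not at H
  have := Finset.sum_le_card_nsmul S _ k H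
  rw [sum_triDegree, smul_eq_mul] at this
  rw [mul_comm] at hk
  omega

/-- The degrees add up to three times the number of triangles and `p` takes at most one third of
that. The remaining `|S| - 1` points share a total of at least `|S|`. -/
theorem exists_ne_triDegree_gt {p : 𝓑.carrier} (hp : p ∈ S)
    (hk : S.card ≤ 2 * (𝓑.tri S).card) : ∃ x ∈ S, x ≠ p ∧ 1 < 𝓑.triDegree S x := by
  by_contra H
  push Not at H
  have h1 := Finset.sum_le_card_nsmul (S.erase p) (fun x => 𝓑.triDegree S x) 1 fun x hx =>
    H x (Finset.mem_of_mem_erase hx) (Finset.ne_of_mem_erase hx)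
  have h2 := Finset.add_sum_erase S (𝓑.triDegree S) hp
  have h3 := card_tri_eq S p
  rw [sum_triDegree] at h2
  rw [Finset.card_erase_of_mem hp, smul_eq_mul] at h1
  have := Finset.card_pos.2 ⟨p, hp⟩
  omega

theorem filter_pair_subset {p c x : 𝓑.carrier} (hc : c ∈ S) (hp : p ∈ S) (hpc : p ≠ c)
    (hx : ∀ T ∈ 𝓑.tri S, c ∈ T → x ∉ T) :
    (((S.erase p).erase c).filter fun w => ¬ 𝓑.Collinear {p, c, w}) ⊆
      ((S.erase p).erase c).erase x := by
  intro w hw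
  rw [Finset.mem_filter] at hw
  refine Finset.mem_erase.2 ⟨?_, hw.1⟩
  rintro rfl
  have hw1 := hw.1
  simp only [Finset.mem_erase] at hw1
  exact hx _ (triple_mem_tri hp hc hw1.2.2 hpc hw1.1.symm hw1.2.1.symm hw.2) (by simp) (by simp)

theorem mem_tri_of_mem_filter {p c w : 𝓑.carrier} (hc : c ∈ S) (hp : p ∈ S) (hpc : p ≠ c)
    (hw : w ∈ ((S.erase p).erase c).filter fun w => ¬ 𝓑.Collinear {p, c, w}) :
    {p, c, w} ∈ 𝓑.tri S := by
  rw [Finset.mem_filter, Finset.mem_erase, Finset.mem_erase] at hw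
  exact triple_mem_tri hp hc hw.1.2.2 hpc hw.1.1.symm hw.1.2.1.symm hw.2

theorem exists_ne_common {p y z : 𝓑.carrier} (hyz : y ≠ z)
    (hs : ∀ T ∈ 𝓑.tri S, y ∈ T ∧ z ∈ T) : ∃ c, c ≠ p ∧ ∀ T ∈ 𝓑.tri S, c ∈ T := by
  by_cases hy : y = p
  · exact ⟨z, fun H => hyz (hy.trans H.symm), fun T hT => (hs T hT).2⟩
  · exact ⟨y, hy, fun T hT => (hs T hT).1⟩

/-- If all triangles have a common point but no common pair, there are at least `2n - 9`. -/
theorem two_mul_card_le_of_common_point (h : 𝓑.IsAlmostMetrizable) (n : ℕ) (hn : 7 ≤ n) :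
    ∀ (S : Finset 𝓑.carrier) (p : 𝓑.carrier), S.card = n → p ∈ S → (∀ T ∈ 𝓑.tri S, p ∈ T) →
      ¬ 𝓑.SharedPair S → 2 * n ≤ (𝓑.tri S).card + 9 := by
  induction n, hn using Nat.le_induction with
  | base =>
    intro S p hS hp hall hns
    have := (seven_points h hS hp hall).resolve_left hns
    omega
  | succ n hn ih =>
    intro S p hS hp hall hns
    by_contra! hm
    have hne : 𝓑.tri S ≠ ∅ := fun h0 => hns (sharedPair_of_eq_empty (by omega) h0)
    have hm1 := card_le_card_tri_add_four h (n + 1) (by omega) S hS hne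
    -- Such a deletion removes at least two triangles, which brings the count below `2n - 9`, so by
    -- induction only a common pair is possible.
    have hdel : ∀ x ∈ S, x ≠ p → 1 < 𝓑.triDegree S x → 𝓑.SharedPair (S.erase x) := by
      intro x hx hxp hd
      by_contra hns'
      have h1 := ih (S.erase x) p (by rw [Finset.card_erase_of_mem hx]; omega)
        (Finset.mem_erase.2 ⟨hxp.symm, hp⟩) (fun T hT => hall T (mem_tri_erase.1 hT).1) hns'
      have := card_tri_eq S x
      omega
    have hne' : ∀ x, x ≠ p → 𝓑.tri (S.erase x) ≠ ∅ := fun x hx h0 =>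
      hns ⟨p, x, hx.symm, fun T hT => ⟨hall T hT, tri_erase_eq_empty_iff.1 h0 T hT⟩⟩
    obtain ⟨x, hx, hxp, hdx⟩ := exists_ne_triDegree_gt hp (by omega)
    have hmx := card_tri_erase_ge h (by omega) hS hx (hne' x hxp)
    obtain ⟨y, z, hyz, hsh⟩ := hdel x hx hxp hdx
    obtain ⟨c, hcp, hc⟩ := exists_ne_common (p := p) hyz hsh
    obtain ⟨T0, hT0⟩ := Finset.nonempty_iff_ne_empty.2 (hne' x hxp)
    have hcx := Finset.mem_erase.1 (mem_of_mem_tri hT0 (hc T0 hT0))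
    have hmc := card_tri_erase_ge h (by omega) hS hcx.2 (hne' c hcp)
    have h1 := card_tri_erase_le_triDegree hc
    have h2 := card_tri_eq S c
    -- The degree of `c` and the number of triangles avoiding `c` are both at least `n - 4`, and
    -- they add up to at most `2n - 8`. Equality holds throughout, so no triangle contains both `c`
    -- and `x`.
    have hcT : ∀ T ∈ 𝓑.tri S, c ∈ T → x ∉ T := fun T hT hcT =>
      (mem_tri_erase.1 (mem_tri_erase_of_triDegree_le hc (by omega) hT hcT)).2
    have hxT : ∀ T ∈ 𝓑.tri S, x ∈ T → c ∉ T := fun T hT h1 h2 => hcT T hT h2 h1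
    have hcard : ∀ q, (((𝓑.tri S).filter fun T => q ∈ T).card =
        ((𝓑.tri S).filter fun T => p ∈ T ∧ q ∈ T).card) := fun q => by
      congr 1
      ext T
      simp only [Finset.mem_filter]
      exact ⟨fun H => ⟨H.1, hall T H.1, H.2⟩, fun H => ⟨H.1, H.2.2⟩⟩
    -- `A` and `B` are the third points of the triangles over `p, c` and over `p, x`. Both have at
    -- least `n - 4` elements and lie among the `n - 2` points other than `p`, `c`, `x`, so they
    -- meet because `n ≥ 7`.
    set A := ((S.erase p).erase c).filter fun w => ¬ 𝓑.Collinear {p, c, w} with hA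
    set B := ((S.erase p).erase x).filter fun w => ¬ 𝓑.Collinear {p, x, w} with hB
    have hAcard : n ≤ A.card + 4 := by
      rw [hA, ← card_filter_pair hcp.symm hp hcx.2, ← hcard]
      exact hmx.trans (by have := h1; unfold triDegree at this; omega)
    have hBcard : n ≤ B.card + 4 := by
      rw [hB, ← card_filter_pair hxp.symm hp hx, ← hcard]
      have : (𝓑.tri (S.erase c)).card ≤ 𝓑.triDegree S x := by
        refine Finset.card_le_card fun T hT => ?_
        rw [mem_tri_erase] at hT
        refine Finset.mem_filter.2 ⟨hT.1, ?_⟩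
        by_contra hxT'
        exact hT.2 (hc T (mem_tri_erase.2 ⟨hT.1, hxT'⟩))
      unfold triDegree at this
      omega
    have hAsub : A ⊆ ((S.erase p).erase c).erase x := filter_pair_subset hcx.2 hp hcp.symm hcT
    have hBsub : B ⊆ ((S.erase p).erase c).erase x := by
      rw [Finset.erase_right_comm]
      exact filter_pair_subset hx hp hxp.symm hxT
    have hWcard : (((S.erase p).erase c).erase x).card = n - 2 := by
      rw [Finset.card_erase_of_mem, Finset.card_erase_of_mem, Finset.card_erase_of_mem hp]
      · omega
      · simp [hcp, hcx.2]
      · simp [hxp, hcx.1.symm, hx]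
    obtain ⟨w, hw⟩ : (A ∩ B).Nonempty := by
      rw [← Finset.card_pos]
      have h3 := Finset.card_union_add_card_inter A B
      have h4 := Finset.card_le_card (Finset.union_subset hAsub hBsub)
      omega
    obtain ⟨hwA, hwB⟩ := Finset.mem_inter.1 hw
    have hwW := hAsub hwA
    simp only [Finset.mem_erase] at hwW
    have hd : 1 < 𝓑.triDegree S w := by
      refine Finset.one_lt_card.2 ⟨{p, c, w}, ?_, {p, x, w}, ?_, ?_⟩
      · exact Finset.mem_filter.2 ⟨mem_tri_of_mem_filter hcx.2 hp hcp.symm hwA, by simp⟩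
      · exact Finset.mem_filter.2 ⟨mem_tri_of_mem_filter hx hp hxp.symm hwB, by simp⟩
      · intro H
        have : c ∈ ({p, x, w} : Finset 𝓑.carrier) := H ▸ (by simp)
        simp only [Finset.mem_insert, Finset.mem_singleton] at this
        rcases this with H | H | H
        · exact hcp H
        · exact hcx.1 H
        · exact hwW.2.1 H.symm
    obtain ⟨y', z', hyz', hsh'⟩ := hdel w hwW.2.2.2 hwW.2.2.1 hd
    -- Deleting `w` must leave a common pair, but two triangles over `p, c` and one over `p, x`
    -- survive, and these have only `p` in common.
    obtain ⟨b, hb⟩ : (B.erase w).Nonempty := by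
      rw [← Finset.card_pos, Finset.card_erase_of_mem hwB]; omega
    obtain ⟨a, ha, a', ha', haa⟩ := Finset.one_lt_card.1
      (show 1 < (A.erase w).card by rw [Finset.card_erase_of_mem hwA]; omega)
    rw [Finset.mem_erase] at ha ha' hb
    have t1 : {p, c, a} ∈ 𝓑.tri (S.erase w) := mem_tri_erase.2
      ⟨mem_tri_of_mem_filter hcx.2 hp hcp.symm ha.2, by
        simp [hwW.2.2.1, hwW.2.1, ha.1.symm]⟩
    have t2 : {p, c, a'} ∈ 𝓑.tri (S.erase w) := mem_tri_erase.2
      ⟨mem_tri_of_mem_filter hcx.2 hp hcp.symm ha'.2, by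
        simp [hwW.2.2.1, hwW.2.1, ha'.1.symm]⟩
    have t3 : {p, x, b} ∈ 𝓑.tri (S.erase w) := mem_tri_erase.2
      ⟨mem_tri_of_mem_filter hx hp hxp.symm hb.2, by
        simp [hwW.2.2.1, hwW.1, hb.1.symm]⟩
    have hbW := hBsub hb.2
    have haW := hAsub ha.2
    have haW' := hAsub ha'.2
    have s1 := hsh' _ t1
    have s2 := hsh' _ t2
    have s3 := hsh' _ t3
    simp only [Finset.mem_insert, Finset.mem_singleton, Finset.mem_erase] at s1 s2 s3 hbW haW haW'
    grind

/-- A set of `n ≥ 6` points with at most `2n - 11` triangles has a pair common to all of them. -/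
theorem sharedPair_of_card_tri_le (h : 𝓑.IsAlmostMetrizable) (n : ℕ) (hn : 6 ≤ n) :
    ∀ S : Finset 𝓑.carrier, S.card = n → (𝓑.tri S).card + 11 ≤ 2 * n → 𝓑.SharedPair S := by
  induction n, hn using Nat.le_induction with
  | base =>
    intro S hS hm
    by_contra hns
    have := card_le_card_tri_add_four h 6 (by omega) S hS
      fun h0 => hns (sharedPair_of_eq_empty (by omega) h0)
    omega
  | succ n hn ih =>
    intro S hS hm
    by_contra hns
    have hne : 𝓑.tri S ≠ ∅ := fun h0 => hns (sharedPair_of_eq_empty (by omega) h0)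
    have hm1 := card_le_card_tri_add_four h (n + 1) (by omega) S hS hne
    have hne' : ∀ p ∈ S, 𝓑.tri (S.erase p) ≠ ∅ := by
      intro p hp h0
      have := two_mul_card_le_of_common_point h (n + 1) (by omega) S p hS hp
        (tri_erase_eq_empty_iff.1 h0) hns
      omega
    -- Deleting a point on two triangles leaves at most `2n - 11`, hence a common pair `y, z`. The
    -- triangles through `y` and those avoiding `y` then number at least `n - 4` each, against a
    -- total of at most `2n - 9`.
    obtain ⟨p, hp, hd⟩ := exists_triDegree_gt (𝓑 := 𝓑) (S := S) (k := 1) (by omega)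
    have h1 := card_tri_eq S p
    obtain ⟨y, z, hyz, hsh⟩ := ih (S.erase p) (by rw [Finset.card_erase_of_mem hp]; omega) (by omega)
    obtain ⟨T0, hT0⟩ := Finset.nonempty_iff_ne_empty.2 (hne' p hp)
    have hy := Finset.mem_of_mem_erase (mem_of_mem_tri hT0 (hsh T0 hT0).1)
    have h2 := card_tri_erase_ge h (by omega) hS hp (hne' p hp)
    have h3 := card_tri_erase_ge h (by omega) hS hy (hne' y hy)
    have h4 := card_tri_erase_le_triDegree fun T hT => (hsh T hT).1
    have h5 := card_tri_eq S y
    omega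

/-- The possible numbers of triangles below `2n - 10`. -/
theorem card_tri_cases (h : 𝓑.IsAlmostMetrizable) (hn : 6 ≤ S.card)
    (hm : (𝓑.tri S).card + 11 ≤ 2 * S.card) :
    (𝓑.tri S).card = 0 ∨
      (S.card ≤ (𝓑.tri S).card + 4 ∧ (𝓑.tri S).card + 2 ≤ S.card) := by
  have h1 := (sharedPair_of_card_tri_le h _ hn S rfl hm).card_tri_le
  rcases eq_or_ne (𝓑.tri S) ∅ with h0 | h0
  · left; simp [h0]
  · right
    exact ⟨card_le_card_tri_add_four h _ (by omega) S rfl h0, by omega⟩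

/-- Two pairs `y, z` and `u, v` such that every triangle of `S` contains exactly one of them and
one further point, which can be any further point but `a` and `b`, respectively. -/
structure TwoTwins (𝓑 : BetweennessStructure.{u}) (S : Finset 𝓑.carrier)
    (y z u v a b : 𝓑.carrier) : Prop where
  y_mem : y ∈ S
  z_mem : z ∈ S
  u_mem : u ∈ S
  v_mem : v ∈ S
  a_mem : a ∈ S
  b_mem : b ∈ S
  nodup : [y, z, u, v].Nodup
  a_notMem : a ∉ [y, z, u, v]
  b_notMem : b ∉ [y, z, u, v]
  mem_tri : ∀ T ∈ 𝓑.tri S, (y ∈ T ∧ z ∈ T ∧ u ∉ T ∧ v ∉ T) ∨ (u ∈ T ∧ v ∈ T ∧ y ∉ T ∧ z ∉ T)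
  collinear_yz : 𝓑.Collinear {y, z, a}
  collinear_uv : 𝓑.Collinear {u, v, b}
  not_collinear_yz : ∀ w ∈ S, w ∉ [y, z, u, v] → w ≠ a → ¬ 𝓑.Collinear {y, z, w}
  not_collinear_uv : ∀ w ∈ S, w ∉ [y, z, u, v] → w ≠ b → ¬ 𝓑.Collinear {u, v, w}

/-- The third points of the `|S| - 5` triangles through `y` all lie among the `|S| - 4` points
outside the two pairs, so exactly one of those points is left over. -/
theorem exists_unique_collinear {y z u v : 𝓑.carrier} (hn : 9 ≤ S.card)
    (hy : y ∈ S) (hz : z ∈ S) (hu : u ∈ S) (hv : v ∈ S) (hnd : [y, z, u, v].Nodup)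
    (hd : 𝓑.triDegree S y + 5 = S.card)
    (hT : ∀ T ∈ 𝓑.tri S, y ∈ T → z ∈ T ∧ u ∉ T ∧ v ∉ T) :
    ∃ a ∈ S, a ∉ [y, z, u, v] ∧ 𝓑.Collinear {y, z, a} ∧
      ∀ w ∈ S, w ∉ [y, z, u, v] → w ≠ a → ¬ 𝓑.Collinear {y, z, w} := by
  simp only [List.nodup_cons, List.mem_cons, List.not_mem_nil, or_false, not_or, not_false_eq_true,
    List.nodup_nil, and_true] at hnd
  obtain ⟨⟨hyz, hyu, hyv⟩, ⟨hzu, hzv⟩, huv⟩ := hnd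
  have hcard : 𝓑.triDegree S y =
      (((S.erase y).erase z).filter fun w => ¬ 𝓑.Collinear {y, z, w}).card := by
    rw [← card_filter_pair hyz hy hz, triDegree]
    congr 1
    ext T
    simp only [Finset.mem_filter]
    exact ⟨fun H => ⟨H.1, H.2, (hT T H.1 H.2).1⟩, fun H => ⟨H.1, H.2.1⟩⟩
  set A := ((S.erase y).erase z).filter fun w => ¬ 𝓑.Collinear {y, z, w} with hA
  set W := (((S.erase y).erase z).erase u).erase v with hW
  have hAW : A ⊆ W := by
    intro w hw
    have h1 := hT _ (mem_tri_of_mem_filter hz hy hyz hw) (by simp)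
    rw [hA, Finset.mem_filter] at hw
    simp only [Finset.mem_insert, Finset.mem_singleton, not_or] at h1
    exact Finset.mem_erase.2 ⟨Ne.symm h1.2.2.2.2, Finset.mem_erase.2 ⟨Ne.symm h1.2.1.2.2, hw.1⟩⟩
  have hWcard : W.card = S.card - 4 := by
    rw [hW, Finset.card_erase_of_mem, Finset.card_erase_of_mem, Finset.card_erase_of_mem,
      Finset.card_erase_of_mem hy]
    · omega
    · simp [Ne.symm hyz, hz]
    · simp [Ne.symm hyu, Ne.symm hzu, hu]
    · simp [Ne.symm hyv, Ne.symm hzv, Ne.symm huv, hv]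
  have h1 : (W \ A).card = 1 := by rw [Finset.card_sdiff_of_subset hAW]; omega
  obtain ⟨a, ha⟩ := Finset.card_eq_one.1 h1
  have hWmem : ∀ w, w ∈ W ↔ w ∈ S ∧ w ∉ [y, z, u, v] := by
    intro w
    simp only [hW, Finset.mem_erase, List.mem_cons, List.not_mem_nil, or_false, not_or]
    tauto
  have hAmem : ∀ w, w ∈ W → (w ∈ A ↔ ¬ 𝓑.Collinear {y, z, w}) := by
    intro w hw
    rw [hA, Finset.mem_filter, and_iff_right]
    exact Finset.mem_of_mem_erase (Finset.mem_of_mem_erase hw)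
  have hmem : ∀ w, w ∈ W → (w = a ↔ 𝓑.Collinear {y, z, w}) := by
    intro w hw
    rw [← Finset.mem_singleton, ← ha, Finset.mem_sdiff, and_iff_right hw, hAmem w hw, not_not]
  have haW : a ∈ W := by
    have : a ∈ W \ A := by simp [ha]
    exact (Finset.mem_sdiff.1 this).1
  refine ⟨a, ((hWmem a).1 haW).1, ((hWmem a).1 haW).2, (hmem a haW).1 rfl, fun w hw hw' hwa => ?_⟩
  rw [← hmem w ((hWmem w).2 ⟨hw, hw'⟩)]
  exact hwa

/-- A set of `n ≥ 9` points with exactly `2n - 10` triangles has the triangles of `T_{n,i}`. -/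
theorem exists_twoTwins (h : 𝓑.IsAlmostMetrizable) (hn : 9 ≤ S.card)
    (hm : (𝓑.tri S).card + 10 = 2 * S.card) : ∃ y z u v a b, 𝓑.TwoTwins S y z u v a b := by
  obtain ⟨n, hS⟩ : ∃ n, S.card = n + 1 := ⟨S.card - 1, by omega⟩
  -- A common pair allows at most `|S| - 2` triangles, which is less than `2|S| - 10` exactly when
  -- `|S| ≥ 9`.
  have hns : ¬ 𝓑.SharedPair S := fun H => by
    have := H.card_tri_le
    omega
  have hne : ∀ p ∈ S, 𝓑.tri (S.erase p) ≠ ∅ := by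
    intro p hp h0
    have := two_mul_card_le_of_common_point h (n + 1) (by omega) S p hS hp
      (tri_erase_eq_empty_iff.1 h0) hns
    omega
  have hcard : ∀ p ∈ S, (S.erase p).card = n := fun p hp => by
    rw [Finset.card_erase_of_mem hp]; omega
  have hge := fun p hp => card_tri_erase_ge h (by omega) hS hp (hne p hp)
  have hshare : ∀ p ∈ S, 2 < 𝓑.triDegree S p → ∃ y z, y ≠ z ∧ y ∈ S.erase p ∧ z ∈ S.erase p ∧
      (∀ T ∈ 𝓑.tri (S.erase p), y ∈ T) ∧ (∀ T ∈ 𝓑.tri (S.erase p), z ∈ T) := by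
    intro p hp hd
    have h1 := card_tri_eq S p
    obtain ⟨y, z, hyz, hsh⟩ := sharedPair_of_card_tri_le h n (by omega) _ (hcard p hp) (by omega)
    obtain ⟨T0, hT0⟩ := Finset.nonempty_iff_ne_empty.2 (hne p hp)
    exact ⟨y, z, hyz, mem_of_mem_tri hT0 (hsh T0 hT0).1, mem_of_mem_tri hT0 (hsh T0 hT0).2,
      fun T hT => (hsh T hT).1, fun T hT => (hsh T hT).2⟩
  -- The `2n - 8` triangles split into those through `y` and those avoiding `y`, each at least `n -
  -- 4` in number. So both counts are exact.
  have hdeg : ∀ p ∈ S, ∀ y ∈ S, (∀ T ∈ 𝓑.tri (S.erase p), y ∈ T) →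
      𝓑.triDegree S y + 5 = S.card ∧ ∀ T ∈ 𝓑.tri S, y ∈ T → T ∈ 𝓑.tri (S.erase p) := by
    intro p hp y hy hT
    have h1 := card_tri_erase_le_triDegree hT
    have h2 := card_tri_eq S y
    have h3 := hge p hp
    have h4 := hge y hy
    exact ⟨by omega, fun T hT' hyT => mem_tri_erase_of_triDegree_le hT (by omega) hT' hyT⟩
  obtain ⟨p, hp, hd⟩ := exists_triDegree_gt (𝓑 := 𝓑) (S := S) (k := 2) (by omega)
  obtain ⟨y, z, hyz, hy, hz, hyT, hzT⟩ := hshare p hp hd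
  have hy := Finset.mem_of_mem_erase hy
  have hz := Finset.mem_of_mem_erase hz
  have dy := hdeg p hp y hy hyT
  have dz := hdeg p hp z hz hzT
  -- The degree of `y` is `|S| - 5 ≥ 4`, so deleting `y` exposes a second pair, common to all
  -- triangles that avoid `y`.
  obtain ⟨u, v, huv, hu, hv, huT, hvT⟩ := hshare y hy (by omega)
  rw [Finset.mem_erase] at hu hv
  have du := hdeg y hy u hu.2 huT
  have dv := hdeg y hy v hv.2 hvT
  have hz' : ∀ T ∈ 𝓑.tri S, z ∈ T → y ∈ T := fun T hT H => hyT T (dz.2 T hT H)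
  have key1 : ∀ T ∈ 𝓑.tri S, y ∈ T → z ∈ T ∧ u ∉ T ∧ v ∉ T := fun T hT H =>
    ⟨hzT T (dy.2 T hT H), fun H' => (mem_tri_erase.1 (du.2 T hT H')).2 H,
      fun H' => (mem_tri_erase.1 (dv.2 T hT H')).2 H⟩
  have key2 : ∀ T ∈ 𝓑.tri S, u ∈ T → v ∈ T ∧ y ∉ T ∧ z ∉ T := fun T hT H => by
    have h1 := du.2 T hT H
    have h2 := (mem_tri_erase.1 h1).2
    exact ⟨hvT T h1, h2, fun H' => h2 (hz' T hT H')⟩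
  have hzu : z ≠ u := by
    rintro rfl
    obtain ⟨T0, hT0⟩ := Finset.nonempty_iff_ne_empty.2 (hne y hy)
    have := mem_tri_erase.1 hT0
    exact this.2 (hz' T0 this.1 (huT T0 hT0))
  have hzv : z ≠ v := by
    rintro rfl
    obtain ⟨T0, hT0⟩ := Finset.nonempty_iff_ne_empty.2 (hne y hy)
    have := mem_tri_erase.1 hT0
    exact this.2 (hz' T0 this.1 (hvT T0 hT0))
  have hnd : [y, z, u, v].Nodup := by
    simp [hyz, hu.1.symm, hv.1.symm, hzu, hzv, huv]
  have hnd' : [u, v, y, z].Nodup := by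
    simp [hyz, hu.1, hv.1, hzu.symm, hzv.symm, huv]
  have hperm : ∀ w, w ∈ [y, z, u, v] ↔ w ∈ [u, v, y, z] := by
    intro w; simp only [List.mem_cons, List.not_mem_nil, or_false]; tauto
  obtain ⟨a, ha, ha', hac, hau⟩ := exists_unique_collinear hn hy hz hu.2 hv.2 hnd dy.1 key1
  obtain ⟨b, hb, hb', hbc, hbu⟩ := exists_unique_collinear hn hu.2 hv.2 hy hz hnd' du.1 key2
  refine ⟨y, z, u, v, a, b, hy, hz, hu.2, hv.2, ha, hb, hnd, ha', by rwa [hperm], ?_, hac, hbc, hau,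
    fun w hw hw' => hbu w hw (by rwa [← hperm])⟩
  intro T hT
  by_cases hyT' : y ∈ T
  · exact Or.inl ⟨hyT', key1 T hT hyT'⟩
  · have h1 := huT T (mem_tri_erase.2 ⟨hT, hyT'⟩)
    exact Or.inr ⟨h1, key2 T hT h1⟩

end Counting
end BetweennessStructure

/-! ### Two points that extend the same path. -/

namespace BetweennessStructure

open Classical

section Pair

variable {𝓑 : BetweennessStructure.{u}} {g : ℕ → 𝓑.carrier} {M : ℕ} {P : Finset 𝓑.carrier}
  {y z : 𝓑.carrier} {a b : ℕ}

theorem IsGap.reverse (h : 𝓑.IsAlmostMetrizable) (ha : 𝓑.IsGap g M y a) :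
    𝓑.IsGap (fun i => g (M - 1 - i)) M y (M - a) where
  le := by omega
  right i j hij hj := h.symm _ _ _ (ha.left _ _ (by omega) (by omega) (by omega))
  mid i j hi hj hjM := h.symm _ _ _ (ha.mid _ _ (by omega) (by omega) (by omega))
  left i j hi hij hj := h.symm _ _ _ (ha.right _ _ (by omega) (by omega))

theorem collinear_of_btw (h : 𝓑.IsAlmostMetrizable) {x y z : 𝓑.carrier} (hxy : x ≠ y) (hyz : y ≠ z)
    (hxz : x ≠ z) (H : 𝓑.btw x y z ∨ 𝓑.btw y x z ∨ 𝓑.btw x z y) : 𝓑.Collinear {x, y, z} :=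
  (collinear_triple h hxy hyz hxz).2 H

theorem IsPath.ne_of_notMem (hg : 𝓑.IsPath g M P) (hy : y ∉ P) {j : ℕ} (hj : j < M) : y ≠ g j :=
  fun e => hy (e ▸ hg.mem hj)

variable (h : 𝓑.IsAlmostMetrizable) (hg : 𝓑.IsPath g M P) (hy : y ∉ P) (hz : z ∉ P) (hyz : y ≠ z)
  (ha : 𝓑.IsGap g M y a) (hb : 𝓑.IsGap g M z b)

include h hg hy hz hyz ha hb

/-- The entry `g (a - 1)` precedes both points, and from there `y` comes before `z`. Anchored at
this entry, (P4) orders `y` and `z` against the whole path. -/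
theorem collinear_of_gap_lt (ha1 : 1 ≤ a) (hab : a < b) {j : ℕ} (hj : j < M) :
    𝓑.Collinear {y, z, g j} := by
  have hbM := hb.le
  apply collinear_of_btw h hyz (hg.ne_of_notMem hz hj) (hg.ne_of_notMem hy hj)
  rcases Nat.lt_or_ge j a with hja | hja
  · right; left
    have h1 := ha.mid j a hja le_rfl (by omega)
    have h2 := hb.right j a hja hab
    exact h.symm _ _ _ (h.trans_outer h2 h1)
  rcases Nat.lt_or_ge j b with hjb | hjb
  · right; right
    have h1 := ha.mid (a - 1) j (by omega) hja hj
    have h2 := hb.right (a - 1) j (by omega) hjb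
    exact h.trans_inner h2 h1
  · left
    have h0 := ha.mid (a - 1) a (by omega) le_rfl (by omega)
    have h1 := hb.right (a - 1) a (by omega) hab
    have h2 := h.trans_outer h1 h0
    have h3 := hb.mid (a - 1) j (by omega) hjb hj
    exact h.trans_inner h3 h2

theorem collinear_of_gap_lt' (hbM : b < M) (hab : a < b) {j : ℕ} (hj : j < M) :
    𝓑.Collinear {y, z, g j} := by
  have := collinear_of_gap_lt h (hg.reverse h) hz hy hyz.symm (hb.reverse h) (ha.reverse h)
    (by omega) (by omega) (j := M - 1 - j) (by omega)
  rw [Finset.insert_comm] at this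
  simpa [show M - 1 - (M - 1 - j) = j by omega] using this

/-- If `y` or `z` were the middle one of the collinear triple, the relation would spread to every
entry of the path. So `g j` is in the middle, and it is the first entry after the gap: `g a`
precedes `g j` as seen from both `y` and `z`. -/
theorem btw_of_same_gap_of_le (hab : a = b) (hnot : ∃ k < M, ¬ 𝓑.Collinear {y, z, g k}) {j : ℕ}
    (hj : j < M) (haj : a ≤ j) (hc : 𝓑.Collinear {y, z, g j}) : 𝓑.btw y (g j) z ∧ j = a := by
  subst hab
  have hy' : ∀ {k}, k < M → y ≠ g k := fun hk => hg.ne_of_notMem hy hk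
  have hz' : ∀ {k}, k < M → z ≠ g k := fun hk => hg.ne_of_notMem hz hk
  have key : ∀ {y z : 𝓑.carrier}, y ∉ P → z ∉ P → y ≠ z → 𝓑.IsGap g M y a → 𝓑.IsGap g M z a →
      𝓑.btw y z (g j) → ∀ k < M, 𝓑.Collinear {y, z, g k} := by
    intro y z hy hz hyz ha hb H k hk
    apply collinear_of_btw h hyz (hg.ne_of_notMem hz hk) (hg.ne_of_notMem hy hk)
    rcases Nat.lt_or_ge k a with hka | hka
    · right; left
      exact h.trans_inner (h.symm _ _ _ (ha.mid k j hka haj hj)) (h.symm _ _ _ H)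
    rcases Nat.lt_trichotomy k j with hkj | rfl | hkj
    · left
      exact h.symm _ _ _ (h.trans_inner (h.symm _ _ _ H) (h.symm _ _ _ (hb.left k j hka hkj hj)))
    · left; exact H
    · left
      exact h.trans_outer (ha.left j k haj hkj hk) H
  obtain ⟨k, hk, hkn⟩ := hnot
  rcases (collinear_triple h hyz (hz' hj) (hy' hj)).1 hc with H | H | H
  · exact absurd (key hy hz hyz ha hb H k hk) hkn
  · refine absurd ?_ hkn
    rw [Finset.insert_comm]
    exact key hz hy hyz.symm hb ha H k hk
  · refine ⟨H, ?_⟩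
    by_contra hne
    have h1 := ha.left a j le_rfl (by omega) hj
    have h2 := hb.left a j le_rfl (by omega) hj
    have h3 := h.trans_inner H h1
    exact h.not_btw_left (hg.ne (by omega) hj (by omega)) h3 (h.symm _ _ _ h2)

theorem btw_of_same_gap (hab : a = b) (hnot : ∃ k < M, ¬ 𝓑.Collinear {y, z, g k}) {j : ℕ}
    (hj : j < M) (hc : 𝓑.Collinear {y, z, g j}) : 𝓑.btw y (g j) z ∧ (j = a ∨ j + 1 = a) := by
  rcases Nat.lt_or_ge j a with hja | hja
  · obtain ⟨k, hk, hkn⟩ := hnot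
    have haM := ha.le
    have hr : ∀ i, i < M → M - 1 - (M - 1 - i) = i := fun i hi => by omega
    have := btw_of_same_gap_of_le h (hg.reverse h) hy hz hyz (ha.reverse h) (hb.reverse h)
      (by omega) ⟨M - 1 - k, by omega, by simpa [hr k hk] using hkn⟩ (j := M - 1 - j) (by omega)
      (by omega) (by simpa [hr j hj] using hc)
    simp only [hr j hj] at this
    exact ⟨this.1, by omega⟩
  · have := btw_of_same_gap_of_le h hg hy hz hyz ha hb hab hnot hj hja hc
    exact ⟨this.1, Or.inl this.2⟩

/-- An entry between `y` and `z` would force every entry to be between them. Hence `y` or `z` is in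
the middle, and the entry is the end of the path next to it. -/
theorem btw_of_opposite_ends (ha0 : a = 0) (hbM : b = M)
    (hnot : ∃ k < M, ¬ 𝓑.Collinear {y, z, g k}) {j : ℕ} (hj : j < M)
    (hc : 𝓑.Collinear {y, z, g j}) :
    (j = 0 ∧ 𝓑.btw z y (g j)) ∨ (j + 1 = M ∧ 𝓑.btw y z (g j)) := by
  subst ha0 hbM
  have hy' : ∀ {k}, k < b → y ≠ g k := fun hk => hg.ne_of_notMem hy hk
  have hz' : ∀ {k}, k < b → z ≠ g k := fun hk => hg.ne_of_notMem hz hk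
  rcases (collinear_triple h hyz (hz' hj) (hy' hj)).1 hc with H | H | H
  · right
    refine ⟨?_, H⟩
    by_contra hne
    have h1 := hb.right j (b - 1) (by omega) (by omega)
    have h2 := h.trans_outer (h.symm _ _ _ H) h1
    exact h.not_btw_right (hg.ne hj (by omega) (by omega))
      (ha.left j (b - 1) (by omega) (by omega) (by omega)) (h.symm _ _ _ h2)
  · left
    refine ⟨?_, H⟩
    by_contra hne
    have h1 := ha.left 0 j (by omega) (by omega) (by omega)
    have h2 := h.trans_outer (h.symm _ _ _ H) (h.symm _ _ _ h1)
    exact h.not_btw_left (hg.ne (i := 0) (j := j) (by omega) (by omega) (by omega))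
      (hb.right 0 j (by omega) (by omega)) h2
  · exfalso
    obtain ⟨k, hk, hkn⟩ := hnot
    refine hkn (collinear_of_btw h hyz (hz' hk) (hy' hk) (Or.inr (Or.inr ?_)))
    rcases Nat.lt_trichotomy k j with hkj | rfl | hkj
    · exact h.trans_outer H (ha.left k j (by omega) hkj hj)
    · exact H
    · exact h.trans_outer' H (hb.right j k hkj hk)

end Pair

section

variable {𝓑 : BetweennessStructure.{u}} {g : ℕ → 𝓑.carrier} {M : ℕ} {P : Finset 𝓑.carrier}
  {y z k l : 𝓑.carrier}

/-- `y` and `z` lie at the opposite ends `e` and `f` of the path on `P`. -/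
structure Opposite (𝓑 : BetweennessStructure.{u}) (P : Finset 𝓑.carrier)
    (y z e f : 𝓑.carrier) : Prop where
  near : 𝓑.btw z y e
  near' : 𝓑.btw y z f
  out : ∀ w ∈ P, w ≠ e → 𝓑.btw y e w
  out' : ∀ w ∈ P, w ≠ f → 𝓑.btw w f z
  thru : ∀ w ∈ P, w ≠ e → 𝓑.btw e w z
  thru' : ∀ w ∈ P, w ≠ f → 𝓑.btw y w f

/-- `y` and `z` lie in the same gap, between `k` and `l`. -/
structure Twin (𝓑 : BetweennessStructure.{u}) (y z k l : 𝓑.carrier) : Prop where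
  btw_yz : 𝓑.btw y k z
  btw_yz' : 𝓑.btw y l z
  btw_kl : 𝓑.btw k y l
  btw_kl' : 𝓑.btw k z l

theorem opposite_of_gaps (h : 𝓑.IsAlmostMetrizable) (hg : 𝓑.IsPath g M P) (hM : 3 ≤ M)
    (hy : y ∉ P) (hz : z ∉ P) (hyz : y ≠ z) (ha : 𝓑.IsGap g M y 0) (hb : 𝓑.IsGap g M z M)
    (hk : k ∈ P) (hl : l ∈ P) (hkl : k ≠ l) (hcol : ∀ w ∈ P, 𝓑.Collinear {y, z, w} ↔ w = k ∨ w = l)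
    (hnot : ∃ j < M, ¬ 𝓑.Collinear {y, z, g j}) :
    𝓑.Opposite P y z k l ∨ 𝓑.Opposite P y z l k := by
  have key : ∀ {k l}, k ∈ P → l ∈ P → k ≠ l → 𝓑.Collinear {y, z, k} → 𝓑.Collinear {y, z, l} →
      g 0 = k → 𝓑.Opposite P y z k l := by
    intro k l hk hl hkl hck hcl h0
    obtain ⟨j, hj, rfl⟩ := (hg.mem_iff l).1 hl
    subst h0
    rcases btw_of_opposite_ends h hg hy hz hyz ha hb rfl rfl hnot hj hcl with ⟨hj0, -⟩ | ⟨hjM, H⟩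
    · exact absurd (by rw [hj0]) hkl
    rcases btw_of_opposite_ends h hg hy hz hyz ha hb rfl rfl hnot (show 0 < M by omega) hck with
      ⟨-, H'⟩ | ⟨h1, -⟩
    swap
    · omega
    refine ⟨H', H, ?_, ?_, ?_, ?_⟩ <;> intro w hw hne <;> obtain ⟨i, hi, rfl⟩ := (hg.mem_iff w).1 hw
    · have : i ≠ 0 := fun e => hne (by rw [e])
      exact ha.left 0 i le_rfl (by omega) hi
    · have : i ≠ j := fun e => hne (by rw [e])
      exact hb.right i j (by omega) hj
    · have : i ≠ 0 := fun e => hne (by rw [e])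
      exact hb.right 0 i (by omega) hi
    · have : i ≠ j := fun e => hne (by rw [e])
      exact ha.left i j (by omega) (by omega) hj
  have hck := (hcol k hk).2 (Or.inl rfl)
  have hcl := (hcol l hl).2 (Or.inr rfl)
  obtain ⟨i, hi, rfl⟩ := (hg.mem_iff k).1 hk
  obtain ⟨j, hj, rfl⟩ := (hg.mem_iff l).1 hl
  have h1 := btw_of_opposite_ends h hg hy hz hyz ha hb rfl rfl hnot hi hck
  have h2 := btw_of_opposite_ends h hg hy hz hyz ha hb rfl rfl hnot hj hcl
  have hij : i ≠ j := fun e => hkl (by rw [e])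
  rcases h1 with ⟨h1, -⟩ | ⟨h1, -⟩
  · left; exact key hk hl hkl hck hcl (by rw [h1])
  · rcases h2 with ⟨h2, -⟩ | ⟨h2, -⟩
    · right; exact key hl hk hkl.symm hcl hck (by rw [h2])
    · omega

theorem Opposite.swap (h : 𝓑.IsAlmostMetrizable) {e f : 𝓑.carrier} (H : 𝓑.Opposite P z y e f) :
    𝓑.Opposite P y z f e where
  near := H.near'
  near' := H.near
  out w hw hne := h.symm _ _ _ (H.out' w hw hne)
  out' w hw hne := h.symm _ _ _ (H.out w hw hne)
  thru w hw hne := h.symm _ _ _ (H.thru' w hw hne)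
  thru' w hw hne := h.symm _ _ _ (H.thru w hw hne)

/-- Two points that extend the same path and are collinear with exactly two points of it. -/
theorem twin_or_opposite (h : 𝓑.IsAlmostMetrizable) (hM : 4 ≤ M) (hg : 𝓑.IsPath g M P)
    (hy : y ∉ P) (hz : z ∉ P) (hyz : y ≠ z) (hPy : 𝓑.tri (insert y P) = ∅)
    (hPz : 𝓑.tri (insert z P) = ∅) (hk : k ∈ P) (hl : l ∈ P) (hkl : k ≠ l)
    (hcol : ∀ w ∈ P, 𝓑.Collinear {y, z, w} ↔ w = k ∨ w = l) :
    𝓑.Twin y z k l ∨ 𝓑.Opposite P y z k l ∨ 𝓑.Opposite P y z l k := by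
  obtain ⟨a, ha⟩ := hg.exists_gap h hM hy hPy
  obtain ⟨b, hb⟩ := hg.exists_gap h hM hz hPz
  have hnot : ∃ j < M, ¬ 𝓑.Collinear {y, z, g j} := by
    by_contra! H
    have h0 := (hcol _ (hg.mem (show 0 < M by omega))).1 (H 0 (by omega))
    have h1 := (hcol _ (hg.mem (show 1 < M by omega))).1 (H 1 (by omega))
    have h2 := (hcol _ (hg.mem (show 2 < M by omega))).1 (H 2 (by omega))
    have n01 := hg.ne (i := 0) (j := 1) (by omega) (by omega) (by omega)
    have n02 := hg.ne (i := 0) (j := 2) (by omega) (by omega) (by omega)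
    have n12 := hg.ne (i := 1) (j := 2) (by omega) (by omega) (by omega)
    grind
  have hnot' : ∃ j < M, ¬ 𝓑.Collinear {z, y, g j} := by
    obtain ⟨j, hj, H⟩ := hnot
    exact ⟨j, hj, by rwa [Finset.insert_comm]⟩
  have hle := ha.le
  have hle' := hb.le
  rcases Nat.lt_trichotomy a b with hab | hab | hab
  · right
    obtain ⟨j, hj, hn⟩ := hnot
    -- Distinct gaps, one of which is not at an end of the path, would make all entries collinear
    -- with `y` and `z`.
    have ha0 : a = 0 := by
      by_contra h0
      exact hn (collinear_of_gap_lt h hg hy hz hyz ha hb (by omega) hab hj)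
    have hbM : b = M := by
      by_contra h0
      exact hn (collinear_of_gap_lt' h hg hy hz hyz ha hb (by omega) hab hj)
    subst ha0 hbM
    exact opposite_of_gaps h hg (by omega) hy hz hyz ha hb hk hl hkl hcol ⟨j, hj, hn⟩
  · left
    have hck := (hcol k hk).2 (Or.inl rfl)
    have hcl := (hcol l hl).2 (Or.inr rfl)
    obtain ⟨i, hi, rfl⟩ := (hg.mem_iff k).1 hk
    obtain ⟨j, hj, rfl⟩ := (hg.mem_iff l).1 hl
    obtain ⟨h1, h1'⟩ := btw_of_same_gap h hg hy hz hyz ha hb hab hnot hi hck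
    obtain ⟨h2, h2'⟩ := btw_of_same_gap h hg hy hz hyz ha hb hab hnot hj hcl
    have hij : i ≠ j := fun e => hkl (by rw [e])
    subst hab
    rcases Nat.lt_or_gt_of_ne hij with hij | hij
    · exact ⟨h1, h2, ha.mid i j (by omega) (by omega) hj, hb.mid i j (by omega) (by omega) hj⟩
    · exact ⟨h1, h2, h.symm _ _ _ (ha.mid j i (by omega) (by omega) hi),
        h.symm _ _ _ (hb.mid j i (by omega) (by omega) hi)⟩
  · right
    obtain ⟨j, hj, hn⟩ := hnot'
    have ha0 : b = 0 := by
      by_contra h0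
      exact hn (collinear_of_gap_lt h hg hz hy hyz.symm hb ha (by omega) hab hj)
    have hbM : a = M := by
      by_contra h0
      exact hn (collinear_of_gap_lt' h hg hz hy hyz.symm hb ha (by omega) hab hj)
    subst ha0 hbM
    have hcol' : ∀ w ∈ P, 𝓑.Collinear {z, y, w} ↔ w = k ∨ w = l := fun w hw => by
      rw [Finset.insert_comm]; exact hcol w hw
    rcases opposite_of_gaps h hg (by omega) hz hy hyz.symm hb ha hk hl hkl hcol' ⟨j, hj, hn⟩ with H | H
    · right; exact H.swap h
    · left; exact H.swap h

end
end BetweennessStructure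

/-! ### The geometry of two twin pairs. -/

namespace BetweennessStructure

open Classical

section

variable {𝓑 : BetweennessStructure.{u}} {S : Finset 𝓑.carrier} {y z u v a b : 𝓑.carrier}

namespace TwoTwins

theorem swap_yz (H : 𝓑.TwoTwins S y z u v a b) : 𝓑.TwoTwins S z y u v a b := by
  obtain ⟨h1, h2, h3, h4, h5, h6, h7, h8, h9, h10, h11, h12, h13, h14⟩ := H
  have hp : ∀ w, w ∈ [z, y, u, v] ↔ w ∈ [y, z, u, v] := by
    intro w; simp only [List.mem_cons, List.not_mem_nil, or_false]; tauto
  refine ⟨h2, h1, h3, h4, h5, h6, ?_, by rwa [hp], by rwa [hp], ?_, ?_, h12, ?_, ?_⟩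
  · simp only [List.nodup_cons, List.mem_cons, List.not_mem_nil, or_false, not_or] at h7 ⊢
    have := h7.1.1
    refine ⟨⟨Ne.symm this, ?_⟩, ?_⟩ <;> tauto
  · intro T hT
    have := h10 T hT
    tauto
  · rwa [Finset.insert_comm]
  · intro w hw hw' hwa
    rw [Finset.insert_comm]
    exact h13 w hw (by rwa [← hp]) hwa
  · intro w hw hw' hwb
    exact h14 w hw (by rwa [← hp]) hwb

theorem exchange (H : 𝓑.TwoTwins S y z u v a b) : 𝓑.TwoTwins S u v y z b a := by
  obtain ⟨h1, h2, h3, h4, h5, h6, h7, h8, h9, h10, h11, h12, h13, h14⟩ := H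
  have hp : ∀ w, w ∈ [u, v, y, z] ↔ w ∈ [y, z, u, v] := by
    intro w; simp only [List.mem_cons, List.not_mem_nil, or_false]; tauto
  refine ⟨h3, h4, h1, h2, h6, h5, ?_, by rwa [hp], by rwa [hp], fun T hT => (h10 T hT).symm, h12,
    h11, fun w hw hw' => h14 w hw (by rwa [← hp]), fun w hw hw' => h13 w hw (by rwa [← hp])⟩
  simp only [List.nodup_cons, List.mem_cons, List.not_mem_nil, or_false, not_or] at h7 ⊢
  grind

theorem swap_uv (H : 𝓑.TwoTwins S y z u v a b) : 𝓑.TwoTwins S y z v u a b :=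
  H.exchange.swap_yz.exchange

theorem ne (H : 𝓑.TwoTwins S y z u v a b) :
    y ≠ z ∧ y ≠ u ∧ y ≠ v ∧ z ≠ u ∧ z ≠ v ∧ u ≠ v := by
  have := H.nodup
  simp only [List.nodup_cons, List.mem_cons, List.not_mem_nil, or_false, not_or] at this
  tauto

theorem ne_a (H : 𝓑.TwoTwins S y z u v a b) : a ≠ y ∧ a ≠ z ∧ a ≠ u ∧ a ≠ v := by
  simpa using H.a_notMem

theorem ne_b (H : 𝓑.TwoTwins S y z u v a b) : b ≠ y ∧ b ≠ z ∧ b ≠ u ∧ b ≠ v := by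
  simpa using H.b_notMem

theorem tri_eq_empty (H : 𝓑.TwoTwins S y z u v a b) {A : Finset 𝓑.carrier} (hA : A ⊆ S)
    (h1 : y ∉ A ∨ z ∉ A) (h2 : u ∉ A ∨ v ∉ A) : 𝓑.tri A = ∅ := by
  rw [Finset.eq_empty_iff_forall_notMem]
  intro T hT
  have hsub := (BetweennessStructure.mem_tri.1 hT).1
  have := H.mem_tri T (tri_mono hA hT)
  have m := fun w (hw : w ∈ T) => hsub hw
  grind

theorem collinear_yzu (H : 𝓑.TwoTwins S y z u v a b) : 𝓑.Collinear {y, z, u} := by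
  by_contra hc
  obtain ⟨h1, h2, h3, h4, h5, h6⟩ := H.ne
  have := H.mem_tri _ (triple_mem_tri H.y_mem H.z_mem H.u_mem h1 h4 h2 hc)
  simp at this

/-- `y` and `z` relative to the path on the points other than `y`, `z`, `v`. -/
theorem twin_or_opposite (h : 𝓑.IsAlmostMetrizable) (hS : 8 ≤ S.card)
    (H : 𝓑.TwoTwins S y z u v a b) :
    𝓑.Twin y z u a ∨ 𝓑.Opposite (((S.erase y).erase z).erase v) y z u a ∨
      𝓑.Opposite (((S.erase y).erase z).erase v) y z a u := by
  obtain ⟨h1, h2, h3, h4, h5, h6⟩ := H.ne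
  obtain ⟨a1, a2, a3, a4⟩ := H.ne_a
  set P := ((S.erase y).erase z).erase v with hP
  have hmem : ∀ w, w ∈ P ↔ w ≠ v ∧ w ≠ z ∧ w ≠ y ∧ w ∈ S := by
    intro w; simp only [hP, Finset.mem_erase]
  have hPS : P ⊆ S := fun w hw => ((hmem w).1 hw).2.2.2
  have hcard : P.card = S.card - 3 := by
    rw [hP, Finset.card_erase_of_mem, Finset.card_erase_of_mem, Finset.card_erase_of_mem H.y_mem]
    · omega
    · simp [h1.symm, H.z_mem]
    · simp [h3.symm, h5.symm, H.v_mem]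
  have hyP : y ∉ P := by simp [hmem]
  have hzP : z ∉ P := by simp [hmem]
  have hvP : v ∉ P := by simp [hmem]
  obtain ⟨g, hg⟩ := exists_isPath h P.card (by omega) P
    (H.tri_eq_empty hPS (Or.inl hyP) (Or.inr hvP)) rfl
  refine BetweennessStructure.twin_or_opposite h (by omega) hg hyP hzP h1 ?_ ?_
    ((hmem u).2 ⟨h6, h4.symm, h2.symm, H.u_mem⟩) ((hmem a).2 ⟨a4, a2, a1, H.a_mem⟩) a3.symm ?_
  · exact H.tri_eq_empty (Finset.insert_subset H.y_mem hPS) (Or.inr (by simp [h1.symm, hzP]))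
      (Or.inr (by simp [h3.symm, hvP]))
  · exact H.tri_eq_empty (Finset.insert_subset H.z_mem hPS) (Or.inl (by simp [h1, hyP]))
      (Or.inr (by simp [h5.symm, hvP]))
  · intro w hw
    rw [hmem] at hw
    constructor
    · intro hc
      by_contra! hn
      exact H.not_collinear_yz w hw.2.2.2 (by simp [hw.1, hw.2.1, hw.2.2.1, hn.1]) hn.2 hc
    · rintro (rfl | rfl)
      · exact H.collinear_yzu
      · exact H.collinear_yz

/-- The relation `y z a` forces the same orientation when `v` takes the place of `u`, so `b` lies
between `u` and `z` and between `v` and `z`. Each possible configuration of `u, v` over the path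
that contains `z` and not `y` contradicts one of these two facts. -/
theorem not_opposite (h : 𝓑.IsAlmostMetrizable) (hS : 8 ≤ S.card)
    (H : 𝓑.TwoTwins S y z u v a b)
    (O : 𝓑.Opposite (((S.erase y).erase z).erase v) y z u a) : False := by
  obtain ⟨h1, h2, h3, h4, h5, h6⟩ := H.ne
  obtain ⟨a1, a2, a3, a4⟩ := H.ne_a
  obtain ⟨b1, b2, b3, b4⟩ := H.ne_b
  have O' : 𝓑.Opposite (((S.erase y).erase z).erase u) y z v a := by
    rcases H.swap_uv.twin_or_opposite h hS with T | O' | O'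
    · exact absurd T.btw_yz' (h.not_btw_right a2.symm O.near')
    · exact O'
    · exact absurd O'.near (h.not_btw_left h1 O.near')
  have hb : 𝓑.btw u b z := O.thru b (by simp [b1, b2, b4, H.b_mem]) b3
  have hb' : 𝓑.btw v b z := O'.thru b (by simp [b1, b2, b3, H.b_mem]) b4
  have hbm : b ∈ ((S.erase u).erase v).erase y := by simp [b1, b3, b4, H.b_mem]
  rcases H.exchange.swap_uv.twin_or_opposite h hS with T | Q | Q
  · exact h.not_btw_right b3.symm T.btw_kl (h.symm _ _ _ hb)
  · exact h.not_btw_right b2 hb (Q.out b hbm b2)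
  · exact h.not_btw_right b2 hb' (h.symm _ _ _ (Q.out' b hbm b2))

theorem twin (h : 𝓑.IsAlmostMetrizable) (hS : 8 ≤ S.card) (H : 𝓑.TwoTwins S y z u v a b) :
    𝓑.Twin y z u a := by
  rcases H.twin_or_opposite h hS with T | O | O
  · exact T
  · exact (H.not_opposite h hS O).elim
  · rw [Finset.erase_right_comm (a := y)] at O
    exact (H.swap_yz.not_opposite h hS (O.swap h)).elim

end TwoTwins

section Path

variable {g : ℕ → 𝓑.carrier} {N : ℕ}

theorem IsPath.lt_of_btw (h : 𝓑.IsAlmostMetrizable) (hg : 𝓑.IsPath g N S) {i j k : ℕ} (hi : i < N)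
    (hj : j < N) (hk : k < N) (hij : i ≠ j) (hjk : j ≠ k) (H : 𝓑.btw (g i) (g j) (g k)) :
    (i < j ∧ j < k) ∨ (k < j ∧ j < i) := by
  have hik : i ≠ k := by
    rintro rfl
    exact hg.ne hi hj hij (h.eq_of_btw_self H)
  have n1 : ¬ 𝓑.btw (g j) (g i) (g k) := h.not_btw_left (hg.ne hi hj hij) H
  have n2 : ¬ 𝓑.btw (g i) (g k) (g j) := h.not_btw_right (hg.ne hj hk hjk) H
  have n1' : ¬ 𝓑.btw (g k) (g i) (g j) := fun e => n1 (h.symm _ _ _ e)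
  have n2' : ¬ 𝓑.btw (g j) (g k) (g i) := fun e => n2 (h.symm _ _ _ e)
  by_contra! hcon
  rcases Nat.lt_or_gt_of_ne hij with h1 | h1 <;> rcases Nat.lt_or_gt_of_ne hjk with h2 | h2 <;>
    rcases Nat.lt_or_gt_of_ne hik with h3 | h3 <;> first
    | omega
    | exact n1 (hg.btw _ _ _ (by omega) (by omega) (by omega))
    | exact n2 (hg.btw _ _ _ (by omega) (by omega) (by omega))
    | exact n1' (hg.btw _ _ _ (by omega) (by omega) (by omega))
    | exact n2' (hg.btw _ _ _ (by omega) (by omega) (by omega))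

/-- Replacing an inner entry of a path by a point between its neighbours. -/
theorem btw_update (h : 𝓑.IsAlmostMetrizable)
    (hg : ∀ i j k, i < j → j < k → k < N → 𝓑.btw (g i) (g j) (g k)) {p : 𝓑.carrier} {m : ℕ}
    (hm : m + 2 < N) (H : 𝓑.btw (g m) p (g (m + 2))) (i j k : ℕ) (hij : i < j) (hjk : j < k)
    (hk : k < N) : 𝓑.btw (Function.update g (m + 1) p i) (Function.update g (m + 1) p j)
      (Function.update g (m + 1) p k) := by
  have mid : ∀ i k, i < m + 1 → m + 1 < k → k < N → 𝓑.btw (g i) p (g k) := by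
    intro i k hi hk hkN
    have h1 : 𝓑.btw (g i) p (g (m + 2)) := by
      rcases Nat.lt_or_ge i m with him | him
      · exact h.trans_outer' (hg i m (m + 2) him (by omega) hm) H
      · rwa [show i = m by omega]
    rcases Nat.lt_or_ge (m + 2) k with h2 | h2
    · exact h.trans_outer (hg i (m + 2) k (by omega) h2 hkN) h1
    · rwa [show k = m + 2 by omega]
  simp only [Function.update_apply]
  split_ifs with h1 h2 h3 h2 h3 h3 <;> first
    | omega
    | skip
  · exact h.trans_inner (hg m j k (by omega) hjk hk) (mid m j (by omega) (by omega) (by omega))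
  · exact mid i k (by omega) (by omega) hk
  · exact h.trans_inner' (hg i j (m + 2) hij (by omega) hm) (mid j (m + 2) (by omega) (by omega) hm)
  · exact hg i j k hij hjk hk

end Path

namespace TwoTwins

/-- The path through all points but `z` and `v`, with `a, y, u, b` at the indices
`i, i + 1, i + 2, i + 3`. -/
structure IsSpine (𝓑 : BetweennessStructure.{u}) (S : Finset 𝓑.carrier)
    (y z u v a b : 𝓑.carrier) (g : ℕ → 𝓑.carrier) (i : ℕ) : Prop where
  isPath : 𝓑.IsPath g (S.card - 2) ((S.erase z).erase v)
  lt : i + 3 < S.card - 2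
  eq_a : g i = a
  eq_y : g (i + 1) = y
  eq_u : g (i + 2) = u
  eq_b : g (i + 3) = b

theorem IsSpine.reverse (h : 𝓑.IsAlmostMetrizable) {g : ℕ → 𝓑.carrier} {i : ℕ}
    (hs : IsSpine 𝓑 S y z u v a b g i) :
    IsSpine 𝓑 S u v y z b a (fun j => g (S.card - 2 - 1 - j)) (S.card - 6 - i) := by
  have hlt := hs.lt
  refine ⟨?_, by omega, ?_, ?_, ?_, ?_⟩
  · rw [Finset.erase_right_comm]; exact hs.isPath.reverse h
  · show g _ = b
    rw [← hs.eq_b]; congr 1; omega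
  · show g _ = u
    rw [← hs.eq_u]; congr 1; omega
  · show g _ = y
    rw [← hs.eq_y]; congr 1; omega
  · show g _ = a
    rw [← hs.eq_a]; congr 1; omega

/-- The twin relations `u y a` and `y u b` fix the order `a, y, u, b` on the path, up to reversal.
These four are consecutive: an entry inside one of the three intervals would lie between `y` and `z`
or between `u` and `v`, hence be an additional point collinear with that pair. -/
theorem exists_isSpine (h : 𝓑.IsAlmostMetrizable) (hS : 9 ≤ S.card)
    (H : 𝓑.TwoTwins S y z u v a b) : ∃ g i, IsSpine 𝓑 S y z u v a b g i := by
  obtain ⟨h1, h2, h3, h4, h5, h6⟩ := H.ne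
  obtain ⟨a1, a2, a3, a4⟩ := H.ne_a
  obtain ⟨b1, b2, b3, b4⟩ := H.ne_b
  have T1 := H.twin h (by omega)
  have T2 := H.exchange.twin h (by omega)
  have hcard : ((S.erase z).erase v).card = S.card - 2 := by
    rw [Finset.card_erase_of_mem, Finset.card_erase_of_mem H.z_mem]
    · omega
    · simp [h5.symm, H.v_mem]
  obtain ⟨g0, hg0⟩ := exists_isPath h _ (by omega) _
    (H.tri_eq_empty (A := (S.erase z).erase v)
      ((Finset.erase_subset _ _).trans (Finset.erase_subset _ _)) (Or.inr (by simp))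
      (Or.inr (by simp))) hcard
  have idx : ∀ {g}, 𝓑.IsPath g (S.card - 2) ((S.erase z).erase v) → ∃ ia iy iu ib,
      ia < S.card - 2 ∧ iy < S.card - 2 ∧ iu < S.card - 2 ∧ ib < S.card - 2 ∧
      g ia = a ∧ g iy = y ∧ g iu = u ∧ g ib = b := by
    intro g hg
    obtain ⟨ia, hia, ea⟩ := (hg.mem_iff a).1 (by simp [a2, a4, H.a_mem])
    obtain ⟨iy, hiy, ey⟩ := (hg.mem_iff y).1 (by simp [h1, h3, H.y_mem])
    obtain ⟨iu, hiu, eu⟩ := (hg.mem_iff u).1 (by simp [h4.symm, h6, H.u_mem])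
    obtain ⟨ib, hib, eb⟩ := (hg.mem_iff b).1 (by simp [b2, b4, H.b_mem])
    exact ⟨ia, iy, iu, ib, hia, hiy, hiu, hib, ea, ey, eu, eb⟩
  have order : ∀ {g} {ia iy iu ib : ℕ}, 𝓑.IsPath g (S.card - 2) ((S.erase z).erase v) →
      ia < S.card - 2 → iy < S.card - 2 → iu < S.card - 2 → ib < S.card - 2 →
      g ia = a → g iy = y → g iu = u → g ib = b →
      (ia < iy ∧ iy < iu ∧ iu < ib) ∨ (ib < iu ∧ iu < iy ∧ iy < ia) := by
    intro g ia iy iu ib hg hia hiy hiu hib ea ey eu eb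
    have nyu : iy ≠ iu := by rintro rfl; exact h2 (ey.symm.trans eu)
    have nya : iy ≠ ia := by rintro rfl; exact a1 (ea.symm.trans ey)
    have nub : iu ≠ ib := by rintro rfl; exact b3 (eb.symm.trans eu)
    have o1 := hg.lt_of_btw h hiu hiy hia nyu.symm nya (by rw [eu, ey, ea]; exact T1.btw_kl)
    have o2 := hg.lt_of_btw h hiy hiu hib nyu nub (by rw [eu, ey, eb]; exact T2.btw_kl)
    omega
  have fwd : ∃ g, 𝓑.IsPath g (S.card - 2) ((S.erase z).erase v) ∧ ∃ ia iy iu ib,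
      ia < iy ∧ iy < iu ∧ iu < ib ∧ ib < S.card - 2 ∧ g ia = a ∧ g iy = y ∧ g iu = u ∧ g ib = b := by
    obtain ⟨ia, iy, iu, ib, hia, hiy, hiu, hib, ea, ey, eu, eb⟩ := idx hg0
    rcases order hg0 hia hiy hiu hib ea ey eu eb with o | o
    · exact ⟨g0, hg0, ia, iy, iu, ib, o.1, o.2.1, o.2.2, hib, ea, ey, eu, eb⟩
    · have hr : ∀ i, i < S.card - 2 → S.card - 2 - 1 - (S.card - 2 - 1 - i) = i :=
        fun i hi => by omega
      refine ⟨_, hg0.reverse h, S.card - 2 - 1 - ia, S.card - 2 - 1 - iy, S.card - 2 - 1 - iu,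
        S.card - 2 - 1 - ib, by omega, by omega, by omega, by omega, ?_, ?_, ?_, ?_⟩
      · simpa only [hr ia hia] using ea
      · simpa only [hr iy hiy] using ey
      · simpa only [hr iu hiu] using eu
      · simpa only [hr ib hib] using eb
  obtain ⟨g, hg, ia, iy, iu, ib, o1, o2, o3, hib, rfl, rfl, rfl, rfl⟩ := fwd
  have inner : ∀ w, w < S.card - 2 → g w ∈ S ∧ g w ≠ z ∧ g w ≠ v := fun w hw => by
    have := hg.mem hw
    simp only [Finset.mem_erase] at this
    tauto
  have no_yz : ∀ w, w < S.card - 2 → w ≠ ia → w ≠ iy → w ≠ iu → ¬ 𝓑.btw (g iy) (g w) z := by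
    intro w hw n1 n2 n3 hb
    have hw' := inner w hw
    have m1 := hg.ne hw (show ia < _ by omega) n1
    have m2 := hg.ne hw (show iy < _ by omega) n2
    have m3 := hg.ne hw (show iu < _ by omega) n3
    refine H.not_collinear_yz (g w) hw'.1 (by simp [m2, m3, hw'.2.1, hw'.2.2]) m1 ?_
    exact collinear_of_btw h h1 hw'.2.1.symm m2.symm (Or.inr (Or.inr hb))
  have no_uv : ∀ w, w < S.card - 2 → w ≠ ib → w ≠ iy → w ≠ iu → ¬ 𝓑.btw (g iu) (g w) v := by
    intro w hw n1 n2 n3 hb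
    have hw' := inner w hw
    have m1 := hg.ne hw (show ib < _ by omega) n1
    have m2 := hg.ne hw (show iy < _ by omega) n2
    have m3 := hg.ne hw (show iu < _ by omega) n3
    refine H.not_collinear_uv (g w) hw'.1 (by simp [m2, m3, hw'.2.1, hw'.2.2]) m1 ?_
    exact collinear_of_btw h h6 hw'.2.2.symm m3.symm (Or.inr (Or.inr hb))
  have e1 : iy = ia + 1 := by
    by_contra hne
    have := h.symm _ _ _ (hg.btw ia (ia + 1) iy (by omega) (by omega) (by omega))
    exact no_yz (ia + 1) (by omega) (by omega) (by omega) (by omega) (h.trans_outer T1.btw_yz' this)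
  have e2 : iu = iy + 1 := by
    by_contra hne
    have := hg.btw iy (iy + 1) iu (by omega) (by omega) (by omega)
    exact no_yz (iy + 1) (by omega) (by omega) (by omega) (by omega) (h.trans_outer T1.btw_yz this)
  have e3 : ib = iu + 1 := by
    by_contra hne
    have := hg.btw iu (iu + 1) ib (by omega) (by omega) (by omega)
    exact no_uv (iu + 1) (by omega) (by omega) (by omega) (by omega) (h.trans_outer T2.btw_yz' this)
  subst e1 e2 e3
  exact ⟨g, ia, hg, hib, rfl, rfl, rfl, rfl⟩

/-- The spine with `y` possibly replaced by `z` and `u` by `v`. -/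
noncomputable def spine (g : ℕ → 𝓑.carrier) (i : ℕ) (z v : 𝓑.carrier) (c d : Bool) :
    ℕ → 𝓑.carrier :=
  Function.update (Function.update g (i + 1) (bif c then z else g (i + 1))) (i + 2)
    (bif d then v else g (i + 2))

/-- Like `y`, the point `z` lies between `a` and `u`; and both `u` and `v` lie between `b` and
either of `y`, `z`. The two replacements can therefore be made independently. -/
theorem IsSpine.btw_spine (h : 𝓑.IsAlmostMetrizable) (hS : 9 ≤ S.card)
    (H : 𝓑.TwoTwins S y z u v a b) {g : ℕ → 𝓑.carrier} {i : ℕ}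
    (hs : IsSpine 𝓑 S y z u v a b g i) (c d : Bool) (j k l : ℕ) (hjk : j < k) (hkl : k < l)
    (hl : l < S.card - 2) :
    𝓑.btw (spine g i z v c d j) (spine g i z v c d k) (spine g i z v c d l) := by
  have T1 := H.twin h (by omega)
  have T2 := H.exchange.twin h (by omega)
  have T3 := H.exchange.swap_uv.twin h (by omega)
  have hlt := hs.lt
  have ea := hs.eq_a
  have ey := hs.eq_y
  have eu := hs.eq_u
  have eb := hs.eq_b
  refine btw_update h (btw_update h hs.isPath.btw (by omega) ?_) (by omega) ?_ j k l hjk hkl hl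
  · cases c
    · simpa using hs.isPath.btw i (i + 1) (i + 2) (by omega) (by omega) (by omega)
    · simp only [cond_true, ea, eu]
      exact h.symm _ _ _ T1.btw_kl'
  · have n3 : i + 1 + 2 ≠ i + 1 := by omega
    simp only [Function.update_self, Function.update_of_ne n3, show i + 1 + 2 = i + 3 by omega, eb,
      eu, ey]
    cases c <;> cases d <;> simp only [cond_true, cond_false]
    · exact T2.btw_kl
    · exact T2.btw_kl'
    · exact T3.btw_kl
    · exact T3.btw_kl'

end TwoTwins

end
end BetweennessStructure

/-! ### Level distances and the metric of `T_{n,i}`. -/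

namespace BetweennessStructure

open Classical

/-- The distance given by levels: points on a common level are at distance `c`. -/
noncomputable def levDist {V : Type u} (c : ℕ) (lev : V → ℕ) (s t : V) : ℕ :=
  if s = t then 0 else if lev s = lev t then c else (lev s - lev t) + (lev t - lev s)

/-- The betweenness structure of the level distance. -/
noncomputable abbrev levelStruct (V : Type u) [Nonempty V] [Finite V] (c : ℕ) (lev : V → ℕ) :
    BetweennessStructure.{u} where
  carrier := V
  btw x y z := levDist c lev x z = levDist c lev x y + levDist c lev y z

section Levels

variable {V : Type u} {c : ℕ} {lev : V → ℕ}

theorem levDist_self (s : V) : levDist c lev s s = 0 := if_pos rfl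

theorem levDist_of_eq {s t : V} (h : s ≠ t) (hl : lev s = lev t) : levDist c lev s t = c := by
  rw [levDist, if_neg h, if_pos hl]

theorem levDist_of_ne {s t : V} (hl : lev s ≠ lev t) :
    levDist c lev s t = (lev s - lev t) + (lev t - lev s) := by
  rw [levDist, if_neg (fun h => hl (by rw [h])), if_neg hl]

theorem levDist_comm (s t : V) : levDist c lev s t = levDist c lev t s := by
  unfold levDist
  split_ifs with h1 h2 h3 h4 h5 <;> first | rfl | omega | (exfalso; first | omega | (subst_vars; simp_all))

theorem levDist_eq_zero (hc : 0 < c) {s t : V} (h : levDist c lev s t = 0) : s = t := by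
  unfold levDist at h
  split_ifs at h with h1 h2
  · exact h1
  · omega
  · omega

/-- The critical case is a detour from one point of a level to another through a different level; it
costs at least `2`, hence at least `c`. -/
theorem levDist_triangle (hc : c = 1 ∨ c = 2) (s t r : V) :
    levDist c lev s r ≤ levDist c lev s t + levDist c lev t r := by
  by_cases h1 : s = t
  · subst h1; omega
  by_cases h2 : t = r
  · subst h2; omega
  unfold levDist
  rw [if_neg h1, if_neg h2]
  split_ifs <;> omega

theorem levelStruct_isAlmostMetrizable [Nonempty V] [Finite V] (hc : c = 1 ∨ c = 2) :
    (levelStruct V c lev).IsAlmostMetrizable where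
  btw_left := fun (x z : V) => by
    show levDist c lev x z = levDist c lev x x + levDist c lev x z
    rw [levDist_self, zero_add]
  symm := fun (x y z : V) H => by
    change levDist c lev x z = levDist c lev x y + levDist c lev y z at H
    show levDist c lev z x = levDist c lev z y + levDist c lev y x
    rw [levDist_comm z x, levDist_comm z y, levDist_comm y x]
    omega
  antisymm x y z H H' := by
    change levDist c lev x z = levDist c lev x y + levDist c lev y z at H
    change levDist c lev y z = levDist c lev y x + levDist c lev x z at H'
    exact levDist_eq_zero (c := c) (lev := lev) (by omega) (by omega)
  four_relations x y z w H H' := by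
    change levDist c lev x z = levDist c lev x y + levDist c lev y z at H
    change levDist c lev x y = levDist c lev x w + levDist c lev w y at H'
    have h1 := levDist_triangle (lev := lev) hc x w z
    have h2 := levDist_triangle (lev := lev) hc w y z
    show levDist c lev x z = levDist c lev x w + levDist c lev w z ∧
      levDist c lev w z = levDist c lev w y + levDist c lev y z
    omega

theorem levelStruct_collinear_of_ne [Nonempty V] [Finite V] (hc : c = 1 ∨ c = 2) {x y z : V}
    (hxy : lev x ≠ lev y) (hyz : lev y ≠ lev z) (hxz : lev x ≠ lev z) :
    (levelStruct V c lev).Collinear {x, y, z} := by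
  refine (collinear_triple (levelStruct_isAlmostMetrizable hc) (x := x) (y := y) (z := z)
    (fun e => hxy (congrArg lev e)) (fun e => hyz (congrArg lev e))
    (fun e => hxz (congrArg lev e))).2 ?_
  show levDist c lev x z = levDist c lev x y + levDist c lev y z ∨
    levDist c lev y z = levDist c lev y x + levDist c lev x z ∨
    levDist c lev x y = levDist c lev x z + levDist c lev z y
  rw [levDist_of_ne hxy, levDist_of_ne hyz, levDist_of_ne hxz, levDist_of_ne hxy.symm,
    levDist_of_ne hyz.symm]
  omega

/-- A point `w` on another level is equally far from `x` and `y`, so only `w` can be in the middle,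
which requires `c` to be twice the difference of levels. -/
theorem levelStruct_collinear_twin [Nonempty V] [Finite V] (hc : c = 1 ∨ c = 2) {x y w : V}
    (hxy : x ≠ y) (hl : lev x = lev y) (hw : lev w ≠ lev x) :
    (levelStruct V c lev).Collinear {x, y, w} ↔
      c = 2 ∧ (lev w = lev x + 1 ∨ lev x = lev w + 1) := by
  refine (collinear_triple (levelStruct_isAlmostMetrizable hc) (x := x) (y := y) (z := w)
    hxy (fun e => hw (by rw [hl, e])) (fun e => hw (by rw [e]))).trans ?_
  show (levDist c lev x w = levDist c lev x y + levDist c lev y w ∨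
    levDist c lev y w = levDist c lev y x + levDist c lev x w ∨
    levDist c lev x y = levDist c lev x w + levDist c lev w y) ↔ _
  have h1 : lev x ≠ lev w := hw.symm
  have h2 : lev y ≠ lev w := by omega
  rw [levDist_of_eq hxy hl, levDist_of_eq hxy.symm hl.symm, levDist_of_ne h1, levDist_of_ne h2,
    levDist_of_ne h2.symm]
  omega

/-- A structure whose points lie on levels with at most two points each is determined by the
betweenness of points on different levels and the behaviour of the pairs on a common level. -/
theorem btw_iff_levDist {𝓑 : BetweennessStructure.{v}} (h : 𝓑.IsAlmostMetrizable)
    (f : V → 𝓑.carrier) (hf : Function.Injective f)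
    (hlt : ∀ s t r, lev s < lev t → lev t < lev r → 𝓑.btw (f s) (f t) (f r))
    (htwin : ∀ s t r, s ≠ t → lev s = lev t → (lev r = lev s + 1 ∨ lev s = lev r + 1) →
      𝓑.btw (f s) (f r) (f t))
    (hnot : ∀ s t r, s ≠ t → lev s = lev t → lev r ≠ lev s → lev r ≠ lev s + 1 →
      lev s ≠ lev r + 1 → ¬ 𝓑.Collinear {f s, f t, f r})
    (htwo : ∀ s t r, s ≠ t → t ≠ r → s ≠ r → lev s = lev t → lev t ≠ lev r) (s t r : V) :
    𝓑.btw (f s) (f t) (f r) ↔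
      levDist 2 lev s r = levDist 2 lev s t + levDist 2 lev t r := by
  by_cases hst : s = t
  · subst hst
    simp [levDist_self, h.btw_left]
  by_cases htr : t = r
  · subst htr
    simp [levDist_self, h.btw_right]
  by_cases hsr : s = r
  · subst hsr
    rw [levDist_self]
    refine ⟨fun H => absurd (hf (h.eq_of_btw_self H)) hst, fun H => ?_⟩
    exact absurd (levDist_eq_zero (c := 2) (lev := lev) (by omega) (by omega)) hst
  have fst : f s ≠ f t := fun e => hst (hf e)
  have ftr : f t ≠ f r := fun e => htr (hf e)
  have fsr : f s ≠ f r := fun e => hsr (hf e)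
  have n1 : 𝓑.btw (f t) (f s) (f r) → ¬ 𝓑.btw (f s) (f t) (f r) := fun H => h.not_btw_left fst.symm H
  have n2 : 𝓑.btw (f s) (f r) (f t) → ¬ 𝓑.btw (f s) (f t) (f r) := fun H =>
    h.not_btw_right ftr.symm H
  by_cases l1 : lev s = lev t
  · have l2 : lev t ≠ lev r := htwo s t r hst htr hsr l1
    have l3 : lev s ≠ lev r := by omega
    rw [levDist_of_eq hst l1, levDist_of_ne l2, levDist_of_ne l3]
    refine iff_of_false ?_ (by omega)
    by_cases hadj : lev r = lev s + 1 ∨ lev s = lev r + 1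
    · exact n2 (htwin s t r hst l1 hadj)
    · push Not at hadj
      exact fun H => hnot s t r hst l1 l3.symm hadj.1 hadj.2
        ((collinear_triple h fst ftr fsr).2 (Or.inl H))
  by_cases l2 : lev t = lev r
  · have l3 : lev s ≠ lev r := by omega
    rw [levDist_of_eq htr l2, levDist_of_ne l1, levDist_of_ne l3]
    refine iff_of_false ?_ (by omega)
    by_cases hadj : lev s = lev t + 1 ∨ lev t = lev s + 1
    · exact n1 (htwin t r s htr l2 hadj)
    · push Not at hadj
      exact fun H => hnot t r s htr l2 l1 hadj.1 hadj.2
        ((collinear_triple h ftr fsr.symm fst.symm).2 (Or.inr (Or.inl (h.symm _ _ _ H))))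
  by_cases l3 : lev s = lev r
  · rw [levDist_of_eq hsr l3, levDist_of_ne l1, levDist_of_ne l2]
    by_cases hadj : lev t = lev s + 1 ∨ lev s = lev t + 1
    · exact iff_of_true (htwin s r t hsr l3 hadj) (by omega)
    · push Not at hadj
      refine iff_of_false (fun H => hnot s r t hsr l3 (by omega) hadj.1 hadj.2
        ((collinear_triple h fsr ftr.symm fst).2 (Or.inr (Or.inr H)))) (by omega)
  rw [levDist_of_ne l1, levDist_of_ne l2, levDist_of_ne l3]
  have key : ((lev s < lev t ∧ lev t < lev r) ∨ (lev r < lev t ∧ lev t < lev s)) ∨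
      ((lev t < lev s ∧ lev s < lev r) ∨ (lev r < lev s ∧ lev s < lev t)) ∨
      ((lev s < lev r ∧ lev r < lev t) ∨ (lev t < lev r ∧ lev r < lev s)) := by omega
  rcases key with (k | k) | (k | k) | (k | k)
  · exact iff_of_true (hlt s t r k.1 k.2) (by omega)
  · exact iff_of_true (h.symm _ _ _ (hlt r t s k.1 k.2)) (by omega)
  · exact iff_of_false (n1 (hlt t s r k.1 k.2)) (by omega)
  · exact iff_of_false (n1 (h.symm _ _ _ (hlt r s t k.1 k.2))) (by omega)
  · exact iff_of_false (n2 (hlt s r t k.1 k.2)) (by omega)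
  · exact iff_of_false (n2 (h.symm _ _ _ (hlt t r s k.1 k.2))) (by omega)

end Levels

section GraphT

/-- The distance levels of `T_{n,i}`, counted from `x_1`. -/
def levT (n i : ℕ) : TVertex n → ℕ
  | .x j => if j.val ≤ i then j.val - 1 else j.val + 1
  | .y => i
  | .z => i
  | .u => i + 1
  | .v => i + 1

variable {n i : ℕ}

/-- The graph joins exactly the pairs on consecutive levels, which reduces all distances to levels.
-/
theorem tEdge_iff {s t : TVertex n} (hi : 1 ≤ i) : TEdge n i s t ↔ levT n i t = levT n i s + 1 := by
  constructor
  · intro H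
    cases H with
    | path j k hjk hj =>
      simp only [levT]; split_ifs <;> have := (Finset.mem_Icc.1 j.2).1 <;> omega
    | xy j hj => have := (Finset.mem_Icc.1 j.2).1; simp only [levT]; split_ifs <;> omega
    | xz j hj => have := (Finset.mem_Icc.1 j.2).1; simp only [levT]; split_ifs <;> omega
    | yu => rfl
    | yv => rfl
    | zu => rfl
    | zv => rfl
    | ux k hk => simp only [levT]; split_ifs <;> omega
    | vx k hk => simp only [levT]; split_ifs <;> omega
  · intro H
    rcases s with j | _ | _ | _ | _ <;> rcases t with k | _ | _ | _ | _ <;>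
      simp only [levT] at H <;> first
      | omega
      | exact .yu
      | exact .yv
      | exact .zu
      | exact .zv
      | skip
    · have := (Finset.mem_Icc.1 j.2).1
      have := (Finset.mem_Icc.1 k.2).1
      split_ifs at H <;> first
        | omega
        | exact .path j k (by omega) (by omega)
    all_goals first
      | (have := (Finset.mem_Icc.1 j.2).1
         split_ifs at H <;> first | omega | exact .xy j (by omega) | exact .xz j (by omega))
      | (have := (Finset.mem_Icc.1 k.2).1
         split_ifs at H <;> first | omega | exact .ux k (by omega) | exact .vx k (by omega))

theorem graphT_adj (hi : 1 ≤ i) {s t : TVertex n} :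
    (graphT n i).Adj s t ↔ levT n i t = levT n i s + 1 ∨ levT n i s = levT n i t + 1 := by
  rw [graphT, SimpleGraph.fromRel_adj, tEdge_iff hi, tEdge_iff hi]
  refine ⟨fun H => H.2, fun H => ⟨?_, H⟩⟩
  rintro rfl
  omega

theorem levT_lt (hin : i + 1 ≤ n - 4) (s : TVertex n) : levT n i s < n - 2 := by
  rcases s with j | _ | _ | _ | _ <;> simp only [levT]
  · have := Finset.mem_Icc.1 j.2
    split_ifs <;> omega
  all_goals omega

theorem exists_levT_eq (hin : i + 1 ≤ n - 4) {l : ℕ} (hl : l < n - 2) :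
    ∃ s : TVertex n, levT n i s = l := by
  rcases Nat.lt_or_ge l i with h | h
  · refine ⟨.x ⟨l + 1, Finset.mem_Icc.2 (by omega)⟩, ?_⟩
    simp only [levT]; rw [if_pos (by omega)]; rfl
  · rcases h.eq_or_lt with rfl | h
    · exact ⟨.y, rfl⟩
    · rcases Nat.eq_or_lt_of_le h with rfl | h
      · exact ⟨.u, rfl⟩
      · refine ⟨.x ⟨l - 1, Finset.mem_Icc.2 (by omega)⟩, ?_⟩
        simp only [levT]; rw [if_neg (by omega)]; omega

theorem exists_walk_graphT (hi : 1 ≤ i) (hin : i + 1 ≤ n - 4) (k : ℕ) :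
    ∀ s t : TVertex n, levT n i t = levT n i s + (k + 1) →
      ∃ p : (graphT n i).Walk s t, p.length = k + 1 := by
  induction k with
  | zero =>
    intro s t H
    exact ⟨.cons ((graphT_adj hi).2 (Or.inl H)) .nil, rfl⟩
  | succ k ih =>
    intro s t H
    have := levT_lt hin t
    obtain ⟨w, hw⟩ := exists_levT_eq hin (l := levT n i s + 1) (by omega)
    obtain ⟨p, hp⟩ := ih w t (by omega)
    exact ⟨.cons ((graphT_adj hi).2 (Or.inl hw)) p, by simp [hp]⟩

theorem levT_le_walk (hi : 1 ≤ i) {s t : TVertex n} (p : (graphT n i).Walk s t) :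
    (levT n i s - levT n i t) + (levT n i t - levT n i s) ≤ p.length := by
  induction p with
  | nil => simp
  | cons hadj p ih =>
    rw [graphT_adj hi] at hadj
    rw [SimpleGraph.Walk.length_cons]
    omega

theorem eq_or_eq_of_levT_eq {s t : TVertex n} (hst : s ≠ t)
    (hl : levT n i s = levT n i t) :
    (s = .y ∧ t = .z) ∨ (s = .z ∧ t = .y) ∨ (s = .u ∧ t = .v) ∨ (s = .v ∧ t = .u) := by
  rcases s with j | _ | _ | _ | _ <;> rcases t with k | _ | _ | _ | _ <;>
    simp only [levT] at hl <;> first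
    | (simp; done)
    | omega
    | (exact absurd rfl hst)
    | skip
  · exfalso
    have h1 := Finset.mem_Icc.1 j.2
    have h2 := Finset.mem_Icc.1 k.2
    refine hst (congrArg _ (Subtype.ext ?_))
    split_ifs at hl <;> omega
  all_goals
    exfalso
    first
    | (have h1 := Finset.mem_Icc.1 j.2
       split_ifs at hl <;> omega)
    | (have h1 := Finset.mem_Icc.1 k.2
       split_ifs at hl <;> omega)

/-- Each edge changes the level by one and every intermediate level is inhabited. Two points on a
common level are not adjacent but have a common neighbour in the other pair. -/
theorem graphT_dist (hi : 1 ≤ i) (hin : i + 1 ≤ n - 4) (s t : TVertex n) :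
    (graphT n i).dist s t = levDist 2 (levT n i) s t := by
  have hlt : ∀ s t : TVertex n, levT n i s < levT n i t →
      (graphT n i).dist s t = levT n i t - levT n i s := by
    intro s t H
    obtain ⟨p, hp⟩ := exists_walk_graphT hi hin (levT n i t - levT n i s - 1) s t (by omega)
    have h1 := SimpleGraph.dist_le p
    obtain ⟨q, hq⟩ := SimpleGraph.Reachable.exists_walk_length_eq_dist ⟨p⟩
    have h2 := levT_le_walk hi q
    omega
  by_cases hst : s = t
  · subst hst
    rw [SimpleGraph.dist_self, levDist_self]
  rcases Nat.lt_trichotomy (levT n i s) (levT n i t) with H | H | H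
  · rw [hlt s t H, levDist_of_ne (by omega)]
    omega
  · rw [levDist_of_eq hst H]
    have hnadj : ¬ (graphT n i).Adj s t := by
      rw [graphT_adj hi]; omega
    obtain ⟨w, h1, h2⟩ : ∃ w, (graphT n i).Adj s w ∧ (graphT n i).Adj w t := by
      rcases eq_or_eq_of_levT_eq hst H with ⟨rfl, rfl⟩ | ⟨rfl, rfl⟩ | ⟨rfl, rfl⟩ | ⟨rfl, rfl⟩
      · exact ⟨.u, by simp [graphT_adj hi, levT], by simp [graphT_adj hi, levT]⟩
      · exact ⟨.u, by simp [graphT_adj hi, levT], by simp [graphT_adj hi, levT]⟩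
      · exact ⟨.y, by simp [graphT_adj hi, levT], by simp [graphT_adj hi, levT]⟩
      · exact ⟨.y, by simp [graphT_adj hi, levT], by simp [graphT_adj hi, levT]⟩
    have hle := SimpleGraph.dist_le (SimpleGraph.Walk.cons h1 (.cons h2 .nil))
    have hr : (graphT n i).Reachable s t := ⟨SimpleGraph.Walk.cons h1 (.cons h2 .nil)⟩
    have h0 : (graphT n i).dist s t ≠ 0 := fun H => hst ((hr.dist_eq_zero_iff).1 H)
    have h1' : (graphT n i).dist s t ≠ 1 := fun H => hnadj (SimpleGraph.dist_eq_one_iff_adj.1 H)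
    simp only [SimpleGraph.Walk.length_cons, SimpleGraph.Walk.length_nil] at hle
    omega
  · rw [SimpleGraph.dist_comm, hlt t s H, levDist_of_ne (by omega)]
    omega

theorem structT_eq (hi : 1 ≤ i) (hin : i + 1 ≤ n - 4) :
    structT n i = levelStruct (TVertex n) 2 (levT n i) := by
  simp only [structT, ofGraph, levelStruct, graphT_dist hi hin]

/-- An upper bound suffices, since the placement of the vertices is shown to be surjective. -/
theorem card_tVertex_le (hn : 4 ≤ n) : Nat.card (TVertex n) ≤ n := by
  have := Nat.card_le_card_of_surjective
    (fun s : Finset.Icc 1 (n - 4) ⊕ Fin 4 =>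
      Sum.elim (fun j => TVertex.x j) ![TVertex.y, TVertex.z, TVertex.u, TVertex.v] s)
    (by
      intro w
      cases w with
      | x j => exact ⟨Sum.inl j, rfl⟩
      | y => exact ⟨Sum.inr 0, rfl⟩
      | z => exact ⟨Sum.inr 1, rfl⟩
      | u => exact ⟨Sum.inr 2, rfl⟩
      | v => exact ⟨Sum.inr 3, rfl⟩)
  refine this.trans ?_
  rw [Nat.card_sum, Nat.card_eq_fintype_card, Nat.card_eq_fintype_card, Fintype.card_coe,
    Nat.card_Icc, Fintype.card_fin]
  omega

end GraphT
end BetweennessStructure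

/-! ### The isomorphism with `T_{n,i}`. -/

namespace BetweennessStructure

open Classical

section Iso

variable {𝓑 : BetweennessStructure.{u}} {S : Finset 𝓑.carrier} {y z u v a b : 𝓑.carrier}
  {g : ℕ → 𝓑.carrier} {i : ℕ}

/-- The vertices of `T_{n,i+1}` placed along a spine. -/
def place (n : ℕ) (g : ℕ → 𝓑.carrier) (i : ℕ) (y z u v : 𝓑.carrier) : TVertex n → 𝓑.carrier
  | .x j => g (levT n (i + 1) (.x j))
  | .y => y
  | .z => z
  | .u => u
  | .v => v

variable {n : ℕ}

theorem levT_x_ne (j : Finset.Icc 1 (n - 4)) :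
    levT n (i + 1) (.x j) ≠ i + 1 ∧ levT n (i + 1) (.x j) ≠ i + 2 := by
  have := (Finset.mem_Icc.1 j.2).1
  simp only [levT]
  split_ifs <;> omega

namespace TwoTwins

theorem IsSpine.place_eq (hs : IsSpine 𝓑 S y z u v a b g i) (s : TVertex n) (c d : Bool)
    (h1 : s = .y → c = false) (h2 : s = .z → c = true) (h3 : s = .u → d = false)
    (h4 : s = .v → d = true) : place n g i y z u v s = spine g i z v c d (levT n (i + 1) s) := by
  have e1 := hs.eq_y
  have e2 := hs.eq_u
  have n1 : i + 1 ≠ i + 2 := by omega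
  rcases s with j | _ | _ | _ | _
  · have := levT_x_ne (n := n) (i := i) j
    rw [spine, Function.update_of_ne this.2, Function.update_of_ne this.1, place]
  · simp [spine, place, levT, h1 rfl, e1]
  · simp [spine, place, levT, h2 rfl]
  · simp [spine, place, levT, h3 rfl, e2]
  · simp [spine, place, levT, h4 rfl]

/-- Three vertices on distinct levels include at most one of `y, z` and at most one of `u, v`, so
one of the four spines passes through all three. -/
theorem IsSpine.btw_place (h : 𝓑.IsAlmostMetrizable) (hn : 9 ≤ n) (hS : S.card = n)
    (H : 𝓑.TwoTwins S y z u v a b) (hs : IsSpine 𝓑 S y z u v a b g i) (s t r : TVertex n)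
    (hst : levT n (i + 1) s < levT n (i + 1) t) (htr : levT n (i + 1) t < levT n (i + 1) r) :
    𝓑.btw (place n g i y z u v s) (place n g i y z u v t) (place n g i y z u v r) := by
  have hi := hs.lt
  have hr := levT_lt (n := n) (i := i + 1) (by omega) r
  have side : ∀ q : TVertex n, q = s ∨ q = t ∨ q = r → place n g i y z u v q =
      spine g i z v (decide (s = .z ∨ t = .z ∨ r = .z)) (decide (s = .v ∨ t = .v ∨ r = .v))
        (levT n (i + 1) q) := by
    have ey : levT n (i + 1) .y = levT n (i + 1) .z := rfl
    have eu : levT n (i + 1) .u = levT n (i + 1) .v := rfl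
    intro q hq
    apply hs.place_eq
    · rintro rfl
      rw [decide_eq_false_iff_not]
      rintro (rfl | rfl | rfl) <;> rcases hq with hq | hq | hq <;>
        first | (exact absurd hq (by simp)) | (subst hq; omega)
    · rintro rfl
      rw [decide_eq_true_iff]
      grind
    · rintro rfl
      rw [decide_eq_false_iff_not]
      rintro (rfl | rfl | rfl) <;> rcases hq with hq | hq | hq <;>
        first | (exact absurd hq (by simp)) | (subst hq; omega)
    · rintro rfl
      rw [decide_eq_true_iff]
      grind
  rw [side s (by simp), side t (by simp), side r (by simp)]
  exact hs.btw_spine h (by omega) H _ _ _ _ _ hst htr (by omega)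

theorem IsSpine.place_surjective (hS : S.card = n) (hs : IsSpine 𝓑 S y z u v a b g i) {w : 𝓑.carrier}
    (hw : w ∈ S) : ∃ s, place n g i y z u v s = w := by
  have hi := hs.lt
  by_cases hwz : w = z
  · exact ⟨.z, hwz.symm⟩
  by_cases hwv : w = v
  · exact ⟨.v, hwv.symm⟩
  obtain ⟨k, hk, rfl⟩ := (hs.isPath.mem_iff w).1 (by simp [hwz, hwv, hw])
  rcases Nat.lt_or_ge k (i + 1) with h1 | h1
  · refine ⟨.x ⟨k + 1, Finset.mem_Icc.2 (by omega)⟩, ?_⟩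
    simp only [place, levT]
    rw [if_pos (by omega)]; rfl
  · by_cases h2 : k = i + 1
    · exact ⟨.y, by rw [h2, hs.eq_y]; rfl⟩
    · by_cases h3 : k = i + 2
      · exact ⟨.u, by rw [h3, hs.eq_u]; rfl⟩
      · refine ⟨.x ⟨k - 1, Finset.mem_Icc.2 (by omega)⟩, ?_⟩
        simp only [place, levT]
        rw [if_neg (by omega)]
        congr 1
        omega

theorem IsSpine.isomorphic (h : 𝓑.IsAlmostMetrizable) (hn : 9 ≤ n) (hS : S.card = n)
    (hall : ∀ w, w ∈ S) (H : 𝓑.TwoTwins S y z u v a b) (hs : IsSpine 𝓑 S y z u v a b g i) :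
    𝓑.Isomorphic (structT n (i + 1)) := by
  have hi := hs.lt
  have T1 := H.twin h (by omega)
  have T2 := H.exchange.twin h (by omega)
  have T3 := H.exchange.swap_uv.twin h (by omega)
  have T4 := H.swap_uv.twin h (by omega)
  have hcard : Nat.card 𝓑.carrier = n := by
    have := 𝓑.finite
    have := Fintype.ofFinite 𝓑.carrier
    rw [Nat.card_eq_fintype_card, ← hS, ← Finset.card_univ]
    congr 1
    ext w; simp [hall w]
  have := 𝓑.finite
  have hbij : Function.Bijective (place n g i y z u v) :=
    Function.Surjective.bijective_of_nat_card_le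
      (fun w => hs.place_surjective hS (hall w))
      (by rw [hcard]; exact card_tVertex_le (by omega))
  have hpx : ∀ j, ∃ k, k < S.card - 2 ∧ k = levT n (i + 1) (.x j) ∧
      place n g i y z u v (.x j) = g k ∧ k ≠ i + 1 ∧ k ≠ i + 2 := by
    intro j
    have := levT_lt (n := n) (i := i + 1) (by omega) (.x j)
    exact ⟨_, by omega, rfl, rfl, levT_x_ne j⟩
  have htwin : ∀ s t r : TVertex n, s ≠ t → levT n (i + 1) s = levT n (i + 1) t →
      (levT n (i + 1) r = levT n (i + 1) s + 1 ∨ levT n (i + 1) s = levT n (i + 1) r + 1) →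
      𝓑.btw (place n g i y z u v s) (place n g i y z u v r) (place n g i y z u v t) := by
    intro s t r hst hl hr
    have key : ((s = .y ∨ s = .z) ∧ 𝓑.btw y (place n g i y z u v r) z) ∨
        ((s = .u ∨ s = .v) ∧ 𝓑.btw u (place n g i y z u v r) v) := by
      have hs' := eq_or_eq_of_levT_eq hst hl
      have hsl : ((s = .y ∨ s = .z) ∧ levT n (i + 1) s = i + 1) ∨
          ((s = .u ∨ s = .v) ∧ levT n (i + 1) s = i + 2) := by
        rcases hs' with ⟨rfl, rfl⟩ | ⟨rfl, rfl⟩ | ⟨rfl, rfl⟩ | ⟨rfl, rfl⟩ <;> simp [levT]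
      rcases hsl with ⟨h1, h2⟩ | ⟨h1, h2⟩
      · left
        refine ⟨h1, ?_⟩
        rw [h2] at hr
        rcases r with j | _ | _ | _ | _
        · obtain ⟨k, hk, hk', e, hk1, hk2⟩ := hpx j
          rw [e, show k = i by omega, hs.eq_a]
          exact T1.btw_yz'
        · simp [levT] at hr
        · simp [levT] at hr
        · exact T1.btw_yz
        · exact T4.btw_yz
      · right
        refine ⟨h1, ?_⟩
        rw [h2] at hr
        rcases r with j | _ | _ | _ | _
        · obtain ⟨k, hk, hk', e, hk1, hk2⟩ := hpx j
          rw [e, show k = i + 3 by omega, hs.eq_b]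
          exact T2.btw_yz'
        · exact T2.btw_yz
        · exact T3.btw_yz
        · simp [levT] at hr
        · simp [levT] at hr
    rcases eq_or_eq_of_levT_eq hst hl with ⟨rfl, rfl⟩ | ⟨rfl, rfl⟩ | ⟨rfl, rfl⟩ | ⟨rfl, rfl⟩ <;>
      simp only [reduceCtorEq, or_false, false_and, true_and, or_true, false_or] at key
    · exact key
    · exact h.symm _ _ _ key
    · exact key
    · exact h.symm _ _ _ key
  have hnot : ∀ s t r : TVertex n, s ≠ t → levT n (i + 1) s = levT n (i + 1) t →
      levT n (i + 1) r ≠ levT n (i + 1) s → levT n (i + 1) r ≠ levT n (i + 1) s + 1 →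
      levT n (i + 1) s ≠ levT n (i + 1) r + 1 →
      ¬ 𝓑.Collinear {place n g i y z u v s, place n g i y z u v t, place n g i y z u v r} := by
    have hin : ∀ k, k < S.card - 2 → k ≠ i + 1 → k ≠ i + 2 → g k ∉ [y, z, u, v] := by
      intro k hk h1 h2
      have h3 := hs.isPath.mem hk
      have h4 := hs.isPath.ne hk (show i + 1 < _ by omega) h1
      have h5 := hs.isPath.ne hk (show i + 2 < _ by omega) h2
      rw [hs.eq_y] at h4
      rw [hs.eq_u] at h5
      simp only [Finset.mem_erase] at h3
      simp [h4, h5, h3.1, h3.2.1]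
    intro s t r hst hl hr1 hr2 hr3
    rcases eq_or_eq_of_levT_eq hst hl with ⟨rfl, rfl⟩ | ⟨rfl, rfl⟩ | ⟨rfl, rfl⟩ | ⟨rfl, rfl⟩ <;>
      rcases r with j | _ | _ | _ | _ <;>
      first
      | (exfalso; simp [levT] at hr1; done)
      | (exfalso; simp [levT] at hr2; done)
      | (exfalso; simp [levT] at hr3; done)
      | skip
    all_goals
      obtain ⟨k, hk, hk', e, hk1, hk2⟩ := hpx j
      rw [e]
      rw [← hk'] at hr1 hr2 hr3
      have hm := hin k hk hk1 hk2
      simp only [levT] at hr1 hr2 hr3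
      simp only [place]
    · exact H.not_collinear_yz _ (hall _) hm
        (by rw [← hs.eq_a]; exact hs.isPath.ne hk (by omega) (by omega))
    · rw [Finset.insert_comm]
      exact H.not_collinear_yz _ (hall _) hm
        (by rw [← hs.eq_a]; exact hs.isPath.ne hk (by omega) (by omega))
    · exact H.not_collinear_uv _ (hall _) hm
        (by rw [← hs.eq_b]; exact hs.isPath.ne hk (by omega) (by omega))
    · rw [Finset.insert_comm]
      exact H.not_collinear_uv _ (hall _) hm
        (by rw [← hs.eq_b]; exact hs.isPath.ne hk (by omega) (by omega))
  have htwo : ∀ s t r : TVertex n, s ≠ t → t ≠ r → s ≠ r →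
      levT n (i + 1) s = levT n (i + 1) t → levT n (i + 1) t ≠ levT n (i + 1) r := by
    intro s t r hst htr hsr hl hl'
    have h1 := eq_or_eq_of_levT_eq hst hl
    have h2 := eq_or_eq_of_levT_eq htr hl'
    grind
  have key := btw_iff_levDist h (place n g i y z u v) hbij.1 (hs.btw_place h hn hS H) htwin hnot htwo
  rw [structT_eq (by omega) (by omega)]
  refine ⟨(Equiv.ofBijective _ hbij).symm, fun p q r => ?_⟩
  obtain ⟨p, rfl⟩ := hbij.2 p
  obtain ⟨q, rfl⟩ := hbij.2 q
  obtain ⟨r, rfl⟩ := hbij.2 r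
  rw [key]
  have e : ∀ w, (Equiv.ofBijective _ hbij).symm (place n g i y z u v w) = w := fun w =>
    (Equiv.ofBijective _ hbij).symm_apply_apply w
  show _ ↔ levDist 2 (levT n (i + 1)) ((Equiv.ofBijective _ hbij).symm _)
    ((Equiv.ofBijective _ hbij).symm _) = levDist 2 (levT n (i + 1))
    ((Equiv.ofBijective _ hbij).symm _) ((Equiv.ofBijective _ hbij).symm _) +
    levDist 2 (levT n (i + 1)) ((Equiv.ofBijective _ hbij).symm _)
    ((Equiv.ofBijective _ hbij).symm _)
  rw [e, e, e]

end TwoTwins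

theorem exists_isomorphic_structT {n : ℕ} (hn : 9 ≤ n) (hB : 𝓑 ∈ B n (2 * (n : ℤ) - 10)) :
    ∃ i : ℕ, 1 ≤ i ∧ 2 * i ≤ n - 4 ∧ 𝓑.Isomorphic (structT n i) := by
  obtain ⟨h, hord, hm⟩ := hB
  have := 𝓑.finite
  have := Fintype.ofFinite 𝓑.carrier
  have hS : (Finset.univ : Finset 𝓑.carrier).card = n := by
    rw [Finset.card_univ, ← Nat.card_eq_fintype_card]; exact hord
  rw [coSize_eq] at hm
  obtain ⟨y, z, u, v, a, b, H⟩ := exists_twoTwins h (S := Finset.univ) (by omega) (by omega)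
  obtain ⟨g, i, hs⟩ := H.exists_isSpine h (by omega)
  have hi := hs.lt
  -- Reversing the spine exchanges the two pairs and replaces the index `i + 1` by `n - 5 - i`. The
  -- two indices add up to `n - 4`, so one of them is in range.
  rcases Nat.lt_or_ge (n - 4) (2 * (i + 1)) with hlt | hge
  · refine ⟨n - 6 - i + 1, by omega, by omega, ?_⟩
    have hs' := hs.reverse h
    rw [hS] at hs'
    exact hs'.isomorphic h hn hS (by simp) H.exchange
  · exact ⟨i + 1, by omega, hge, hs.isomorphic h hn hS (by simp) H⟩

end Iso
end BetweennessStructure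

/-! ### Examples, and the triangles of `T_{n,i}`. -/

namespace BetweennessStructure

open Classical

section Examples

theorem exists_lev_eq_of_mem_tri {V : Type u} [Nonempty V] [Finite V] {c : ℕ} {lev : V → ℕ}
    (hc : c = 1 ∨ c = 2) {S T : Finset V} (hT : T ∈ (levelStruct V c lev).tri S) :
    ∃ x ∈ T, ∃ y ∈ T, x ≠ y ∧ lev x = lev y := by
  obtain ⟨-, h3, hn⟩ := mem_tri.1 hT
  by_contra! H
  obtain ⟨x, y, z, hxy, hxz, hyz, rfl⟩ := Finset.card_eq_three.1 h3
  exact hn (levelStruct_collinear_of_ne hc (H x (by simp) y (by simp) hxy)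
    (H y (by simp) z (by simp) hyz) (H x (by simp) z (by simp) hxz))

variable {n : ℕ} {V : Type u}

theorem eq_symm_iff (φ : V ≃ Fin n) {w : V} {k : ℕ} (hk : k < n) :
    w = φ.symm ⟨k, hk⟩ ↔ (φ w : ℕ) = k := by
  rw [Equiv.eq_symm_apply, Fin.ext_iff]

theorem card_eq_sub (φ : V ≃ Fin n) (A : Finset V) (F : Finset ℕ) (hF : F ⊆ Finset.range n)
    (hA : ∀ w, w ∈ A ↔ (φ w : ℕ) ∉ F) : A.card = n - F.card := by
  suffices key : A.card = (Finset.range n \ F).card by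
    rw [key, Finset.card_sdiff_of_subset hF, Finset.card_range]
  refine Finset.card_bij (fun w _ => (φ w : ℕ)) ?_ ?_ ?_
  · intro w hw
    exact Finset.mem_sdiff.2 ⟨Finset.mem_range.2 (φ w).2, (hA w).1 hw⟩
  · intro w _ w' _ H
    exact φ.injective (Fin.ext H)
  · intro k hk
    rw [Finset.mem_sdiff, Finset.mem_range] at hk
    exact ⟨φ.symm ⟨k, hk.1⟩, (hA _).2 (by simpa using hk.2), by simp⟩

variable [Fintype V] [Nonempty V] (φ : V ≃ Fin n)

theorem levelStruct_mem_B (φ : V ≃ Fin n) {c : ℕ} {lev : V → ℕ} (hc : c = 1 ∨ c = 2)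
    {m : ℕ} (hm : ((levelStruct _ c lev).tri (Finset.univ : Finset V)).card = m) :
    levelStruct _ c lev ∈ B n (m : ℤ) := by
  refine ⟨levelStruct_isAlmostMetrizable hc, ?_, ?_⟩
  · show Nat.card V = n
    rw [Nat.card_eq_fintype_card, Fintype.card_congr φ, Fintype.card_fin]
  · rw [coSize_eq (𝓑 := levelStruct V c lev)]
    exact_mod_cast hm

/-- The path of order `n`. -/
theorem exists_mem_B_zero (hn : 1 ≤ n) : (B.{u} n 0).Nonempty := by
  have : NeZero n := ⟨by omega⟩
  let φ : ULift.{u} (Fin n) ≃ Fin n := Equiv.ulift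
  refine ⟨levelStruct _ 1 (fun w => (φ w : ℕ)), levelStruct_mem_B φ (m := 0) (Or.inl rfl) ?_⟩
  rw [Finset.card_eq_zero, Finset.eq_empty_iff_forall_notMem]
  intro T hT
  obtain ⟨x, -, y, -, hxy, hl⟩ := exists_lev_eq_of_mem_tri (Or.inl rfl) hT
  exact hxy (φ.injective (Fin.ext hl))

/-- The levels of the path `0, …, n - 2` with a second point on level `e`. -/
def levTwin (e : ℕ) (w : V) : ℕ :=
  if (φ w : ℕ) = n - 1 then e else φ w

theorem levTwin_tri {c e : ℕ} (hc : c = 1 ∨ c = 2) (he : e + 1 < n)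
    {T : Finset V}
    (hT : T ∈ (levelStruct _ c (levTwin φ e)).tri (Finset.univ : Finset V)) :
    φ.symm ⟨e, by omega⟩ ∈ T ∧ φ.symm ⟨n - 1, by omega⟩ ∈ T := by
  obtain ⟨x, hx, y, hy, hxy, hl⟩ := exists_lev_eq_of_mem_tri hc hT
  have hne : (φ x : ℕ) ≠ φ y := fun H => hxy (φ.injective (Fin.ext H))
  unfold levTwin at hl
  have h1 := (φ x).2
  have h2 := (φ y).2
  split_ifs at hl with hx1 hy1 hy1
  · omega
  · rw [← (eq_symm_iff φ (by omega)).2 hx1, ← (eq_symm_iff φ (by omega)).2 hl.symm]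
    exact ⟨hy, hx⟩
  · rw [← (eq_symm_iff φ (by omega)).2 hy1, ← (eq_symm_iff φ (by omega)).2 hl]
    exact ⟨hx, hy⟩
  · omega

theorem levTwin_sharedPair {c e : ℕ} (hc : c = 1 ∨ c = 2) (he : e + 1 < n) :
    (levelStruct _ c (levTwin φ e)).SharedPair (Finset.univ : Finset V) :=
  ⟨φ.symm ⟨e, by omega⟩, φ.symm ⟨n - 1, by omega⟩,
    fun H => by rw [eq_symm_iff] at H; simp at H; omega, fun _ hT => levTwin_tri φ hc he hT⟩

/-- `F` lists the points that form no triangle with the doubled pair: the pair itself and, for `c =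
2`, the points one level away. -/
theorem levTwin_card_tri {c e : ℕ} (hc : c = 1 ∨ c = 2) (he : e + 1 < n) (F : Finset ℕ)
    (hF : F ⊆ Finset.range n)
    (hF' : ∀ k < n, k ∈ F ↔ k = e ∨ k = n - 1 ∨ (c = 2 ∧ (k = e + 1 ∨ e = k + 1))) :
    ((levelStruct _ c (levTwin φ e)).tri (Finset.univ : Finset V)).card =
      n - F.card := by
  set p : V := φ.symm ⟨e, by omega⟩ with hp
  set q : V := φ.symm ⟨n - 1, by omega⟩ with hq
  have hpq : p ≠ q := fun H => by
    rw [hq, eq_symm_iff] at H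
    simp [hp] at H
    omega
  have lp : levTwin φ e p = e := by simp [levTwin, hp]
  have lq : levTwin φ e q = e := by simp [levTwin, hq]
  have h1 := card_filter_pair (𝓑 := levelStruct _ c (levTwin φ e))
    (S := (Finset.univ : Finset V)) (y := p) (z := q) hpq (Finset.mem_univ _)
    (Finset.mem_univ _)
  have hall : ∀ T ∈ (levelStruct _ c (levTwin φ e)).tri (Finset.univ : Finset V),
      p ∈ T ∧ q ∈ T := fun T hT => levTwin_tri φ hc he hT
  rw [Finset.filter_true_of_mem hall] at h1
  rw [h1]
  refine card_eq_sub φ _ F hF fun w => ?_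
  have hw2 := (φ w).2
  have e1 : w = p ↔ (φ w : ℕ) = e := eq_symm_iff φ _
  have e2 : w = q ↔ (φ w : ℕ) = n - 1 := eq_symm_iff φ _
  rw [hF' _ hw2]
  refine Finset.mem_filter.trans ?_
  have hm : (w ∈ (Finset.univ.erase p).erase q) ↔ w ≠ q ∧ w ≠ p := by simp
  refine (and_congr_left' hm).trans ?_
  by_cases c1 : w = p
  · exact iff_of_false (fun H => H.1.2 c1) (fun H => H (Or.inl (e1.1 c1)))
  by_cases c2 : w = q
  · exact iff_of_false (fun H => H.1.1 c2) (fun H => H (Or.inr (Or.inl (e2.1 c2))))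
  have lw : levTwin φ e w = φ w := if_neg (fun H => c2 (e2.2 H))
  have hwe : (φ w : ℕ) ≠ e := fun H => c1 (e1.2 H)
  have hwq : (φ w : ℕ) ≠ n - 1 := fun H => c2 (e2.2 H)
  have := levelStruct_collinear_twin (lev := levTwin φ e) hc hpq (lp.trans lq.symm) (w := w)
    (by rw [lw, lp]; exact hwe)
  rw [lw, lp] at this
  rw [this]
  simp [c1, c2, hwe, hwq]

/-- The levels of the path `0, …, n - 3` with second points on the levels `1` and `2`. -/
def levTwoTwins (w : V) : ℕ :=
  if (φ w : ℕ) = n - 2 then 1 else if (φ w : ℕ) = n - 1 then 2 else φ w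

/-- Triangles through `z` contain `y`, and the others contain `p` and `q`. Over each pair five
points are excluded as third points: the four paired points and the one on the remaining adjacent
level. Each pair thus contributes `n - 5`. -/
theorem levTwoTwins_card_tri (hn : 6 ≤ n) :
    ((levelStruct _ 2 (levTwoTwins φ)).tri (Finset.univ : Finset V)).card =
      2 * n - 10 := by
  set 𝓑 := levelStruct V 2 (levTwoTwins φ) with h𝓑
  set y : V := φ.symm ⟨1, by omega⟩ with hy
  set z : V := φ.symm ⟨n - 2, by omega⟩ with hz
  set p : V := φ.symm ⟨2, by omega⟩ with hp
  set q : V := φ.symm ⟨n - 1, by omega⟩ with hq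
  have ey : ∀ w : V, w = y ↔ (φ w : ℕ) = 1 := fun w => eq_symm_iff φ _
  have ez : ∀ w : V, w = z ↔ (φ w : ℕ) = n - 2 := fun w => eq_symm_iff φ _
  have ep : ∀ w : V, w = p ↔ (φ w : ℕ) = 2 := fun w => eq_symm_iff φ _
  have eq : ∀ w : V, w = q ↔ (φ w : ℕ) = n - 1 := fun w => eq_symm_iff φ _
  have vy : (φ y : ℕ) = 1 := by simp [hy]
  have vz : (φ z : ℕ) = n - 2 := by simp [hz]
  have vp : (φ p : ℕ) = 2 := by simp [hp]
  have vq : (φ q : ℕ) = n - 1 := by simp [hq]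
  have lev_eq : ∀ w, levTwoTwins φ w =
    if (φ w : ℕ) = n - 2 then 1 else if (φ w : ℕ) = n - 1 then 2 else (φ w : ℕ) := fun _ => rfl
  have ly : levTwoTwins φ y = 1 := by rw [lev_eq, vy]; split_ifs <;> omega
  have lz : levTwoTwins φ z = 1 := by rw [lev_eq, vz]; split_ifs <;> omega
  have lp : levTwoTwins φ p = 2 := by rw [lev_eq, vp]; split_ifs <;> omega
  have lq : levTwoTwins φ q = 2 := by rw [lev_eq, vq]; split_ifs <;> omega
  have hyz : y ≠ z := by rw [Ne, ez, vy]; omega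
  have hpq : p ≠ q := by rw [Ne, eq, vp]; omega
  have hzp : z ≠ p := by rw [Ne, ep, vz]; omega
  have hzq : z ≠ q := by rw [Ne, eq, vz]; omega
  have hpair : ∀ T ∈ 𝓑.tri Finset.univ, (y ∈ T ∧ z ∈ T) ∨ (p ∈ T ∧ q ∈ T) := by
    intro T hT
    obtain ⟨x, hx, x', hx', hxx, hl⟩ := exists_lev_eq_of_mem_tri (Or.inr rfl) hT
    have hne : (φ x : ℕ) ≠ φ x' := fun H => hxx (φ.injective (Fin.ext H))
    have key : (x = y ∧ x' = z) ∨ (x = z ∧ x' = y) ∨ (x = p ∧ x' = q) ∨ (x = q ∧ x' = p) := by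
      rw [ey, ez, ez, ey, ep, eq, eq, ep]
      rw [lev_eq, lev_eq] at hl
      have h1 := (φ x).2
      have h2 := (φ x').2
      split_ifs at hl <;> omega
    rcases key with ⟨rfl, rfl⟩ | ⟨rfl, rfl⟩ | ⟨rfl, rfl⟩ | ⟨rfl, rfl⟩ <;> simp [hx, hx']
  have hzT : ∀ T ∈ 𝓑.tri Finset.univ, z ∈ T → y ∈ T ∧ z ∈ T := by
    intro T hT hzT'
    rcases hpair T hT with H | H
    · exact H
    · exfalso
      have hT' := mem_tri.1 hT
      obtain ⟨w, -, -, rfl⟩ := exists_third hT'.2.1 hpq H.1 H.2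
      have : z = w := by
        simp only [Finset.mem_insert, Finset.mem_singleton] at hzT'
        rcases hzT' with H | H | H
        · exact absurd H hzp
        · exact absurd H hzq
        · exact H
      subst this
      exact hT'.2.2 ((levelStruct_collinear_twin (Or.inr rfl) hpq (lp.trans lq.symm)
        (by rw [lz, lp]; omega)).2 ⟨rfl, Or.inr (by rw [lz, lp])⟩)
  have hpqT : ∀ T ∈ 𝓑.tri (Finset.univ.erase z), p ∈ T ∧ q ∈ T := by
    intro T hT
    rw [mem_tri_erase] at hT
    exact (hpair T hT.1).resolve_left fun H => hT.2 H.2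
  have c1 : 𝓑.triDegree Finset.univ z = n - 5 := by
    have e : ((𝓑.tri Finset.univ).filter fun T => z ∈ T) =
        (𝓑.tri Finset.univ).filter fun T => y ∈ T ∧ z ∈ T := by
      ext T
      rw [Finset.mem_filter, Finset.mem_filter]
      exact ⟨fun H => ⟨H.1, hzT T H.1 H.2⟩, fun H => ⟨H.1, H.2.2⟩⟩
    rw [triDegree, e, card_filter_pair hyz (Finset.mem_univ _) (Finset.mem_univ _)]
    have hF : ({0, 1, 2, n - 2, n - 1} : Finset ℕ).card = 5 := by
      repeat rw [Finset.card_insert_of_notMem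
        (by simp only [Finset.mem_insert, Finset.mem_singleton]; omega)]
      simp
    rw [← hF]
    refine card_eq_sub φ _ _ ?_ fun w => ?_
    · intro k
      simp only [Finset.mem_insert, Finset.mem_singleton, Finset.mem_range]
      omega
    · refine Finset.mem_filter.trans ?_
      have hm : (w ∈ (Finset.univ.erase y).erase z) ↔ w ≠ z ∧ w ≠ y := by simp
      refine (and_congr_left' hm).trans ?_
      simp only [Finset.mem_insert, Finset.mem_singleton]
      rw [Ne, Ne, ez, ey]
      by_cases c1 : (φ w : ℕ) = n - 2 ∨ (φ w : ℕ) = 1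
      · refine iff_of_false (fun H => ?_) (fun H => ?_) <;> omega
      have hl : levTwoTwins φ w ≠ 1 := by rw [lev_eq]; split_ifs <;> omega
      have := levelStruct_collinear_twin (lev := levTwoTwins φ) (Or.inr rfl) hyz (ly.trans lz.symm)
        (w := w) (by rw [ly]; exact hl)
      refine (and_congr_right' (not_congr this)).trans ?_
      rw [ly, lev_eq]
      split_ifs <;> omega
  have c2 : (𝓑.tri (Finset.univ.erase z)).card = n - 5 := by
    have h1 := card_filter_pair (𝓑 := 𝓑) (S := Finset.univ.erase z) hpq
      (Finset.mem_erase.2 ⟨hzp.symm, Finset.mem_univ _⟩)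
      (Finset.mem_erase.2 ⟨hzq.symm, Finset.mem_univ _⟩)
    rw [Finset.filter_true_of_mem hpqT] at h1
    rw [h1]
    have hF : ({1, 2, 3, n - 2, n - 1} : Finset ℕ).card = 5 := by
      repeat rw [Finset.card_insert_of_notMem
        (by simp only [Finset.mem_insert, Finset.mem_singleton]; omega)]
      simp
    rw [← hF]
    refine card_eq_sub φ _ _ ?_ fun w => ?_
    · intro k
      simp only [Finset.mem_insert, Finset.mem_singleton, Finset.mem_range]
      omega
    · refine Finset.mem_filter.trans ?_
      have hm : (w ∈ ((Finset.univ.erase z).erase p).erase q) ↔ w ≠ q ∧ w ≠ p ∧ w ≠ z := by simp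
      refine (and_congr_left' hm).trans ?_
      simp only [Finset.mem_insert, Finset.mem_singleton]
      rw [Ne, Ne, Ne, ez, ep, eq]
      by_cases c1 : (φ w : ℕ) = n - 2 ∨ (φ w : ℕ) = 2 ∨ (φ w : ℕ) = n - 1
      · refine iff_of_false (fun H => ?_) (fun H => ?_) <;> omega
      have hl : levTwoTwins φ w ≠ 2 := by rw [lev_eq]; split_ifs <;> omega
      have := levelStruct_collinear_twin (lev := levTwoTwins φ) (Or.inr rfl) hpq (lp.trans lq.symm)
        (w := w) (by rw [lp]; exact hl)
      refine (and_congr_right' (not_congr this)).trans ?_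
      rw [lp, lev_eq]
      split_ifs <;> omega
  rw [card_tri_eq (𝓑 := 𝓑) Finset.univ z, c1, c2]
  omega

theorem exists_mem_B_two_mul_sub_ten (hn : 6 ≤ n) : (B.{u} n (2 * (n : ℤ) - 10)).Nonempty := by
  have : NeZero n := ⟨by omega⟩
  let φ : ULift.{u} (Fin n) ≃ Fin n := Equiv.ulift
  have h := levelStruct_mem_B φ (Or.inr rfl) (levTwoTwins_card_tri φ hn)
  rw [show ((2 * n - 10 : ℕ) : ℤ) = 2 * (n : ℤ) - 10 by omega] at h
  exact ⟨_, h⟩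

/-- Structures with `n - 4`, `n - 3` and `n - 2` triangles that have a common pair. -/
theorem exists_sharedPair_mem_B {m : ℕ} (hn : 6 ≤ n) (h1 : n ≤ m + 4) (h2 : m + 2 ≤ n) :
    ∃ 𝓑 ∈ B.{u} n (m : ℤ), ∃ p q, p ≠ q ∧ ∀ T ∈ 𝓑.triangles, p ∈ T ∧ q ∈ T := by
  have : NeZero n := ⟨by omega⟩
  let φ : ULift.{u} (Fin n) ≃ Fin n := Equiv.ulift
  have key : ∀ c e : ℕ, (c = 1 ∨ c = 2) → e + 1 < n →
      ((levelStruct _ c (levTwin φ e)).tri (Finset.univ : Finset (ULift.{u} (Fin n)))).card = m →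
      ∃ 𝓑 ∈ B.{u} n (m : ℤ), ∃ p q, p ≠ q ∧ ∀ T ∈ 𝓑.triangles, p ∈ T ∧ q ∈ T := by
    intro c e hc he hm
    obtain ⟨p, q, hpq, H⟩ := levTwin_sharedPair φ hc he
    exact ⟨_, levelStruct_mem_B φ hc hm, p, q, hpq, fun T hT =>
      H T (mem_tri.2 ⟨fun x _ => Finset.mem_univ x, hT⟩)⟩
  have hm : m = n - 2 ∨ m = n - 3 ∨ m = n - 4 := by omega
  -- For `c = 1` no level is exempt; for `c = 2` the doubled end `e = 0` has one adjacent level and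
  -- the inner level `e = 1` has two.
  rcases hm with hm | hm | hm
  · refine key 1 0 (Or.inl rfl) (by omega) ?_
    have hF : ({0, n - 1} : Finset ℕ).card = 2 := Finset.card_pair (by omega)
    rw [hm, ← hF]
    refine levTwin_card_tri φ (Or.inl rfl) (by omega) _ (fun k => ?_) (fun k => ?_)
    · simp only [Finset.mem_insert, Finset.mem_singleton, Finset.mem_range]
      omega
    · simp
  · refine key 2 0 (Or.inr rfl) (by omega) ?_
    have hF : ({0, 1, n - 1} : Finset ℕ).card = 3 := by
      repeat rw [Finset.card_insert_of_notMem
        (by simp only [Finset.mem_insert, Finset.mem_singleton]; omega)]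
      simp
    rw [hm, ← hF]
    refine levTwin_card_tri φ (Or.inr rfl) (by omega) _ ?_ ?_ <;> intro k <;>
      norm_num <;> omega
  · refine key 2 1 (Or.inr rfl) (by omega) ?_
    have hF : ({0, 1, 2, n - 1} : Finset ℕ).card = 4 := by
      repeat rw [Finset.card_insert_of_notMem
        (by simp only [Finset.mem_insert, Finset.mem_singleton]; omega)]
      simp
    rw [hm, ← hF]
    refine levTwin_card_tri φ (Or.inr rfl) (by omega) _ ?_ ?_ <;> intro k <;>
      norm_num <;> omega

theorem Isomorphic.exists_common_pair {𝓐 : BetweennessStructure.{u}} {𝓑 : BetweennessStructure.{v}}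
    (h : 𝓐.Isomorphic 𝓑) (hp : ∃ p q, p ≠ q ∧ ∀ T ∈ 𝓐.triangles, p ∈ T ∧ q ∈ T) :
    ∃ p q, p ≠ q ∧ ∀ T ∈ 𝓑.triangles, p ∈ T ∧ q ∈ T := by
  obtain ⟨e, he⟩ := h
  obtain ⟨p, q, hpq, H⟩ := hp
  refine ⟨e p, e q, fun heq => hpq (e.injective heq), fun T hT => ?_⟩
  have hT' : T.map e.symm.toEmbedding ∈ 𝓐.triangles := by
    refine ⟨by rw [Finset.card_map]; exact hT.1, ?_⟩
    rintro ⟨x, hx, y, hy, z, hz, hxy, hyz, hxz, hb⟩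
    rw [Finset.mem_map_equiv, Equiv.symm_symm] at hx hy hz
    exact hT.2 ⟨e x, hx, e y, hy, e z, hz, fun H => hxy (e.injective H),
      fun H => hyz (e.injective H), fun H => hxz (e.injective H), (he _ _ _).1 hb⟩
  have := H _ hT'
  rwa [Finset.mem_map_equiv, Finset.mem_map_equiv, Equiv.symm_symm] at this

theorem levelStruct_twin_mem_triangles {W : Type u} [Nonempty W] [Finite W] {lev : W → ℕ}
    {x y w : W} (hxy : x ≠ y) (hl : lev x = lev y) (h : lev w + 2 ≤ lev x ∨ lev x + 2 ≤ lev w) :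
    ({x, y, w} : Finset W) ∈ (levelStruct W 2 lev).triangles := by
  refine ⟨Finset.card_eq_three.2 ⟨x, y, w, hxy, ?_, ?_, rfl⟩, fun hc => ?_⟩
  · rintro rfl
    omega
  · rintro rfl
    omega
  · have := ((levelStruct_collinear_twin (Or.inr rfl) hxy hl (by omega)).1 hc).2
    omega

/-- The triangles of `T_{n,i}` have no common point. -/
theorem structT_not_common_point {i : ℕ} (hi : 1 ≤ i) (hin : i + 1 ≤ n - 4) :
    ¬ ∃ p, ∀ T ∈ (structT n i).triangles, p ∈ T := by
  rw [structT_eq hi hin]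
  rintro ⟨p, H⟩
  change TVertex n at p
  obtain ⟨a, ha⟩ : ∃ a : Finset.Icc 1 (n - 4), (a : ℕ) = i + 1 :=
    ⟨⟨i + 1, Finset.mem_Icc.2 (by omega)⟩, rfl⟩
  obtain ⟨b, hb⟩ : ∃ b : Finset.Icc 1 (n - 4), (b : ℕ) = i :=
    ⟨⟨i, Finset.mem_Icc.2 (by omega)⟩, rfl⟩
  have l1 : levT n i (.x a) = i + 2 := by
    simp only [levT, ha]
    rw [if_neg (by omega)]
  have l2 : levT n i (.x b) = i - 1 := by
    simp only [levT, hb]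
    rw [if_pos le_rfl]
  have hab : a ≠ b := fun h => by
    rw [h] at ha
    omega
  -- These two triangles are disjoint: each pair is combined with the path vertex two levels away,
  -- beyond the other pair.
  have h1 : p ∈ ({.y, .z, .x a} : Finset (TVertex n)) :=
    H _ (levelStruct_twin_mem_triangles (by simp) rfl (Or.inr (by rw [l1]; simp [levT])))
  have h2 : p ∈ ({.u, .v, .x b} : Finset (TVertex n)) :=
    H _ (levelStruct_twin_mem_triangles (by simp) rfl
      (Or.inl (by rw [l2]; simp only [levT]; omega)))
  simp only [Finset.mem_insert, Finset.mem_singleton] at h1 h2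
  rcases h1 with rfl | rfl | rfl <;> simp [hab] at h2

theorem le_ceil_iff {n i : ℕ} (hn : 5 ≤ n) : (i : ℤ) ≤ ⌈((n : ℚ) - 5) / 2⌉ ↔ 2 * i ≤ n - 4 := by
  rw [Int.le_ceil_iff, lt_div_iff₀ (by norm_num)]
  rw [show ((((i : ℤ) : ℚ) - 1) * 2 < (n : ℚ) - 5) ↔ ((2 * i + 3 : ℕ) : ℚ) < ((n : ℕ) : ℚ) by
    push_cast; constructor <;> intro h <;> linarith]
  rw [Nat.cast_lt]
  omega

theorem mem_B_cases {m : ℤ} {𝓑 : BetweennessStructure.{u}} (hB : 𝓑 ∈ B n m) (hn : 6 ≤ n)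
    (hm : m + 11 ≤ 2 * n) : m = 0 ∨ (n - 4 ≤ m ∧ m ≤ n - 2) := by
  obtain ⟨h, hord, hc⟩ := hB
  have := 𝓑.finite
  have := Fintype.ofFinite 𝓑.carrier
  have hS : (Finset.univ : Finset 𝓑.carrier).card = n := by
    rw [Finset.card_univ, ← Nat.card_eq_fintype_card]; exact hord
  rw [coSize_eq] at hc
  have := card_tri_cases h (S := Finset.univ) (by omega) (by omega)
  omega

end Examples
end BetweennessStructure

/-! ### Assembly of the theorem. -/

theorem theorem6 :
    (∀ c : ℤ, 11 ≤ c → ∀ n : ℕ,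
      (BetweennessStructure.B.{u} n (2 * (n : ℤ) - c)).Nonempty ↔
        ((n : ℚ) = (c : ℚ) / 2 ∨ (c - 4 ≤ (n : ℤ) ∧ (n : ℤ) ≤ c - 2))) ∧
    (∀ n : ℕ, (BetweennessStructure.B.{u} n (2 * (n : ℤ) - 10)).Nonempty ↔ 5 ≤ n) ∧
    (∀ n : ℕ, 9 ≤ n → ∀ 𝓑 ∈ BetweennessStructure.B.{u} n (2 * (n : ℤ) - 10),
      ∃ i : ℕ, 1 ≤ i ∧ (i : ℤ) ≤ ⌈((n : ℚ) - 5) / 2⌉ ∧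
        𝓑.Isomorphic (BetweennessStructure.structT n i)) ∧
    (∀ n : ℕ, 6 ≤ n → n < 9 → ∃ 𝓑 ∈ BetweennessStructure.B.{u} n (2 * (n : ℤ) - 10),
      ∀ i : ℕ, 1 ≤ i → (i : ℤ) ≤ ⌈((n : ℚ) - 5) / 2⌉ →
        ¬ 𝓑.Isomorphic (BetweennessStructure.structT n i)) := by
  refine ⟨fun c hc n => ?_, fun n => ?_, fun n hn 𝓑 hB => ?_, fun n h6 h9 => ?_⟩
  · have hhalf : (n : ℚ) = (c : ℚ) / 2 ↔ 2 * (n : ℤ) - c = 0 := by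
      rw [eq_div_iff (by norm_num), sub_eq_zero, mul_comm]
      exact_mod_cast Iff.rfl
    rw [hhalf]
    constructor
    · rintro ⟨𝓑, hB⟩
      -- Nonnegativity of the co-size together with `c ≥ 11` gives `n ≥ 6`, as the counting bounds
      -- require.
      have h0 : (0 : ℤ) ≤ 2 * (n : ℤ) - c := hB.2.2 ▸ Int.natCast_nonneg _
      have := BetweennessStructure.mem_B_cases hB (by omega) (by omega)
      omega
    · rintro (h | ⟨h1, h2⟩)
      · rw [h]
        exact BetweennessStructure.exists_mem_B_zero (by omega)
      · obtain ⟨m, hm⟩ := Int.eq_ofNat_of_zero_le (show 0 ≤ 2 * (n : ℤ) - c by omega)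
        obtain ⟨𝓑, hB, -⟩ := BetweennessStructure.exists_sharedPair_mem_B.{u} (n := n) (m := m)
          (by omega) (by omega) (by omega)
        rw [hm]
        exact ⟨𝓑, hB⟩
  · constructor
    · rintro ⟨𝓑, hB⟩
      have h0 : (0 : ℤ) ≤ 2 * (n : ℤ) - 10 := hB.2.2 ▸ Int.natCast_nonneg _
      omega
    · intro hn
      rcases hn.eq_or_lt with rfl | hn
      · exact BetweennessStructure.exists_mem_B_zero (by omega)
      · exact BetweennessStructure.exists_mem_B_two_mul_sub_ten (by omega)
  · obtain ⟨i, hi, hle, hiso⟩ := BetweennessStructure.exists_isomorphic_structT hn hB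
    exact ⟨i, hi, (BetweennessStructure.le_ceil_iff (by omega)).2 hle, hiso⟩
  -- For `n = 6, 7, 8` the number `2n - 10` equals `n - 4`, `n - 3`, `n - 2`, so a path with one
  -- doubled point attains it. The common pair of its triangles would be carried over by an
  -- isomorphism.
  · obtain ⟨𝓑, hB, hp⟩ := BetweennessStructure.exists_sharedPair_mem_B.{u} (n := n)
      (m := 2 * n - 10) h6 (by omega) (by omega)
    rw [show ((2 * n - 10 : ℕ) : ℤ) = 2 * (n : ℤ) - 10 by omega] at hB
    refine ⟨𝓑, hB, fun i hi hle hiso => ?_⟩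
    rw [BetweennessStructure.le_ceil_iff (by omega)] at hle
    obtain ⟨p, q, -, H⟩ := hiso.exists_common_pair hp
    exact BetweennessStructure.structT_not_common_point hi (by omega) ⟨p, fun T hT => (H T hT).1⟩
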